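/- Conventions. $V_\alpha$ is the $\alpha$-th level of the von Neumann hierarchy. "Definable" means first-order definable with parameters. A cardinal $\delta$ is a *Vopěnka cardinal* if $\delta$ is (strongly) inaccessible and for every first-order language $\mathcal L$ of size less than $\delta$ and every set $\mathcal M\subseteq V_\delta$ of $\delta$ many $\mathcal L$-structures, there are $M\neq N$ in $\mathcal M$ with an elementary embedding $M\to N$. A cardinal $\gamma$ is a *Vopěnka-scheme cardinal* if $V_\gamma$ satisfies ZFC and the Vopěnka scheme, that is, for every language $\mathcal L\in V_\gamma$, every proper class $\mathcal M\subseteq V_\gamma$, $\mathcal M\notin V_\gamma$, of $\mathcal L$-structures that is definable in $\langle V_\gamma,\in\rangle$ has members $M\ne N$ with an elementary embedding $M\to N$. For a cardinal $\delta$ and $A\subseteq V_\delta$, a cardinal $\kappa<\delta$ is *$(<\delta,A)$-extendible* if for every ordinal $\lambda$ with $\kappa<\lambda<\delta$ there are an ordinal $\theta<\delta$ and an elementary embedding $j:\langle V_\lambda,\in,A\cap V_\lambda\rangle\to\langle V_\theta,\in,A\cap V_\theta\rangle$ with critical point $\kappa$ and $\lambda<j(\kappa)$. **Corollary 2.5.**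 Let $\delta$ be a Vopěnka cardinal. 1. There is a closed unbounded set $C\subseteq\delta$ all of whose elements are Vopěnka-scheme cardinals. 2. The set of inaccessible Vopěnka-scheme cardinals below $\delta$ is stationary in $\delta$. 3. For every $A\subseteq V_\delta$, the set of $(<\delta,A)$-extendible Vopěnka-scheme cardinals below $\delta$ is stationary in $\delta$. Consequently, the existence of a Vopěnka cardinal is strictly stronger in consistency strength over ZFC than the existence of a Vopěnka-scheme cardinal, in the following sense: if the theory ZFC + "there is a Vopěnka cardinal" is consistent, then so is the theory ZFC + "there is a Vopěnka-scheme cardinal"; and moreover the theory ZFC + "there is a Vopěnka cardinal" proves the sentence $\mathrm{Con}(\text{ZFC + "there is a Vopěnka-scheme cardinal"})$. -/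

import Mathlib

universe u v

/-! ## The axioms of ZFC in a structure `(X, E)` -/

/-- The relation symbols of the language of set theory: one binary symbol. -/
inductive MemRel : ℕ → Type
  | mem : MemRel 2

/-- The first-order language of set theory. -/
def setLang : FirstOrder.Language.{0, 0} := ⟨fun _ => Empty, MemRel⟩

/-- A binary relation `E` on `X`, viewed as a structure in the language of set theory. -/
@[reducible]
def relStructure {X : Type v} (E : X → X → Prop) : setLang.Structure X where
  funMap := fun f => nomatch f
  RelMap := fun {_} r => match r with
    | MemRel.mem => fun t => E (t 0) (t 1)

/-- `D` is a class of `(X, E)` that is first-order definable with parameters. -/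
def IsDefinableClass {X : Type v} (E : X → X → Prop) (D : Set X) : Prop :=
  letI := relStructure E
  (Set.univ : Set X).Definable₁ setLang D

/-- `D` is a class of pairs over `(X, E)` that is first-order definable with parameters. -/
def IsDefinableRelation {X : Type v} (E : X → X → Prop) (D : Set (X × X)) : Prop :=
  letI := relStructure E
  (Set.univ : Set X).Definable₂ setLang D

/-- The axioms of ZFC for the membership relation `E` on `X`. The separation scheme is asserted
for the classes in `D₁`, the replacement scheme for the binary relations in `D₂`. -/
structure ZFCAxioms {X : Type v} (E : X → X → Prop) (D₁ : Set X → Prop)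
    (D₂ : Set (X × X) → Prop) : Prop where
  extensionality : ∀ x y, (∀ z, E z x ↔ E z y) → x = y
  foundation : ∀ x, (∃ y, E y x) → ∃ y, E y x ∧ ∀ z, E z x → ¬ E z y
  pairing : ∀ x y, ∃ z, ∀ w, E w z ↔ w = x ∨ w = y
  union : ∀ x, ∃ z, ∀ w, E w z ↔ ∃ y, E y x ∧ E w y
  powerset : ∀ x, ∃ z, ∀ y, E y z ↔ ∀ w, E w y → E w x
  infinity : ∃ z, (∃ o, E o z ∧ ∀ w, ¬ E w o) ∧
    ∀ n, E n z → ∃ m, E m z ∧ ∀ w, E w m ↔ E w n ∨ w = n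
  separation : ∀ D, D₁ D → ∀ a, ∃ b, ∀ x, E x b ↔ E x a ∧ x ∈ D
  replacement : ∀ D, D₂ D → ∀ a, (∀ x, E x a → ∃! y, (x, y) ∈ D) →
    ∃ b, ∀ y, E y b ↔ ∃ x, E x a ∧ (x, y) ∈ D
  choice : ∀ a, (∀ x, E x a → ∃ y, E y x) →
    (∀ x y z, E x a → E y a → E z x → E z y → x = y) →
    ∃ c, ∀ x, E x a → ∃! y, E y x ∧ E y c

/-- `(X, E)` is a model of ZFC. -/
def ModelsZFC {X : Type v} (E : X → X → Prop) : Prop :=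
  ZFCAxioms E (IsDefinableClass E) (IsDefinableRelation E)

/-! ## Vopěnka cardinals, Vopěnka-scheme cardinals and extendibility, in the universe `ZFSet` -/

section Ambient

open ZFSet Cardinal FirstOrder

/-- The finite von Neumann ordinal `n`. -/
noncomputable def numeral (n : ℕ) : ZFSet.{u} := (n : Ordinal.{u}).toZFSet

/-- A finite tuple as a set, namely as a function with domain `n`. -/
noncomputable def tupleSet {n : ℕ} (t : Fin n → ZFSet.{u}) : ZFSet.{u} :=
  ZFSet.range fun i : Fin n => pair (numeral i) (t i)

/-- The first-order language given by a set `F` of function symbols and a set `R` of relation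
symbols. A symbol of arity `n` is an ordered pair `(s, n)`. -/
def codedLanguage (F R : ZFSet.{u}) : FirstOrder.Language.{u + 1, u + 1} :=
  ⟨fun n => {s : ZFSet.{u} // pair s (numeral n) ∈ F},
   fun n => {s : ZFSet.{u} // pair s (numeral n) ∈ R}⟩

/-- A first-order structure for the language `(F, R)` whose domain is a nonempty set. -/
structure SetStructure (F R : ZFSet.{u}) where
  carrier : ZFSet.{u}
  nonempty : carrier.Nonempty
  str : (codedLanguage F R).Structure carrier

instance {F R : ZFSet.{u}} (A : SetStructure F R) : (codedLanguage F R).Structure A.carrier :=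
  A.str

/-- The set `x` is the structure `A`, that is, `x = (a, (f, r))` where `a` is the domain of `A`, and
`f` and `r` are the sets that collect the interpretations of the function and of the relation
symbols. -/
def SetStructure.HasCode {F R : ZFSet.{u}} (A : SetStructure F R) (x : ZFSet.{u}) : Prop :=
  ∃ f r : ZFSet.{u}, x = pair A.carrier (pair f r) ∧
    (∀ z, z ∈ f ↔ ∃ (n : ℕ) (s : (codedLanguage F R).Functions n) (t : Fin n → A.carrier),
      z = pair (pair (pair s.1 (numeral n)) (tupleSet fun i => (t i).1))
        (FirstOrder.Language.Structure.funMap s t).1) ∧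
    (∀ z, z ∈ r ↔ ∃ (n : ℕ) (s : (codedLanguage F R).Relations n) (t : Fin n → A.carrier),
      FirstOrder.Language.Structure.RelMap s t ∧
      z = pair (pair s.1 (numeral n)) (tupleSet fun i => (t i).1))

/-- `𝓜` is a class of structures for the language `(F, R)`. -/
def IsClassOfStructures (F R : ZFSet.{u}) (𝓜 : Set ZFSet.{u}) : Prop :=
  ∀ x ∈ 𝓜, ∃ A : SetStructure F R, A.HasCode x

/-- There are distinct members of `𝓜` with an elementary embedding between them. -/
def HasElementaryEmbedding (F R : ZFSet.{u}) (𝓜 : Set ZFSet.{u}) : Prop :=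
  ∃ (x y : ZFSet.{u}) (A B : SetStructure F R), x ∈ 𝓜 ∧ y ∈ 𝓜 ∧ x ≠ y ∧
    A.HasCode x ∧ B.HasCode y ∧ Nonempty (A.carrier ↪ₑ[codedLanguage F R] B.carrier)

/-- `δ` is a Vopěnka cardinal: it is inaccessible, and every set `𝓜 ⊆ V_δ` of `δ` many first-order
structures in a common language of size less than `δ` has distinct members with an elementary
embedding between them. -/
def IsVopenkaCardinal (δ : Cardinal.{u}) : Prop :=
  δ.IsInaccessible ∧
    ∀ F R 𝓜 : ZFSet.{u}, F.card < δ → R.card < δ → 𝓜 ⊆ V_ δ.ord → 𝓜.card = δ →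
      IsClassOfStructures F R {x | x ∈ 𝓜} → HasElementaryEmbedding F R {x | x ∈ 𝓜}

/-- The membership relation of `V_α`. -/
def rankMem (α : Ordinal.{u}) (x y : {x : ZFSet.{u} // x ∈ V_ α}) : Prop := x.1 ∈ y.1

/-- `V_α` satisfies the Vopěnka scheme: for every language in `V_α`, every proper class of
structures of that language which is definable with parameters in `(V_α, ∈)` has distinct
members with an elementary embedding between them. -/
def RankSatisfiesVopenkaScheme (α : Ordinal.{u}) : Prop :=
  ∀ F ∈ V_ α, ∀ R ∈ V_ α, ∀ 𝓜 : Set {x : ZFSet.{u} // x ∈ V_ α},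
    IsDefinableClass (rankMem α) 𝓜 →
    (¬ ∃ c ∈ V_ α, ∀ x, x ∈ c ↔ x ∈ Subtype.val '' 𝓜) →
    IsClassOfStructures F R (Subtype.val '' 𝓜) → HasElementaryEmbedding F R (Subtype.val '' 𝓜)

/-- `γ` is a Vopěnka-scheme cardinal: `V_γ` is a model of ZFC plus the Vopěnka scheme. -/
def IsVopenkaSchemeCardinal (γ : Cardinal.{u}) : Prop :=
  ModelsZFC (rankMem γ.ord) ∧ RankSatisfiesVopenkaScheme γ.ord

/-- The relation symbols of the language of set theory with an additional unary predicate. -/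
inductive MemPredRel : ℕ → Type
  | mem : MemPredRel 2
  | pred : MemPredRel 1

/-- The language of set theory with an additional unary predicate. -/
def setPredLang : FirstOrder.Language.{0, 0} := ⟨fun _ => Empty, MemPredRel⟩

/-- The domain of the structure `⟨V_α, ∈, A ∩ V_α⟩`. -/
def RankWith (_A : ZFSet.{u}) (α : Ordinal.{u}) : Type (u + 1) := {x : ZFSet.{u} // x ∈ V_ α}

/-- The structure `⟨V_α, ∈, A ∩ V_α⟩`. -/
instance (A : ZFSet.{u}) (α : Ordinal.{u}) : setPredLang.Structure (RankWith A α) where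
  funMap := fun f => nomatch f
  RelMap := fun {_} r => match r with
    | MemPredRel.mem => fun t => (t 0).1 ∈ (t 1).1
    | MemPredRel.pred => fun t => (t 0).1 ∈ A

/-- `κ` is `(<δ, A)`-extendible: `κ < δ`, and for every ordinal `l` with `κ < l < δ` there are
`θ < δ` and an elementary embedding `j : ⟨V_l, ∈, A ∩ V_l⟩ → ⟨V_θ, ∈, A ∩ V_θ⟩` with critical
point `κ` and `l < j(κ)`. -/
def IsExtendibleBelow (δ : Cardinal.{u}) (A : ZFSet.{u}) (κ : Cardinal.{u}) : Prop :=
  κ < δ ∧ ∀ l : Ordinal.{u}, κ.ord < l → l < δ.ord →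
    ∃ θ < δ.ord, ∃ j : RankWith A l ↪ₑ[setPredLang] RankWith A θ,
      (∀ α < κ.ord, ∀ x : RankWith A l, x.1 = α.toZFSet → (j x).1 = α.toZFSet) ∧
      ∃ (k : RankWith A l) (μ : Ordinal.{u}),
        k.1 = κ.ord.toZFSet ∧ (j k).1 = μ.toZFSet ∧ μ ≠ κ.ord ∧ l < μ

end Ambient

/-! ## The same notions as first-order properties of an arbitrary structure `(M, E)`

All definitions in this part only quantify over elements of `M`, so that each of them is the
interpretation in `(M, E)` of a first-order formula of the language of set theory. In particular
they can be applied to models of ZFC that are not well-founded, and formulas, satisfaction and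
the ordinals are then those of the model. -/

namespace SetModel

variable {M : Type v} (E : M → M → Prop)

def IsEmptySet (x : M) : Prop := ∀ y, ¬ E y x

def Subset (x y : M) : Prop := ∀ z, E z x → E z y

/-- `z = {x, y}` -/
def IsPair (z x y : M) : Prop := ∀ w, E w z ↔ w = x ∨ w = y

/-- `z` is the Kuratowski pair `(x, y) = {{x}, {x, y}}`. -/
def IsOPair (z x y : M) : Prop := ∃ a b, IsPair E a x x ∧ IsPair E b x y ∧ IsPair E z a b

/-- `y = x ∪ {x}` -/
def IsSucc (y x : M) : Prop := ∀ z, E z y ↔ E z x ∨ z = x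

def IsPowerset (p x : M) : Prop := ∀ y, E y p ↔ Subset E y x

/-- `x` is an ordinal, that is, a transitive set of transitive sets. -/
def IsOrd (x : M) : Prop :=
  (∀ y, E y x → Subset E y x) ∧ ∀ y, E y x → ∀ z, E z y → Subset E z y

/-- `n` is a natural number of the model. -/
def IsNat (n : M) : Prop :=
  IsOrd E n ∧ ∀ k, (k = n ∨ E k n) → IsEmptySet E k ∨ ∃ l, IsSucc E k l

/-- `w = ω` -/
def IsOmega (w : M) : Prop := ∀ n, E n w ↔ IsNat E n

/-- `x` is the von Neumann numeral of the (standard) number `n`. -/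
def IsNumeral : ℕ → M → Prop
  | 0, x => IsEmptySet E x
  | n + 1, x => ∃ y, IsNumeral n y ∧ IsSucc E x y

/-- `(x, y) ∈ f` -/
def App (f x y : M) : Prop := ∃ z, E z f ∧ IsOPair E z x y

/-- `f` is a function from `a` to `b`. -/
def IsFun (f a b : M) : Prop :=
  (∀ z, E z f → ∃ x y, E x a ∧ E y b ∧ IsOPair E z x y) ∧ ∀ x, E x a → ∃! y, App E f x y

/-- `f` is an injection from `a` to `b`. -/
def IsInj (f a b : M) : Prop :=
  IsFun E f a b ∧ ∀ x x' y, App E f x y → App E f x' y → x = x'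

/-- `f` is a bijection from `a` to `b`. -/
def IsBij (f a b : M) : Prop :=
  IsInj E f a b ∧ ∀ y, E y b → ∃ x, App E f x y

/-- `h` is the composition `g ∘ f`. -/
def IsComp (h g f : M) : Prop :=
  ∀ z, E z h ↔ ∃ x y w, IsOPair E z x w ∧ App E f x y ∧ App E g y w

/-- `v = V_α`: some function `f` on `α + 1` satisfies `f(β) = ⋃_{ξ < β} P(f(ξ))` for all `β ≤ α`,
and `v = f(α)`. -/
def IsRank (v α : M) : Prop :=
  ∃ f s, IsSucc E s α ∧ (∀ β, E β s → ∃! y, App E f β y) ∧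
    (∀ β y, E β s → App E f β y → ∀ x, E x y ↔ ∃ ξ w, E ξ β ∧ App E f ξ w ∧ Subset E x w) ∧
    App E f α v

/-! ### Formulas and satisfaction inside the model

A formula is coded by a set: falsum by `∅`, `v_i = v_j` by `(0, (i, j))`, an implication `p → q` by
`(3, (p, q))`, and `∀ v_i, p` by `(4, (i, p))`. The remaining atomic formulas depend on the
language: they are given by a predicate `atom`, and their truth in a structure under an assignment
is given by a relation `val`. -/

/-- `c = (k, (x, y))` -/
def IsTagged (k : ℕ) (c x y : M) : Prop :=
  ∃ t z, IsNumeral E k t ∧ IsOPair E z x y ∧ IsOPair E c t z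

/-- The set `P` contains the atomic formulas and is closed under the formation rules. -/
def IsClosedUnderFormation (atom : M → Prop) (P : M) : Prop :=
  (∀ c, IsEmptySet E c → E c P) ∧
  (∀ c i j, IsNat E i → IsNat E j → IsTagged E 0 c i j → E c P) ∧
  (∀ c, atom c → E c P) ∧
  (∀ c p q, E p P → E q P → IsTagged E 3 c p q → E c P) ∧
  (∀ c i p, IsNat E i → E p P → IsTagged E 4 c i p → E c P)

/-- `p` is (a code of) a formula. -/
def IsFormula (atom : M → Prop) (p : M) : Prop :=
  ∀ P, IsClosedUnderFormation E atom P → E p P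

/-- `s` is an assignment of the variables `v_i`, for `i ∈ ω`, in the set `a`. -/
def IsAssignment (a s : M) : Prop := ∃ w, IsOmega E w ∧ IsFun E s w a

/-- The assignment `s'` in `a` maps `i` to `x` and agrees with `s` elsewhere. -/
def IsUpdate (a s i x s' : M) : Prop :=
  IsAssignment E a s' ∧ App E s' i x ∧
    ∀ n y, IsNat E n → n ≠ i → (App E s' n y ↔ App E s n y)

/-- The set `S` of pairs (formula, assignment in `a`) satisfies the Tarski clauses. -/
def IsSatisfactionSet (atom : M → Prop) (val : M → M → Prop) (a S : M) : Prop :=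
  ∀ s, IsAssignment E a s →
    (∀ c, IsEmptySet E c → ¬ App E S c s) ∧
    (∀ c i j, IsNat E i → IsNat E j → IsTagged E 0 c i j →
      (App E S c s ↔ ∃ x, App E s i x ∧ App E s j x)) ∧
    (∀ c, atom c → (App E S c s ↔ val c s)) ∧
    (∀ c p q, IsFormula E atom p → IsFormula E atom q → IsTagged E 3 c p q →
      (App E S c s ↔ (App E S p s → App E S q s))) ∧
    (∀ c i p, IsNat E i → IsFormula E atom p → IsTagged E 4 c i p →
      (App E S c s ↔ ∀ x s', E x a → IsUpdate E a s i x s' → App E S p s'))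

/-- The formula `p` holds under the assignment `s` in the structure with domain `a`. -/
def Sat (atom : M → Prop) (val : M → M → Prop) (a p s : M) : Prop :=
  ∃ S, IsSatisfactionSet E atom val a S ∧ App E S p s

/-! ### Definable classes of a set structure inside the model -/

/-- The atomic formula `v_i ∈ v_j` of the language of set theory is coded by `(1, (i, j))`. -/
def MemAtom (c : M) : Prop := ∃ i j, IsNat E i ∧ IsNat E j ∧ IsTagged E 1 c i j

/-- Truth of `v_i ∈ v_j` under `s` when the membership symbol is interpreted by `e`. -/
def MemVal (e : M → M → Prop) (c s : M) : Prop :=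
  ∃ i j x y, IsTagged E 1 c i j ∧ App E s i x ∧ App E s j y ∧ e x y

/-- In the sense of the model, the class `D` is definable with parameters over `(m, e)`. -/
def InternallyDefinable₁ (m : M) (e : M → M → Prop) (D : Set {x : M // E x m}) : Prop :=
  ∃ p s i, IsFormula E (MemAtom E) p ∧ IsAssignment E m s ∧ IsNumeral E 0 i ∧
    ∀ x : {x : M // E x m}, x ∈ D ↔
      ∃ s', IsUpdate E m s i x.1 s' ∧ Sat E (MemAtom E) (MemVal E e) m p s'

/-- In the sense of the model, the binary relation `D` is definable with parameters over
`(m, e)`. -/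
def InternallyDefinable₂ (m : M) (e : M → M → Prop)
    (D : Set ({x : M // E x m} × {x : M // E x m})) : Prop :=
  ∃ p s i j, IsFormula E (MemAtom E) p ∧ IsAssignment E m s ∧ IsNumeral E 0 i ∧
    IsNumeral E 1 j ∧
    ∀ x y : {x : M // E x m}, (x, y) ∈ D ↔
      ∃ s' s'', IsUpdate E m s i x.1 s' ∧ IsUpdate E m s' j y.1 s'' ∧
        Sat E (MemAtom E) (MemVal E e) m p s''

/-- The relation `e` restricted to the elements of the set `m`. -/
def restrict (m : M) (e : M → M → Prop) (x y : {x : M // E x m}) : Prop := e x.1 y.1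

/-- In the sense of the model, the set structure `(m, e)` satisfies ZFC. -/
def InternallyModelsZFC (m : M) (e : M → M → Prop) : Prop :=
  ZFCAxioms (restrict E m e) (InternallyDefinable₁ E m e) (InternallyDefinable₂ E m e)

/-! ### First-order structures and elementary embeddings inside the model

A language is given by a set `F` of function symbols and a set `R` of relation symbols, a symbol of
arity `n` being a pair `(s, n)` with `n ∈ ω`. The atomic formulas, besides equations of variables,
are `σ(v_{t(0)}, …, v_{t(n-1)})` for `σ ∈ R`, coded by `(1, (σ, t))`, and
`σ(v_{t(0)}, …, v_{t(n-1)}) = v_j` for `σ ∈ F`, coded by `(2, ((σ, t), j))`, where `t : n → ω`. Every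
first-order formula is equivalent to one with such atomic formulas only. -/

/-- `σ` is a symbol of arity `n` in the set `L` of symbols. -/
def IsSymbol (L σ n : M) : Prop := E σ L ∧ IsNat E n ∧ ∃ s, IsOPair E σ s n

/-- `(a, (f, r))` is a structure for the language `(F, R)`: `f` consists of the elements
`((σ, t), σ(t))` for function symbols `σ` and tuples `t`, and `r` consists of pairs `(σ, t)` for
relation symbols `σ` and tuples `t`, namely those with `σ(t)`. -/
def IsStructure (F R a f r : M) : Prop :=
  (∃ x, E x a) ∧
  (∀ z, E z f → ∃ w σ n t y, IsOPair E z w y ∧ IsOPair E w σ t ∧ IsSymbol E F σ n ∧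
    IsFun E t n a ∧ E y a) ∧
  (∀ σ n t, IsSymbol E F σ n → IsFun E t n a →
    ∃! y, ∃ z w, IsOPair E z w y ∧ IsOPair E w σ t ∧ E z f) ∧
  (∀ z, E z r → ∃ σ n t, IsOPair E z σ t ∧ IsSymbol E R σ n ∧ IsFun E t n a)

/-- `x` is the structure `(a, (f, r))` for the language `(F, R)`. -/
def IsStructureCode (F R x a f r : M) : Prop :=
  IsStructure E F R a f r ∧ ∃ z, IsOPair E z f r ∧ IsOPair E x a z

/-- The atomic formulas of the language `(F, R)`. -/
def StructAtom (F R c : M) : Prop :=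
  (∃ σ n t w, IsSymbol E R σ n ∧ IsOmega E w ∧ IsFun E t n w ∧ IsTagged E 1 c σ t) ∨
  (∃ σ n t w d j, IsSymbol E F σ n ∧ IsOmega E w ∧ IsFun E t n w ∧ IsOPair E d σ t ∧
    IsNat E j ∧ IsTagged E 2 c d j)

/-- Truth of atomic formulas under `s` in the structure with interpretations `f` and `r`. -/
def StructVal (f r c s : M) : Prop :=
  (∃ σ t t' z, IsTagged E 1 c σ t ∧ IsComp E t' s t ∧ IsOPair E z σ t' ∧ E z r) ∨
  (∃ σ t d j t' d' y z, IsTagged E 2 c d j ∧ IsOPair E d σ t ∧ IsComp E t' s t ∧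
    IsOPair E d' σ t' ∧ App E s j y ∧ IsOPair E z d' y ∧ E z f)

/-- `j` is an elementary embedding of the structure `(a, (f, r))` into `(a', (f', r'))`. -/
def IsElementaryEmbedding (F R a f r a' f' r' j : M) : Prop :=
  IsFun E j a a' ∧
  ∀ p s s', IsFormula E (StructAtom E F R) p → IsAssignment E a s → IsComp E s' j s →
    (Sat E (StructAtom E F R) (StructVal E f r) a p s ↔
      Sat E (StructAtom E F R) (StructVal E f' r') a' p s')

/-- Every member of `D` is a structure for the language `(F, R)`. -/
def IsClassOfStructures (F R : M) (D : Set M) : Prop :=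
  ∀ x ∈ D, ∃ a f r, IsStructureCode E F R x a f r

/-- There are distinct members of `D` with an elementary embedding between them. -/
def HasElementaryEmbedding (F R : M) (D : Set M) : Prop :=
  ∃ x y, x ∈ D ∧ y ∈ D ∧ x ≠ y ∧ ∃ a f r a' f' r' j,
    IsStructureCode E F R x a f r ∧ IsStructureCode E F R y a' f' r' ∧
    IsElementaryEmbedding E F R a f r a' f' r' j

/-- The Vopěnka scheme in `(M, E)`, for the proper classes `D` that satisfy `D₁`. -/
def VopenkaScheme (D₁ : Set M → Prop) : Prop :=
  ∀ (F R : M) (D : Set M), D₁ D → (¬ ∃ c, ∀ x, E x c ↔ x ∈ D) →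
    IsClassOfStructures E F R D → HasElementaryEmbedding E F R D

/-! ### The two kinds of cardinals -/

/-- `δ` is an (uncountable, strongly) inaccessible cardinal of the model. -/
def IsInaccessible (δ : M) : Prop :=
  IsOrd E δ ∧ (∃ w, IsOmega E w ∧ E w δ) ∧
  (∀ α f, E α δ → IsFun E f α δ → ∃ β, E β δ ∧ ∀ x y, App E f x y → E y β) ∧
  (∀ α p, E α δ → IsPowerset E p α → ∃ β f, E β δ ∧ IsInj E f p β)

/-- The set `x` has fewer than `δ` elements, for a cardinal `δ`. -/
def SizeLT (x δ : M) : Prop := ∃ β f, E β δ ∧ IsInj E f x β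

/-- `δ` is a Vopěnka cardinal of the model. -/
def IsVopenkaCardinal (δ : M) : Prop :=
  IsInaccessible E δ ∧ ∃ v, IsRank E v δ ∧
    ∀ F R m, SizeLT E F δ → SizeLT E R δ → Subset E m v → (∃ g, IsBij E g m δ) →
      IsClassOfStructures E F R {x | E x m} → HasElementaryEmbedding E F R {x | E x m}

/-- `γ` is a Vopěnka-scheme cardinal of the model: in the sense of the model, `V_γ` satisfies ZFC
and the Vopěnka scheme. Such a `γ` is an initial ordinal because `V_γ` satisfies ZFC. -/
def IsVopenkaSchemeCardinal (γ : M) : Prop :=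
  IsOrd E γ ∧ ∃ v, IsRank E v γ ∧ InternallyModelsZFC E v E ∧
    VopenkaScheme (restrict E v E) (InternallyDefinable₁ E v E)

end SetModel

/-! ## Consistency statements

A first-order sentence of the language of set theory is given by its interpretation in all structures
`(M, E)`. By the completeness theorem, a theory is consistent if and only if it has a model, and it
proves a sentence if and only if the sentence holds in all models of the theory. -/

/-- The sentence "there is a Vopěnka cardinal". -/
def ExistsVopenkaCardinal (M : Type v) (E : M → M → Prop) : Prop :=
  ∃ δ, SetModel.IsVopenkaCardinal E δ

/-- The sentence "there is a Vopěnka-scheme cardinal". -/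
def ExistsVopenkaSchemeCardinal (M : Type v) (E : M → M → Prop) : Prop :=
  ∃ γ, SetModel.IsVopenkaSchemeCardinal E γ

/-- The theory ZFC plus the sentence `φ` is consistent. -/
def ConsistentWithZFC (φ : ∀ M : Type v, (M → M → Prop) → Prop) : Prop :=
  ∃ (M : Type v) (E : M → M → Prop), ModelsZFC E ∧ φ M E

/-- The theory ZFC plus the sentence `φ` proves the sentence `ψ`. -/
def ZFCPlusProves (φ ψ : ∀ M : Type v, (M → M → Prop) → Prop) : Prop :=
  ∀ (M : Type v) (E : M → M → Prop), ModelsZFC E → φ M E → ψ M E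

/-- The set-theoretic sentence "ZFC plus `φ` is consistent": there are a set `m` and a
binary relation `r` on `m` such that `(m, r)` satisfies ZFC and `φ`. -/
def ConSentence (φ : ∀ M : Type v, (M → M → Prop) → Prop) (M : Type v) (E : M → M → Prop) : Prop :=
  ∃ m r : M, SetModel.InternallyModelsZFC E m (SetModel.App E r) ∧
    φ {x : M // E x m} (SetModel.restrict E m (SetModel.App E r))

/-! Everything rests on reflection below `δ`. Since `δ` is inaccessible, one can close off under
witness functions and obtain `γ < δ` such that `V_γ` is an elementary submodel of `V_δ` and three
further kinds of facts about classes definable over `V_δ` from parameters in `V_γ` reflect: a bound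
for the values on a set, a bound for a class of structures, and the presence of two members with an
elementary embedding. The bounds for values give replacement in `V_γ`. A definable proper class of
structures over `V_γ` is the trace of the class defined over `V_δ` by the same formula. That class
is unbounded, so it has `δ` many members, the Vopěnka property yields an embedding, and the pair
reflects into `V_γ`. In `ZFSet` a parameter list is finite, so all closure points of the witness
functions work, and they form a club (`exists_club`, `isVopenkaSchemeCardinal_of_reflects`).

For the two stationary sets, let a club `C` be given. Vopěnka's property is applied to expansions of
levels `V_{β(α)}` that name `α` and carry relations for truth in every `⟨V_l, ∈, A⟩`, for the next
element of `C`, for ladders and for cofinal functions. The resulting embedding moves some ordinal.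
By an argument in the style of Kunen, its critical point `κ` lies in `C` and is regular, and the
next element `ν` of `C` is at most the image of `κ` (`exists_critical_point`). Restrictions to `V_l`
with `l < ν` are embeddings as in the definition of extendibility. If `C` consists of closure points
of a function that picks a failing `l`, this gives extendibility for all `l < δ`.

For the consistency statements the reflection argument is repeated inside an arbitrary model `(M,
E)` of ZFC. It may be ill-founded and have nonstandard formulas, so recursion, the cumulative
hierarchy and satisfaction are developed in the model, and separation and replacement are used only
for classes whose definability is found by instance search. The lemmas that carry this part are
`Hierarchy.exists_reflects`, `Reflects.tr_iff` and `Reflects.vopenkaScheme`. For the sentence on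
consistency, the set model is the `V_δ` of `(M, E)`; absoluteness (`IsInner`) shows that it regards
`γ` as a Vopěnka-scheme cardinal. -/

set_option synthInstance.maxSize 100000
set_option synthInstance.maxHeartbeats 400000

/-! ## Definable predicates and functions on a structure `(M, E)` -/

section Definability

variable {M : Type v} (E : M → M → Prop)

/-- A predicate of valuations that is first-order definable with parameters over `(M, E)`. -/
class DefP (P : (ℕ → M) → Prop) : Prop where
  out : let := relStructure E; (Set.univ : Set M).Definable setLang {v : ℕ → M | P v}

/-- A function of valuations whose graph is first-order definable with parameters. -/
class DefF (f : (ℕ → M) → M) : Prop where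
  out : DefP E fun v => v 0 = f fun n => v (n + 1)

variable {E}

theorem DefP.congr {P Q : (ℕ → M) → Prop} (hP : DefP E P) (h : ∀ v, Q v ↔ P v) : DefP E Q := by
  have : Q = P := funext fun v => propext (h v)
  exact this ▸ hP

theorem DefP.rename {P : (ℕ → M) → Prop} (hP : DefP E P) (σ : ℕ → ℕ) :
    DefP E fun v => P fun n => v (σ n) := by
  let := relStructure E
  exact ⟨hP.out.preimage_comp σ⟩

namespace DefP

instance and {P Q : (ℕ → M) → Prop} [hP : DefP E P] [hQ : DefP E Q] :
    DefP E fun v => P v ∧ Q v := by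
  let := relStructure E
  exact ⟨hP.out.inter hQ.out⟩

instance or {P Q : (ℕ → M) → Prop} [hP : DefP E P] [hQ : DefP E Q] :
    DefP E fun v => P v ∨ Q v := by
  let := relStructure E
  exact ⟨hP.out.union hQ.out⟩

instance not {P : (ℕ → M) → Prop} [hP : DefP E P] : DefP E fun v => ¬ P v := by
  let := relStructure E
  exact ⟨hP.out.compl⟩

instance imp {P Q : (ℕ → M) → Prop} [hP : DefP E P] [hQ : DefP E Q] :
    DefP E fun v => P v → Q v :=
  (inferInstance : DefP E fun v => ¬ P v ∨ Q v).congr fun _ => imp_iff_not_or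

instance iff {P Q : (ℕ → M) → Prop} [hP : DefP E P] [hQ : DefP E Q] :
    DefP E fun v => P v ↔ Q v :=
  (inferInstance : DefP E fun v => (P v → Q v) ∧ (Q v → P v)).congr fun _ => iff_iff_implies_and_implies

/-- Binders follow the de Bruijn convention: the bound variable is read at index 0 and all outer
variables are shifted by one. All later instances for quantifiers and operators have this shape. -/
instance ex {P : (ℕ → M) → M → Prop} [hP : DefP E fun v => P (fun n => v (n + 1)) (v 0)] :
    DefP E fun v => ∃ x, P v x := by
  let := relStructure E
  -- The bound variable becomes the single index of the summand `Unit`, so that projection along a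
  -- finite index type applies.
  have h := (hP.out.preimage_comp
    (fun n => Nat.casesOn n (Sum.inr ()) Sum.inl : ℕ → ℕ ⊕ Unit)).exists_of_finite
  refine ⟨?_⟩
  convert h using 1
  ext v
  exact ⟨fun ⟨x, hx⟩ => ⟨fun _ => x, hx⟩, fun ⟨u, hu⟩ => ⟨u (), hu⟩⟩

instance all {P : (ℕ → M) → M → Prop} [hP : DefP E fun v => P (fun n => v (n + 1)) (v 0)] :
    DefP E fun v => ∀ x, P v x :=
  (inferInstance : DefP E fun v => ¬ ∃ x, ¬ P v x).congr fun _ => by push Not; rfl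

/-- A condition that does not depend on the valuation defines everything or nothing, so arbitrary
ambient facts may occur inside definable predicates. -/
instance const {p : Prop} : DefP E fun _ => p := by
  let := relStructure E
  by_cases h : p
  · exact ⟨by convert Set.definable_univ using 1; ext; simp [h]⟩
  · exact ⟨by convert Set.definable_empty using 1; ext; simp [h]⟩

theorem var_eq_var (i j : ℕ) : DefP E fun v => v i = v j := by
  let := relStructure E
  refine ⟨(FirstOrder.Language.Term.var i).equal (FirstOrder.Language.Term.var j), ?_⟩
  ext v
  simp

theorem var_eq_const (i : ℕ) (c : M) : DefP E fun v => v i = c := by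
  let := relStructure E
  refine ⟨(FirstOrder.Language.Term.var i).equal
    (FirstOrder.Language.Constants.term (FirstOrder.Language.con setLang (⟨c, trivial⟩ : (Set.univ : Set M)))), ?_⟩
  ext v
  simp

theorem var_mem_var (i j : ℕ) : DefP E fun v => E (v i) (v j) := by
  let := relStructure E
  have : (Set.univ : Set M).Definable setLang {v : ℕ → M | E (v i) (v j)} := by
    rw [Set.definable_iff_exists_formula_sum]
    refine ⟨FirstOrder.Language.Relations.formula (L := setLang) (n := 2) MemRel.mem
      ![FirstOrder.Language.Term.var (Sum.inr i), FirstOrder.Language.Term.var (Sum.inr j)], ?_⟩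
    ext v
    simp only [Set.mem_ofPred_eq]
    rfl
  exact ⟨this⟩

end DefP

instance DefF.var (n : ℕ) : DefF E fun v => v n := ⟨DefP.var_eq_var 0 (n + 1)⟩

instance DefF.const (c : M) : DefF E fun _ => c := ⟨DefP.var_eq_const 0 c⟩

/-- A term placed under a quantifier appears with shifted variables. As a local instance of low
priority this lets instance search pass below binders. -/
theorem DefF.rename {f : (ℕ → M) → M} [hf : DefF E f] (σ : ℕ → ℕ) :
    DefF E fun v => f fun n => v (σ n) :=
  ⟨(hf.out.rename (fun n => Nat.casesOn n 0 fun n => σ n + 1)).congr fun _ => Iff.rfl⟩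

/-- Substitution of a definable function. -/
theorem DefP.subst {Q : (ℕ → M) → M → Prop} (hQ : DefP E fun v => Q (fun n => v (n + 1)) (v 0))
    (f : (ℕ → M) → M) [hf : DefF E f] : DefP E fun v => Q v (f v) :=
  have := hf.out
  (inferInstance : DefP E fun v => ∃ x, x = f v ∧ Q v x).congr fun v => by simp

instance DefP.mem {f g : (ℕ → M) → M} [hf : DefF E f] [hg : DefF E g] :
    DefP E fun v => E (f v) (g v) := by
  have h1 : DefP E fun v => E (v 0) (g fun n => v (n + 1)) :=
    have := DefF.rename (E := E) (f := g) (· + 1)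
    DefP.subst (Q := fun v y => E (v 0) y) (DefP.var_mem_var 1 0) (fun v => g fun n => v (n + 1))
  exact DefP.subst (Q := fun v x => E x (g v)) h1 f

instance DefP.eq {f g : (ℕ → M) → M} [hf : DefF E f] [hg : DefF E g] :
    DefP E fun v => f v = g v := by
  have h1 : DefP E fun v => v 0 = (g fun n => v (n + 1)) :=
    have := DefF.rename (E := E) (f := g) (· + 1)
    DefP.subst (Q := fun v y => v 0 = y) (DefP.var_eq_var 1 0) (fun v => g fun n => v (n + 1))
  exact DefP.subst (Q := fun v x => x = (g v)) h1 f

instance DefP.ne {f g : (ℕ → M) → M} [hf : DefF E f] [hg : DefF E g] :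
    DefP E fun v => f v ≠ g v :=
  (inferInstance : DefP E fun v => ¬ f v = g v)

instance DefP.exUnique {P : (ℕ → M) → M → Prop}
    [hP : DefP E fun v => P (fun n => v (n + 1)) (v 0)] :
    DefP E fun v => ∃! x, P v x := by
  -- Below both quantifiers, index 0 is the inner variable `y` and index 1 is `x`; the renaming
  -- skips the latter.
  have h0 := hP.rename (fun n => Nat.casesOn n 0 fun n => n + 2)
  have : DefP E fun v => ∃ x, P v x ∧ ∀ y, P v y → y = x := inferInstance
  exact this

/-- A definable property of one variable. -/
theorem isDefinableClass_of_defP {P : M → Prop} (h : DefP E fun v => P (v 0)) :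
    IsDefinableClass E {x | P x} := by
  let := relStructure E
  exact h.out.preimage_comp (fun _ => 0 : ℕ → Fin 1)

theorem isDefinableRelation_of_defP {P : M → M → Prop} (h : DefP E fun v => P (v 0) (v 1)) :
    IsDefinableRelation E {x | P x.1 x.2} := by
  let := relStructure E
  exact h.out.preimage_comp (fun n => Nat.casesOn n 0 fun _ => 1 : ℕ → Fin 2)

end Definability

/-! ### Definability of the set-theoretic notions -/

namespace SetModel

variable {M : Type v} {E : M → M → Prop}

attribute [local instance 50] DefF.rename

section Notions

variable {a b c d e f g h : (ℕ → M) → M} [DefF E a] [DefF E b] [DefF E c] [DefF E d] [DefF E e]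
  [DefF E f] [DefF E g] [DefF E h]

instance : DefP E fun v => IsEmptySet E (a v) := by
  unfold IsEmptySet; infer_instance

instance : DefP E fun v => Subset E (a v) (b v) := by
  unfold Subset; infer_instance

instance : DefP E fun v => IsPair E (a v) (b v) (c v) := by
  unfold IsPair; infer_instance

instance : DefP E fun v => IsOPair E (a v) (b v) (c v) := by
  unfold IsOPair; infer_instance

instance : DefP E fun v => IsSucc E (a v) (b v) := by
  unfold IsSucc; infer_instance

instance : DefP E fun v => IsOrd E (a v) := by
  unfold IsOrd; infer_instance

instance : DefP E fun v => IsNat E (a v) := by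
  unfold IsNat; infer_instance

instance : DefP E fun v => IsOmega E (a v) := by
  unfold IsOmega; infer_instance

instance (k : ℕ) : DefP E fun v => IsNumeral E k (a v) := by
  have : DefP E fun v => IsNumeral E k (v 0) := by
    induction k with
    | zero => unfold IsNumeral; infer_instance
    | succ k ih =>
      have := ih.rename fun n => n
      unfold IsNumeral; infer_instance
  exact DefP.subst (Q := fun _ x => IsNumeral E k x) this a

instance : DefP E fun v => App E (a v) (b v) (c v) := by
  unfold App; infer_instance

instance : DefP E fun v => IsFun E (a v) (b v) (c v) := by
  unfold IsFun; infer_instance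

instance : DefP E fun v => IsInj E (a v) (b v) (c v) := by
  unfold IsInj; infer_instance

instance : DefP E fun v => IsComp E (a v) (b v) (c v) := by
  unfold IsComp; infer_instance

instance (k : ℕ) : DefP E fun v => IsTagged E k (a v) (b v) (c v) := by
  unfold IsTagged; infer_instance

section Formulas

-- The hypotheses range over all renamings `σ` because `atom` and `val` occur below several
-- quantifiers, where their parameters sit at shifted indices.
variable {atom : (ℕ → M) → M → Prop} {val : (ℕ → M) → M → M → Prop}
  [hatom : ∀ (σ : ℕ → ℕ) (i : ℕ), DefP E fun v => atom (fun n => v (σ n)) (v i)]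
  [hval : ∀ (σ : ℕ → ℕ) (i j : ℕ), DefP E fun v => val (fun n => v (σ n)) (v i) (v j)]

instance : DefP E fun v => IsClosedUnderFormation E (atom v) (a v) := by
  unfold IsClosedUnderFormation; infer_instance

instance : DefP E fun v => IsFormula E (atom v) (a v) := by
  unfold IsFormula; infer_instance

instance : DefP E fun v => IsAssignment E (a v) (b v) := by
  unfold IsAssignment; infer_instance

instance : DefP E fun v => IsUpdate E (a v) (b v) (c v) (d v) (e v) := by
  unfold IsUpdate; infer_instance

instance : DefP E fun v => IsSatisfactionSet E (atom v) (val v) (a v) (b v) := by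
  unfold IsSatisfactionSet; infer_instance

instance : DefP E fun v => Sat E (atom v) (val v) (a v) (b v) (c v) := by
  unfold Sat; infer_instance

end Formulas

instance : DefP E fun v => MemAtom E (a v) := by
  unfold MemAtom; infer_instance

instance {r : (ℕ → M) → M → M → Prop} [∀ (σ : ℕ → ℕ) (i j : ℕ),
    DefP E fun v => r (fun n => v (σ n)) (v i) (v j)] :
    DefP E fun v => MemVal E (r v) (a v) (b v) := by
  unfold MemVal; infer_instance

instance : DefP E fun v => IsSymbol E (a v) (b v) (c v) := by
  unfold IsSymbol; infer_instance

instance : DefP E fun v => IsStructure E (a v) (b v) (c v) (d v) (e v) := by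
  unfold IsStructure; infer_instance

instance : DefP E fun v => IsStructureCode E (a v) (b v) (c v) (d v) (e v) (f v) := by
  unfold IsStructureCode; infer_instance

instance : DefP E fun v => StructAtom E (a v) (b v) (c v) := by
  unfold StructAtom; infer_instance

instance : DefP E fun v => StructVal E (a v) (b v) (c v) (d v) := by
  unfold StructVal; infer_instance

end Notions

section Embeddings

variable {F R a f r a' f' r' j : (ℕ → M) → M} [DefF E F] [DefF E R] [DefF E a] [DefF E f]
  [DefF E r] [DefF E a'] [DefF E f'] [DefF E r'] [DefF E j]

instance : DefP E fun v => IsElementaryEmbedding E (F v) (R v) (a v) (f v) (r v) (a' v) (f' v)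
    (r' v) (j v) := by
  unfold IsElementaryEmbedding; infer_instance

end Embeddings

end SetModel

namespace SetModel

/-! ## Set operations in a model of ZFC -/

/-- `(M, E)` is a model of ZFC, as a type class. -/
class IsZFC {M : Type v} (E : M → M → Prop) : Prop where
  out : ModelsZFC E

/-- The class `P` is a set of the model. -/
def IsSet {M : Type v} (E : M → M → Prop) (P : M → Prop) : Prop := ∃ c, ∀ x, E x c ↔ P x

variable {M : Type v} {E : M → M → Prop} [hZ : IsZFC E]

attribute [local instance 50] DefF.rename

variable (E) in
theorem ext {x y : M} (h : ∀ z, E z x ↔ E z y) : x = y := hZ.out.extensionality x y h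

variable (E) in
theorem isSet_sep (a : M) (P : M → Prop) [hP : DefP E fun v => P (v 0)] :
    IsSet E fun x => E x a ∧ P x :=
  hZ.out.separation {x | P x} (isDefinableClass_of_defP hP) a

theorem IsSet.of_subset (a : M) {P : M → Prop} (h : ∀ x, P x → E x a)
    [hP : DefP E fun v => P (v 0)] : IsSet E P := by
  obtain ⟨c, hc⟩ := isSet_sep E a P
  exact ⟨c, fun x => (hc x).trans ⟨And.right, fun hx => ⟨h x hx, hx⟩⟩⟩

variable (E) in
/-- A fixed set of the model. -/
noncomputable def someSet : M := hZ.out.infinity.choose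

open Classical in
variable (E) in
/-- The set of all `x` with `P x`. -/
noncomputable def mk (P : M → Prop) : M := if h : IsSet E P then h.choose else someSet E

open Classical in
variable (E) in
/-- The unique `x` with `P x`. -/
noncomputable def the (P : M → Prop) : M := if h : ∃! x, P x then h.choose else someSet E

theorem mem_mk {P : M → Prop} (h : IsSet E P) {x : M} : E x (mk E P) ↔ P x := by
  rw [mk, dif_pos h]
  exact h.choose_spec x

theorem the_spec {P : M → Prop} (h : ∃! x, P x) : P (the E P) := by
  rw [the, dif_pos h]
  exact h.choose_spec.1

theorem the_eq {P : M → Prop} (h : ∃! x, P x) {x : M} (hx : P x) : the E P = x :=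
  h.unique (the_spec h) hx

instance {P : (ℕ → M) → M → Prop}
    [hP : ∀ (σ : ℕ → ℕ) (i : ℕ), DefP E fun v => P (fun n => v (σ n)) (v i)] :
    DefP E fun v => IsSet E (P v) := by
  unfold IsSet; infer_instance

/-- Since `mk` is total, with the fixed value `someSet E` when the class is not a set, its graph is
a disjunction of two definable cases. -/
instance {P : (ℕ → M) → M → Prop}
    [hP : ∀ (σ : ℕ → ℕ) (i : ℕ), DefP E fun v => P (fun n => v (σ n)) (v i)] :
    DefF E fun v => mk E (P v) := by
  have hD : DefP E fun v => (IsSet E (P fun n => v (n + 1)) ∧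
    ∀ x, E x (v 0) ↔ P (fun n => v (n + 1)) x) ∨
    (¬ IsSet E (P fun n => v (n + 1)) ∧ v 0 = someSet E) := by infer_instance
  refine ⟨hD.congr fun v => ?_⟩
  by_cases h : IsSet E (P fun n => v (n + 1))
  · simp only [h, true_and, not_true_eq_false, false_and, or_false]
    constructor
    · rintro h' x
      rw [h', mem_mk h]
    · exact fun h' => ext E fun z => (h' z).trans (mem_mk h).symm
  · simp [h, mk]

instance {P : (ℕ → M) → M → Prop}
    [hP : ∀ (σ : ℕ → ℕ) (i : ℕ), DefP E fun v => P (fun n => v (σ n)) (v i)] :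
    DefF E fun v => the E (P v) := by
  have hD : DefP E fun v => ((∃! x, P (fun n => v (n + 1)) x) ∧
    P (fun n => v (n + 1)) (v 0)) ∨
    (¬ (∃! x, P (fun n => v (n + 1)) x) ∧ v 0 = someSet E) := by infer_instance
  refine ⟨hD.congr fun v => ?_⟩
  by_cases h : ∃! x, P (fun n => v (n + 1)) x
  · simp only [h, true_and, not_true_eq_false, false_and, or_false]
    constructor
    · rintro h'
      rw [h']
      exact the_spec h
    · exact fun h' => (the_eq h h').symm
  · simp [h, the]

/-! ### Basic operations -/

variable (E)

noncomputable def empty : M := mk E fun _ => False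
noncomputable def upair (x y : M) : M := mk E fun w => w = x ∨ w = y
noncomputable def opair (x y : M) : M := upair E (upair E x x) (upair E x y)
noncomputable def sUnion (x : M) : M := mk E fun w => ∃ y, E y x ∧ E w y
noncomputable def union (x y : M) : M := mk E fun w => E w x ∨ E w y
noncomputable def succ (x : M) : M := mk E fun w => E w x ∨ w = x
noncomputable def powerset (x : M) : M := mk E fun w => Subset E w x
noncomputable def app (f x : M) : M := the E fun y => App E f x y
noncomputable def sep (a : M) (P : M → Prop) : M := mk E fun x => E x a ∧ P x
noncomputable def lam (a : M) (F : M → M) : M := mk E fun z => ∃ x, E x a ∧ z = opair E x (F x)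
noncomputable def prod (a b : M) : M := mk E fun z => ∃ x y, E x a ∧ E y b ∧ z = opair E x y
noncomputable def funs (a b : M) : M := mk E fun f => IsFun E f a b

variable {E}

section
variable {a b : (ℕ → M) → M} [DefF E a] [DefF E b]

instance : DefF E fun v => upair E (a v) (b v) := by unfold upair; infer_instance
instance : DefF E fun v => opair E (a v) (b v) := by unfold opair; infer_instance
instance : DefF E fun v => sUnion E (a v) := by unfold sUnion; infer_instance
instance : DefF E fun v => succ E (a v) := by unfold succ; infer_instance
instance : DefF E fun v => powerset E (a v) := by unfold powerset; infer_instance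
instance : DefF E fun v => app E (a v) (b v) := by unfold app; infer_instance
instance : DefF E fun v => funs E (a v) (b v) := by unfold funs; infer_instance

instance {P : (ℕ → M) → M → Prop}
    [hP : ∀ (σ : ℕ → ℕ) (i : ℕ), DefP E fun v => P (fun n => v (σ n)) (v i)] :
    DefF E fun v => sep E (a v) (P v) := by unfold sep; infer_instance

end

theorem mem_sep {a : M} {P : M → Prop} [DefP E fun v => P (v 0)] {x : M} :
    E x (sep E a P) ↔ E x a ∧ P x := mem_mk (isSet_sep E a P)

@[simp] theorem not_mem_empty (x : M) : ¬ E x (empty E) := by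
  have : IsSet E fun _ : M => False := by
    obtain ⟨c, hc⟩ := isSet_sep E (someSet E) fun _ => False
    exact ⟨c, by simpa using hc⟩
  simp [empty, mem_mk this]

@[simp] theorem mem_upair {x y w : M} : E w (upair E x y) ↔ w = x ∨ w = y :=
  mem_mk (hZ.out.pairing x y)

@[simp] theorem mem_sUnion {x w : M} : E w (sUnion E x) ↔ ∃ y, E y x ∧ E w y :=
  mem_mk (hZ.out.union x)

@[simp] theorem mem_powerset {x w : M} : E w (powerset E x) ↔ Subset E w x :=
  mem_mk (hZ.out.powerset x)

@[simp] theorem mem_union {x y w : M} : E w (union E x y) ↔ E w x ∨ E w y := by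
  refine mem_mk ⟨sUnion E (upair E x y), fun w => ?_⟩
  simp [or_and_right, exists_or]

@[simp] theorem mem_succ {x w : M} : E w (succ E x) ↔ E w x ∨ w = x := by
  refine mem_mk ⟨union E x (upair E x x), fun w => ?_⟩
  simp

theorem isEmptySet_iff {x : M} : IsEmptySet E x ↔ x = empty E :=
  ⟨fun h => ext E fun z => by simp [h z], fun h => h ▸ not_mem_empty⟩

theorem isPair_iff {z x y : M} : IsPair E z x y ↔ z = upair E x y :=
  ⟨fun h => ext E fun w => by simp [h w], fun h w => by simp [h]⟩

theorem isOPair_iff {z x y : M} : IsOPair E z x y ↔ z = opair E x y := by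
  simp [IsOPair, isPair_iff, opair]

theorem isSucc_iff {y x : M} : IsSucc E y x ↔ y = succ E x :=
  ⟨fun h => ext E fun w => by simp [h w], fun h w => by simp [h]⟩

theorem isPowerset_iff {y x : M} : IsPowerset E y x ↔ y = powerset E x :=
  ⟨fun h => ext E fun w => by simp [h w], fun h w => by simp [h]⟩

theorem app_iff {f x y : M} : App E f x y ↔ E (opair E x y) f := by
  simp [App, isOPair_iff]

theorem upair_inj {x y x' y' : M} (h : upair E x y = upair E x' y') :
    (x = x' ∧ y = y') ∨ (x = y' ∧ y = x') := by
  have h1 : ∀ w, (w = x ∨ w = y) ↔ (w = x' ∨ w = y') := fun w => by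
    rw [← mem_upair (E := E) (x := x), h, mem_upair (E := E)]
  have := h1 x; have := h1 y; have := h1 x'; have := h1 y'
  grind

@[simp] theorem opair_inj {x y x' y' : M} : opair E x y = opair E x' y' ↔ x = x' ∧ y = y' := by
  refine ⟨fun h => ?_, fun ⟨h1, h2⟩ => by rw [h1, h2]⟩
  rcases upair_inj h with ⟨h1, h2⟩ | ⟨h1, h2⟩
  · have h1 := upair_inj h1
    have h2 := upair_inj h2
    grind
  · have h1 := upair_inj h1
    have h2 := upair_inj h2
    grind

/-- The replacement axiom. -/
theorem isSet_image (a : M) (F : M → M) [hF : DefF E fun v => F (v 0)] :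
    IsSet E fun y => ∃ x, E x a ∧ y = F x := by
  have : DefF E fun v => F (v 1) := (DefF.rename (E := E) (f := fun v => F (v 0)) fun n => n + 1)
  have h : DefP E fun v => v 1 = F (v 0) := hF.out.rename (fun n => Nat.casesOn n 1 fun n => n)
  obtain ⟨b, hb⟩ := hZ.out.replacement {p | p.2 = F p.1} (isDefinableRelation_of_defP (P := fun x y => y = F x) h) a
    (fun x _ => ⟨F x, rfl, fun y hy => hy⟩)
  exact ⟨b, hb⟩

theorem isSet_biUnion (a : M) (F : M → M) [hF : DefF E fun v => F (v 0)] :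
    IsSet E fun z => ∃ x, E x a ∧ E z (F x) := by
  obtain ⟨c, hc⟩ := isSet_image (E := E) a F
  exact ⟨sUnion E c, fun z => by simp [hc]⟩

theorem mem_lam {a : M} {F : M → M} [hF : DefF E fun v => F (v 0)] {z : M} :
    E z (lam E a F) ↔ ∃ x, E x a ∧ z = opair E x (F x) :=
  mem_mk (isSet_image a fun x => opair E x (F x))

@[simp] theorem mem_prod {a b z : M} : E z (prod E a b) ↔ ∃ x y, E x a ∧ E y b ∧ z = opair E x y := by
  refine mem_mk ?_
  have h : ∀ x, ∀ {z}, E z (mk E fun z => ∃ y, E y b ∧ z = opair E x y) ↔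
      ∃ y, E y b ∧ z = opair E x y := fun x => mem_mk (isSet_image b fun y => opair E x y)
  -- The product is the union of the sets `{x} × b`, each of which exists by replacement.
  obtain ⟨c, hc⟩ := isSet_biUnion (E := E) a fun x => mk E fun z => ∃ y, E y b ∧ z = opair E x y
  exact ⟨c, fun z => by simp [hc, h]⟩

theorem app_lam {a : M} {F : M → M} [hF : DefF E fun v => F (v 0)] {x y : M} :
    App E (lam E a F) x y ↔ E x a ∧ y = F x := by
  simp only [app_iff, mem_lam, opair_inj]
  grind

theorem isFun_lam {a b : M} {F : M → M} [hF : DefF E fun v => F (v 0)]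
    (h : ∀ x, E x a → E (F x) b) : IsFun E (lam E a F) a b := by
  refine ⟨fun z hz => ?_, fun x hx => ⟨F x, app_lam.2 ⟨hx, rfl⟩, fun y hy => (app_lam.1 hy).2⟩⟩
  obtain ⟨x, hx, rfl⟩ := mem_lam.1 hz
  exact ⟨x, F x, hx, h x hx, isOPair_iff.2 rfl⟩

theorem IsFun.mem_prod {f a b z : M} (h : IsFun E f a b) (hz : E z f) : E z (prod E a b) := by
  obtain ⟨x, y, hx, hy, hxy⟩ := h.1 z hz
  exact SetModel.mem_prod.2 ⟨x, y, hx, hy, isOPair_iff.1 hxy⟩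

@[simp] theorem mem_funs {a b f : M} : E f (funs E a b) ↔ IsFun E f a b :=
  mem_mk (IsSet.of_subset (powerset E (prod E a b)) fun f (hf : IsFun E f a b) =>
    mem_powerset.2 fun _ hz => hf.mem_prod hz)

theorem IsFun.app_mem_left {f a b x y : M} (h : IsFun E f a b) (hxy : App E f x y) : E x a := by
  obtain ⟨x', y', hx, hy, hz⟩ := h.1 _ (app_iff.1 hxy)
  obtain ⟨rfl, rfl⟩ := opair_inj.1 (isOPair_iff.1 hz)
  exact hx

theorem IsFun.app_mem_right {f a b x y : M} (h : IsFun E f a b) (hxy : App E f x y) : E y b := by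
  obtain ⟨x', y', hx, hy, hz⟩ := h.1 _ (app_iff.1 hxy)
  obtain ⟨rfl, rfl⟩ := opair_inj.1 (isOPair_iff.1 hz)
  exact hy

theorem IsFun.app_spec {f a b x : M} (h : IsFun E f a b) (hx : E x a) : App E f x (app E f x) :=
  the_spec (h.2 x hx)

theorem IsFun.app_eq {f a b x y : M} (h : IsFun E f a b) (hxy : App E f x y) : app E f x = y :=
  the_eq (h.2 x (h.app_mem_left hxy)) hxy

theorem IsFun.app_iff {f a b x y : M} (h : IsFun E f a b) :
    App E f x y ↔ E x a ∧ y = app E f x :=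
  ⟨fun hxy => ⟨h.app_mem_left hxy, (h.app_eq hxy).symm⟩, fun ⟨hx, hy⟩ => hy ▸ h.app_spec hx⟩

theorem IsFun.app_mem {f a b x : M} (h : IsFun E f a b) (hx : E x a) : E (app E f x) b :=
  h.app_mem_right (h.app_spec hx)

theorem IsFun.ext {f g a b c : M} (hf : IsFun E f a b) (hg : IsFun E g a c)
    (h : ∀ x, E x a → app E f x = app E g x) : f = g := by
  have key : ∀ {f g b c : M}, IsFun E f a b → IsFun E g a c →
      (∀ x, E x a → app E f x = app E g x) → ∀ z, E z f → E z g := by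
    intro f g b c hf hg h z hz
    obtain ⟨x, y, hx, hy, hxy⟩ := hf.1 z hz
    rw [isOPair_iff] at hxy
    subst hxy
    have h1 := hf.app_eq (SetModel.app_iff.2 hz)
    have h2 := hg.app_spec hx
    rw [← h x hx, h1] at h2
    exact SetModel.app_iff.1 h2
  exact SetModel.ext E fun z => ⟨key hf hg h z, key hg hf (fun x hx => (h x hx).symm) z⟩

theorem IsFun.mono {f a b c : M} (h : IsFun E f a b) (hc : ∀ x, E x a → E (app E f x) c) :
    IsFun E f a c := by
  refine ⟨fun z hz => ?_, h.2⟩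
  obtain ⟨x, y, hx, hy, hxy⟩ := h.1 z hz
  have := h.app_eq ⟨z, hz, hxy⟩
  exact ⟨x, y, hx, this ▸ hc x hx, hxy⟩

theorem app_lam_eq {a x : M} {F : M → M} [hF : DefF E fun v => F (v 0)] (hx : E x a) :
    app E (lam E a F) x = F x :=
  (isFun_lam (b := mk E fun y => ∃ x, E x a ∧ y = F x) fun x hx =>
    (mem_mk (isSet_image a F)).2 ⟨x, hx, rfl⟩).app_eq (app_lam.2 ⟨hx, rfl⟩)

theorem subset_antisymm {x y : M} (h : Subset E x y) (h' : Subset E y x) : x = y :=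
  ext E fun z => ⟨h z, h' z⟩

omit hZ in
theorem Subset.trans {x y z : M} (h : Subset E x y) (h' : Subset E y z) : Subset E x z :=
  fun w hw => h' w (h w hw)

omit hZ in
theorem Subset.refl (x : M) : Subset E x x := fun _ h => h

end SetModel

namespace SetModel

variable {M : Type v} {E : M → M → Prop} [hZ : IsZFC E]

attribute [local instance 50] DefF.rename

/-! ## Ordinals -/

theorem not_mem_self (x : M) : ¬ E x x := by
  obtain ⟨y, hy, h⟩ := hZ.out.foundation (upair E x x) ⟨x, by simp⟩
  have : y = x := by simpa using hy
  subst this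
  exact fun hx => h y hy hx

theorem not_mem_of_mem {x y : M} (hxy : E x y) : ¬ E y x := by
  obtain ⟨z, hz, h⟩ := hZ.out.foundation (upair E x y) ⟨x, by simp⟩
  rcases mem_upair.1 hz with rfl | rfl
  · exact h y (by simp)
  · exact fun _ => h x (by simp) hxy

omit hZ in
theorem IsOrd.mem {α β : M} (hα : IsOrd E α) (hβ : E β α) : IsOrd E β :=
  ⟨hα.2 β hβ, fun y hy => hα.2 y (hα.1 β hβ y hy)⟩

omit hZ in
theorem IsOrd.mem_trans {α β γ : M} (hα : IsOrd E α) (hβ : E β α) (hγ : E γ β) : E γ α :=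
  hα.1 β hβ γ hγ

/-- Foundation speaks of sets, so it is applied to the members of `α ∪ {α}` that satisfy `P`. As `α`
is transitive, a minimal one is minimal among all sets. -/
theorem IsOrd.exists_min {P : M → Prop} [hP : DefP E fun v => P (v 0)] {α : M} (hα : IsOrd E α)
    (h : P α) : ∃ β, IsOrd E β ∧ (β = α ∨ E β α) ∧ P β ∧ ∀ γ, E γ β → ¬ P γ := by
  have hmem : ∀ {x}, E x (sep E (succ E α) P) ↔ E x (succ E α) ∧ P x := mem_sep
  obtain ⟨β, hβ, hmin⟩ := hZ.out.foundation (sep E (succ E α) P) ⟨α, hmem.2 ⟨by simp, h⟩⟩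
  obtain ⟨hβα, hPβ⟩ := hmem.1 hβ
  simp only [mem_succ] at hβα
  have hord : IsOrd E β := hβα.elim (fun h => hα.mem h) (fun h => h ▸ hα)
  refine ⟨β, hord, hβα.symm, hPβ, fun γ hγ hPγ => hmin γ (hmem.2 ⟨?_, hPγ⟩) hγ⟩
  simp only [mem_succ]
  rcases hβα with h | rfl
  · exact Or.inl (hα.mem_trans h hγ)
  · exact Or.inl hγ

theorem IsOrd.induction {P : M → Prop} [hP : DefP E fun v => P (v 0)]
    (h : ∀ α, IsOrd E α → (∀ β, E β α → P β) → P α) {α : M} (hα : IsOrd E α) : P α := by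
  by_contra hn
  obtain ⟨β, hβ, -, hPβ, hmin⟩ := hα.exists_min (P := fun x => ¬ P x) hn
  exact hPβ (h β hβ fun γ hγ => not_not.1 (hmin γ hγ))

theorem IsOrd.trichotomy {α β : M} (hα : IsOrd E α) (hβ : IsOrd E β) :
    E α β ∨ α = β ∨ E β α := by
  suffices h : ∀ β, IsOrd E β → E α β ∨ α = β ∨ E β α from h β hβ
  refine IsOrd.induction (E := E) (P := fun α => ∀ β, IsOrd E β → E α β ∨ α = β ∨ E β α)
    (fun α hα ih β hβ => ?_) hα
  refine IsOrd.induction (E := E) (P := fun β => E α β ∨ α = β ∨ E β α) (fun β hβ ih' => ?_) hβ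
  by_contra hn
  push Not at hn
  refine hn.2.1 (ext E fun z => ⟨fun hz => ?_, fun hz => ?_⟩)
  · rcases ih z hz β hβ with h | rfl | h
    · exact h
    · exact absurd hz hn.2.2
    · exact absurd (hα.mem_trans hz h) hn.2.2
  · rcases ih' z hz with h | rfl | h
    · exact absurd (hβ.mem_trans hz h) hn.1
    · exact absurd hz hn.1
    · exact h

theorem IsOrd.subset_iff {α β : M} (hα : IsOrd E α) (hβ : IsOrd E β) :
    Subset E α β ↔ E α β ∨ α = β := by
  constructor
  · intro h
    rcases hα.trichotomy hβ with h' | h' | h'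
    · exact Or.inl h'
    · exact Or.inr h'
    · exact absurd (h β h') (not_mem_self β)
  · rintro (h | rfl)
    · exact hβ.1 α h
    · exact Subset.refl _

theorem isOrd_empty : IsOrd E (empty E) := by simp [IsOrd]

theorem IsOrd.succ {α : M} (hα : IsOrd E α) : IsOrd E (succ E α) := by
  constructor
  · intro y hy z hz
    simp only [mem_succ] at hy ⊢
    rcases hy with h | rfl
    · exact Or.inl (hα.mem_trans h hz)
    · exact Or.inl hz
  · intro y hy
    simp only [mem_succ] at hy
    rcases hy with h | rfl
    · exact hα.2 y h
    · exact hα.1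

theorem isOrd_sUnion {x : M} (h : ∀ y, E y x → IsOrd E y) : IsOrd E (sUnion E x) := by
  constructor
  · intro y hy z hz
    obtain ⟨w, hw, hyw⟩ := mem_sUnion.1 hy
    exact mem_sUnion.2 ⟨w, hw, (h w hw).mem_trans hyw hz⟩
  · intro y hy
    obtain ⟨w, hw, hyw⟩ := mem_sUnion.1 hy
    exact (h w hw).2 y hyw

/-- The maximum of two ordinals below an ordinal. -/
theorem IsOrd.exists_max {δ α β : M} (hδ : IsOrd E δ) (hα : E α δ) (hβ : E β δ) :
    ∃ γ, E γ δ ∧ Subset E α γ ∧ Subset E β γ := by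
  rcases (hδ.mem hα).trichotomy (hδ.mem hβ) with h | rfl | h
  · exact ⟨β, hβ, (hδ.mem hβ).1 α h, Subset.refl _⟩
  · exact ⟨α, hα, Subset.refl _, Subset.refl _⟩
  · exact ⟨α, hα, Subset.refl _, (hδ.mem hα).1 β h⟩

/-! ## Natural numbers -/

omit hZ in
theorem IsNat.mem {n m : M} (hn : IsNat E n) (hm : E m n) : IsNat E m := by
  refine ⟨hn.1.mem hm, fun k hk => hn.2 k (Or.inr ?_)⟩
  rcases hk with rfl | hk
  · exact hm
  · exact hn.1.mem_trans hm hk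

theorem isNat_empty : IsNat E (empty E) :=
  ⟨isOrd_empty, fun k hk => Or.inl (isEmptySet_iff.2 (hk.resolve_right (not_mem_empty k)))⟩

theorem IsNat.succ {n : M} (hn : IsNat E n) : IsNat E (succ E n) := by
  refine ⟨hn.1.succ, fun k hk => ?_⟩
  rcases hk with rfl | hk
  · exact Or.inr ⟨n, isSucc_iff.2 rfl⟩
  · exact hn.2 k (mem_succ.1 hk).symm

/-- This is induction inside the model: `n` may be nonstandard, so `P` has to be definable. -/
theorem IsNat.induction {P : M → Prop} [hP : DefP E fun v => P (v 0)] (h0 : P (empty E))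
    (hs : ∀ n, IsNat E n → P n → P (SetModel.succ E n)) {n : M} (hn : IsNat E n) : P n := by
  by_contra hPn
  obtain ⟨m, hm, hmn, hPm, hmin⟩ := hn.1.exists_min (P := fun x => ¬ P x) hPn
  have hm' : IsNat E m := hmn.elim (fun h => h ▸ hn) fun h => hn.mem h
  rcases hm'.2 m (Or.inl rfl) with h | ⟨l, hl⟩
  · exact hPm (isEmptySet_iff.1 h ▸ h0)
  · rw [isSucc_iff] at hl
    subst hl
    have hl : E l (SetModel.succ E l) := by simp
    exact hPm (hs l (hm'.mem hl) (not_not.1 (hmin l hl)))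

variable (E) in
/-- The set of natural numbers. -/
noncomputable def omega : M := mk E fun n => IsNat E n

@[simp] theorem mem_omega {n : M} : E n (omega E) ↔ IsNat E n := by
  obtain ⟨z, ⟨o, ho, ho'⟩, hs⟩ := hZ.out.infinity
  have hz : ∀ n, IsNat E n → E n z := fun n hn => by
    refine hn.induction (P := fun n => E n z) ?_ fun n _ hnz => ?_
    · rwa [← isEmptySet_iff.1 ho']
    · obtain ⟨m, hm, hmn⟩ := hs n hnz
      have : m = SetModel.succ E n := isSucc_iff.1 hmn
      rwa [← this]
  exact mem_mk (IsSet.of_subset z hz)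

theorem isOmega_iff {w : M} : IsOmega E w ↔ w = omega E :=
  ⟨fun h => ext E fun n => by simp [h n], fun h n => by simp [h]⟩

theorem isOrd_omega : IsOrd E (omega E) :=
  ⟨fun _ hy _ hz => mem_omega.2 ((mem_omega.1 hy).mem hz), fun _ hy => (mem_omega.1 hy).1.1⟩

variable (E) in
/-- The von Neumann numerals. -/
noncomputable def num : ℕ → M
  | 0 => empty E
  | n + 1 => succ E (num n)

theorem isNumeral_iff {k : ℕ} {x : M} : IsNumeral E k x ↔ x = num E k := by
  induction k generalizing x with
  | zero => exact isEmptySet_iff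
  | succ k ih => simp [IsNumeral, ih, isSucc_iff, num]

theorem isNat_num (k : ℕ) : IsNat E (num E k) := by
  induction k with
  | zero => exact isNat_empty
  | succ k ih => exact ih.succ

theorem num_mem_num {j k : ℕ} (h : j < k) : E (num E j) (num E k) := by
  induction k with
  | zero => omega
  | succ k ih =>
    simp only [num, mem_succ]
    rcases Nat.lt_succ_iff_lt_or_eq.1 h with h | rfl
    · exact Or.inl (ih h)
    · exact Or.inr rfl

@[simp] theorem num_inj {j k : ℕ} : num E j = num E k ↔ j = k := by
  refine ⟨fun h => ?_, fun h => by rw [h]⟩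
  rcases lt_trichotomy j k with h' | h' | h'
  · exact absurd (h ▸ num_mem_num h') (not_mem_self (E := E) _)
  · exact h'
  · exact absurd (h ▸ num_mem_num h') (not_mem_self (E := E) _)

theorem isAssignment_iff {a s : M} : IsAssignment E a s ↔ IsFun E s (omega E) a := by
  simp [IsAssignment, isOmega_iff]

variable (E) in
/-- The code `(k, (x, y))`. -/
noncomputable def tag (k : ℕ) (x y : M) : M := opair E (num E k) (opair E x y)

instance {k : ℕ} {a b : (ℕ → M) → M} [DefF E a] [DefF E b] : DefF E fun v => tag E k (a v) (b v) := by
  unfold tag; infer_instance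

theorem isTagged_iff {k : ℕ} {c x y : M} : IsTagged E k c x y ↔ c = tag E k x y := by
  simp [IsTagged, isNumeral_iff, isOPair_iff, tag]

@[simp] theorem tag_inj {j k : ℕ} {x y x' y' : M} :
    tag E j x y = tag E k x' y' ↔ j = k ∧ x = x' ∧ y = y' := by
  simp [tag]

theorem opair_ne_empty (x y : M) : opair E x y ≠ empty E := fun h =>
  not_mem_empty (E := E) (upair E x x) (h ▸ by simp [opair])

@[simp] theorem tag_ne_empty {k : ℕ} {x y : M} : tag E k x y ≠ empty E := opair_ne_empty _ _

/-! ## Modified assignments -/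

variable (E) in
/-- The function on `ω` that maps `i` to `x` and agrees with `s` elsewhere. -/
noncomputable def update (s i x : M) : M :=
  mk E fun z => ∃ n, IsNat E n ∧ ((n = i ∧ z = opair E n x) ∨ (n ≠ i ∧ z = opair E n (app E s n)))

instance {a b c : (ℕ → M) → M} [DefF E a] [DefF E b] [DefF E c] :
    DefF E fun v => update E (a v) (b v) (c v) := by
  unfold update; infer_instance

theorem mem_update {a s i x z : M} (hs : IsFun E s (omega E) a) :
    E z (update E s i x) ↔
      ∃ n, IsNat E n ∧ ((n = i ∧ z = opair E n x) ∨ (n ≠ i ∧ z = opair E n (app E s n))) := by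
  refine mem_mk (IsSet.of_subset (union E (prod E (omega E) (upair E x x)) s) fun z hz => ?_)
  simp only [mem_union]
  rcases hz with ⟨n, hn, ⟨rfl, rfl⟩ | ⟨hni, rfl⟩⟩
  · exact Or.inl (mem_prod.2 ⟨n, x, mem_omega.2 hn, by simp, rfl⟩)
  · exact Or.inr (app_iff.1 (hs.app_spec (mem_omega.2 hn)))

theorem app_update {a s i x n y : M} (hs : IsFun E s (omega E) a) :
    App E (update E s i x) n y ↔ IsNat E n ∧ ((n = i ∧ y = x) ∨ (n ≠ i ∧ y = app E s n)) := by
  rw [app_iff, mem_update hs]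
  simp only [opair_inj]
  grind

theorem isFun_update {a s i x : M} (hs : IsFun E s (omega E) a) (hx : E x a) :
    IsFun E (update E s i x) (omega E) a := by
  refine ⟨fun z hz => ?_, fun n hn => ?_⟩
  · rcases (mem_update hs).1 hz with ⟨n, hn, ⟨rfl, rfl⟩ | ⟨hni, rfl⟩⟩
    · exact ⟨n, x, mem_omega.2 hn, hx, isOPair_iff.2 rfl⟩
    · exact ⟨n, _, mem_omega.2 hn, hs.app_mem (mem_omega.2 hn), isOPair_iff.2 rfl⟩
  · have := mem_omega.1 hn
    simp only [app_update hs, this, true_and]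
    by_cases h : n = i
    · exact ⟨x, by simp [h], by simp [h]⟩
    · exact ⟨app E s n, by simp [h], by simp [h]⟩

theorem app_update_eq {a s i x n : M} (hs : IsFun E s (omega E) a) (hx : E x a) (hn : IsNat E n) :
    (n = i → app E (update E s i x) n = x) ∧ (n ≠ i → app E (update E s i x) n = app E s n) := by
  have h := isFun_update (i := i) hs hx
  exact ⟨fun h' => h.app_eq ((app_update hs).2 ⟨hn, Or.inl ⟨h', rfl⟩⟩),
    fun h' => h.app_eq ((app_update hs).2 ⟨hn, Or.inr ⟨h', rfl⟩⟩)⟩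

theorem isUpdate_iff {a s i x s' : M} (hs : IsFun E s (omega E) a) (hx : E x a) (hi : IsNat E i) :
    IsUpdate E a s i x s' ↔ s' = update E s i x := by
  have h := isFun_update (i := i) hs hx
  constructor
  · rintro ⟨h1, h2, h3⟩
    rw [isAssignment_iff] at h1
    refine h1.ext h fun n hn => ?_
    have hn' := mem_omega.1 hn
    by_cases hni : n = i
    · subst hni
      rw [(app_update_eq hs hx hn').1 rfl, h1.app_eq h2]
    · rw [(app_update_eq hs hx hn').2 hni]
      exact h1.app_eq ((h3 n _ hn' hni).2 (hs.app_spec hn))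
  · rintro rfl
    refine ⟨isAssignment_iff.2 h, (app_update hs).2 ⟨hi, Or.inl ⟨rfl, rfl⟩⟩, fun n y hn hni => ?_⟩
    rw [app_update hs, hs.app_iff]
    simp [hn, hni]

end SetModel

namespace SetModel

variable {M : Type v} {E : M → M → Prop}

attribute [local instance 50] DefF.rename

/-- Converts a hypothesis about `R` at the indices 0 and 1 into a form that instance search can use
for arbitrary definable arguments. -/
theorem _root_.DefP.comp₂ {R : M → M → Prop} (hR : DefP E fun v => R (v 0) (v 1))
    (f g : (ℕ → M) → M) [hf : DefF E f] [hg : DefF E g] : DefP E fun v => R (f v) (g v) := by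
  have h1 : DefP E fun v => R (v 0) (g fun n => v (n + 1)) :=
    DefP.subst (Q := fun v y => R (v 0) y) (hR.rename fun n => Nat.casesOn n 1 fun _ => 0)
      (fun v => g fun n => v (n + 1))
  exact DefP.subst (Q := fun v x => R x (g v)) h1 f

theorem _root_.DefF.comp₁ {F : M → M} (hF : DefF E fun v => F (v 0))
    (f : (ℕ → M) → M) [hf : DefF E f] : DefF E fun v => F (f v) := by
  have := DefP.comp₂ (R := fun y x => y = F x) (hF.out.rename fun n => n)
  exact ⟨this (fun v => v 0) (fun v => f fun n => v (n + 1))⟩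

theorem _root_.DefP.comp₁ {P : M → Prop} (hP : DefP E fun v => P (v 0))
    (f : (ℕ → M) → M) [hf : DefF E f] : DefP E fun v => P (f v) :=
  DefP.subst (Q := fun _ x => P x) hP f

instance {a b : (ℕ → M) → M} [DefF E a] [DefF E b] : DefP E fun v => SizeLT E (a v) (b v) := by
  unfold SizeLT; infer_instance

variable [hZ : IsZFC E]

/-! ## Choice functions -/

/-- The choice axiom selects from disjoint families. The solution sets of different `x` may overlap,
but the sets `F x` of pairs with first coordinate `x` are disjoint. -/
theorem exists_choice {a b : M} (R : M → M → Prop) [hR : DefP E fun v => R (v 0) (v 1)]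
    (h : ∀ x, E x a → ∃ y, E y b ∧ R x y) :
    ∃ g, IsFun E g a b ∧ ∀ x, E x a → R x (app E g x) := by
  have hR' := hR.comp₂
  let F : M → M := fun x => mk E fun z => ∃ y, E y b ∧ R x y ∧ z = opair E x y
  have hF : ∀ x z, E z (F x) ↔ ∃ y, E y b ∧ R x y ∧ z = opair E x y := fun x z => by
    refine mem_mk (IsSet.of_subset (prod E (upair E x x) b) fun z hz => ?_)
    obtain ⟨y, hy, -, rfl⟩ := hz
    exact mem_prod.2 ⟨x, y, by simp, hy, rfl⟩
  have hFd : DefF E fun v => F (v 0) := by unfold F; infer_instance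
  obtain ⟨A, hA⟩ := isSet_image (E := E) a F
  obtain ⟨c, hc⟩ := hZ.out.choice A (fun X hX => by
    obtain ⟨x, hx, rfl⟩ := (hA X).1 hX
    obtain ⟨y, hy, hxy⟩ := h x hx
    exact ⟨opair E x y, (hF x _).2 ⟨y, hy, hxy, rfl⟩⟩) (fun X Y z hX hY hzX hzY => by
    obtain ⟨x, hx, rfl⟩ := (hA X).1 hX
    obtain ⟨x', hx', rfl⟩ := (hA Y).1 hY
    obtain ⟨y, -, -, rfl⟩ := (hF x _).1 hzX
    obtain ⟨y', -, -, h⟩ := (hF x' _).1 hzY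
    rw [(opair_inj.1 h).1])
  -- The selector `c` may have irrelevant elements, so only its pairs that occur in the family are
  -- kept.
  let g := sep E (prod E a b) fun z => E z c ∧ E z (sUnion E A)
  have hg : ∀ x y, App E g x y ↔ E x a ∧ E y b ∧ R x y ∧ E (opair E x y) c := fun x y => by
    rw [app_iff]
    simp only [g, mem_sep (E := E), mem_prod, mem_sUnion, hA, opair_inj]
    constructor
    · rintro ⟨⟨x', y', hx', hy', rfl, rfl⟩, h1, X, ⟨x'', hx'', rfl⟩, h2⟩
      obtain ⟨y'', hy'', hR, h3⟩ := (hF _ _).1 h2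
      obtain ⟨rfl, rfl⟩ := opair_inj.1 h3
      exact ⟨hx', hy', hR, h1⟩
    · rintro ⟨hx, hy, hR, h1⟩
      exact ⟨⟨x, y, hx, hy, rfl, rfl⟩, h1, F x, ⟨x, hx, rfl⟩, (hF _ _).2 ⟨y, hy, hR, rfl⟩⟩
  have hgf : IsFun E g a b := by
    refine ⟨fun z hz => ?_, fun x hx => ?_⟩
    · obtain ⟨x, y, hx, hy, rfl⟩ := mem_prod.1 (mem_sep.1 hz).1
      exact ⟨x, y, hx, hy, isOPair_iff.2 rfl⟩
    · obtain ⟨z, ⟨hz, hzc⟩, huniq⟩ := hc (F x) ((hA _).2 ⟨x, hx, rfl⟩)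
      obtain ⟨y, hy, hR, rfl⟩ := (hF _ _).1 hz
      refine ⟨y, (hg x y).2 ⟨hx, hy, hR, hzc⟩, fun y' hy' => ?_⟩
      obtain ⟨-, hy'b, hR', hc'⟩ := (hg x y').1 hy'
      exact (opair_inj.1 (huniq _ ⟨(hF _ _).2 ⟨y', hy'b, hR', rfl⟩, hc'⟩)).2
  exact ⟨g, hgf, fun x hx => ((hg x _).1 (hgf.app_spec hx)).2.2.1⟩

/-! ## Sizes below an inaccessible cardinal -/

theorem SizeLT.of_injOn {δ a b : M} (hb : SizeLT E b δ) (F : M → M) [hF : DefF E fun v => F (v 0)]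
    (h : ∀ x, E x a → E (F x) b) (hinj : ∀ x y, E x a → E y a → F x = F y → x = y) :
    SizeLT E a δ := by
  have hF' := hF.comp₁
  obtain ⟨β, g, hβ, hg, hginj⟩ := hb
  refine ⟨β, lam E a fun x => app E g (F x), hβ,
    isFun_lam fun x hx => hg.app_mem (h x hx), fun x x' y hx hx' => ?_⟩
  obtain ⟨hxa, rfl⟩ := app_lam.1 hx
  obtain ⟨hxa', he⟩ := app_lam.1 hx'
  refine hinj x x' hxa hxa' (hginj _ _ _ (hg.app_spec (h x hxa)) ?_)
  rw [he]
  exact hg.app_spec (h x' hxa')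

theorem SizeLT.of_subset {δ a b : M} (hb : SizeLT E b δ) (h : Subset E a b) : SizeLT E a δ :=
  hb.of_injOn (fun x => x) h fun _ _ _ _ h => h

theorem IsInaccessible.sizeLT {δ α : M} (_hδ : IsInaccessible E δ) (hα : E α δ) : SizeLT E α δ := by
  refine ⟨α, lam E α fun x => x, hα, isFun_lam fun x hx => hx, fun x x' y hx hx' => ?_⟩
  rw [← (app_lam.1 hx).2, ← (app_lam.1 hx').2]

theorem SizeLT.powerset {δ a : M} (hδ : IsInaccessible E δ) (ha : SizeLT E a δ) :
    SizeLT E (powerset E a) δ := by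
  obtain ⟨β, g, hβ, hg, hginj⟩ := ha
  have hP : SizeLT E (SetModel.powerset E β) δ := hδ.2.2.2 β _ hβ (isPowerset_iff.2 rfl)
  have hm : ∀ x y, E y (sep E β fun y => ∃ z, E z x ∧ App E g z y) ↔
    E y β ∧ ∃ z, E z x ∧ App E g z y := fun x y => mem_sep
  refine hP.of_injOn (fun x => sep E β fun y => ∃ z, E z x ∧ App E g z y)
    (fun x _ => mem_powerset.2 fun y hy => ((hm x y).1 hy).1) fun x x' hx hx' h => ?_
  have key : ∀ {x x'}, Subset E x a → (sep E β fun y => ∃ z, E z x ∧ App E g z y) =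
      (sep E β fun y => ∃ z, E z x' ∧ App E g z y) → Subset E x x' := by
    intro x x' hx h z hz
    have h1 := hg.app_spec (hx z hz)
    obtain ⟨z', hz', h2⟩ := ((hm x' _).1 (h ▸ (hm x _).2 ⟨hg.app_mem_right h1, z, hz, h1⟩)).2
    rwa [hginj _ _ _ h1 h2]
  exact subset_antisymm (key (mem_powerset.1 hx) h) (key (mem_powerset.1 hx') h.symm)

/-- A definable function from a small set to `δ` is bounded. -/
theorem SizeLT.exists_bound {δ a : M} (hδ : IsInaccessible E δ) (ha : SizeLT E a δ) (F : M → M)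
    [hF : DefF E fun v => F (v 0)] (h : ∀ x, E x a → E (F x) δ) :
    ∃ β, E β δ ∧ ∀ x, E x a → E (F x) β := by
  have hF' := hF.comp₁
  obtain ⟨α, g, hα, hg, hginj⟩ := ha
  obtain ⟨w, hw, hwδ⟩ := hδ.2.1
  have h0 : E (empty E) δ := hδ.1.mem_trans hwδ ((hw _).2 isNat_empty)
  -- Regularity in `IsInaccessible` is about functions on an ordinal, so `F` is transported along
  -- the injection `g`, with default value `∅` off its range.
  let P : M → M → Prop := fun γ y => (∃ x, App E g x γ ∧ y = F x) ∨
    ((¬ ∃ x, App E g x γ) ∧ y = empty E)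
  have hP : ∀ γ, ∃! y, P γ y := fun γ => by
    by_cases hγ : ∃ x, App E g x γ
    · obtain ⟨x, hx⟩ := hγ
      refine ⟨F x, Or.inl ⟨x, hx, rfl⟩, ?_⟩
      rintro y (⟨x', hx', rfl⟩ | ⟨hn, -⟩)
      · rw [hginj _ _ _ hx hx']
      · exact absurd ⟨x, hx⟩ hn
    · exact ⟨empty E, Or.inr ⟨hγ, rfl⟩, fun y hy => (hy.resolve_left
        fun ⟨x, hx, _⟩ => hγ ⟨x, hx⟩).2⟩
  have hd : DefF E fun v => the E (P (v 0)) := by unfold P; infer_instance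
  obtain ⟨β, hβ, hb⟩ := hδ.2.2.1 α (lam E α fun γ => the E (P γ)) hα (isFun_lam fun γ _ => by
    rcases the_spec (E := E) (hP γ) with ⟨x, hx, h'⟩ | ⟨-, h'⟩
    · rw [h']; exact h x (hg.app_mem_left hx)
    · rw [h']; exact h0)
  refine ⟨β, hβ, fun x hx => ?_⟩
  have h1 := hg.app_spec hx
  exact hb (app E g x) _ (app_lam.2 ⟨hg.app_mem hx, (the_eq (hP _) (Or.inl ⟨x, h1, rfl⟩)).symm⟩)

theorem IsInaccessible.omega_mem {δ : M} (hδ : IsInaccessible E δ) : E (omega E) δ := by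
  obtain ⟨w, hw, hwδ⟩ := hδ.2.1
  exact isOmega_iff.1 hw ▸ hwδ

theorem IsInaccessible.succ_mem {δ α : M} (hδ : IsInaccessible E δ) (hα : E α δ) :
    E (succ E α) δ := by
  -- A bound for the constant function with value `α` is an ordinal strictly between `α` and `δ`.
  obtain ⟨β, hβ, hb⟩ := (hδ.sizeLT hδ.omega_mem).exists_bound hδ (fun _ => α) fun _ _ => hα
  have h1 : E α β := hb (empty E) (mem_omega.2 isNat_empty)
  have hα' := hδ.1.mem hα
  have hβ' := hδ.1.mem hβ
  rcases hα'.succ.trichotomy hβ' with h | h | h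
  · exact hδ.1.mem_trans hβ h
  · exact h ▸ hβ
  · rcases mem_succ.1 h with h | rfl
    · exact absurd h (not_mem_of_mem h1)
    · exact absurd h1 (not_mem_self β)

/-- A monotone definable condition on ordinals below `δ` that depends on a parameter from a small
set has a uniform solution. -/
theorem SizeLT.exists_uniform {δ Q : M} (hδ : IsInaccessible E δ) (hQ : SizeLT E Q δ)
    (Φ : M → M → Prop) [hΦ : DefP E fun v => Φ (v 0) (v 1)]
    (hmono : ∀ q ξ ξ', E q Q → E ξ' δ → Subset E ξ ξ' → Φ q ξ → Φ q ξ') :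
    ∃ μ, E μ δ ∧ ∀ q, E q Q → (∃ ξ, E ξ δ ∧ Φ q ξ) → Φ q μ := by
  have hΦ' := hΦ.comp₂
  -- `P q` singles out the least solution for `q`, or `∅` if there is none. This makes the solution
  -- a definable function of `q`, which is bounded below `δ`.
  let P : M → M → Prop := fun q ξ => E ξ δ ∧ ((Φ q ξ ∧ ∀ ξ', E ξ' ξ → ¬ Φ q ξ') ∨
    ((¬ ∃ ξ, E ξ δ ∧ Φ q ξ) ∧ ξ = empty E))
  have h0 : E (empty E) δ := hδ.1.mem_trans hδ.omega_mem (mem_omega.2 isNat_empty)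
  have hP : ∀ q, ∃! ξ, P q ξ := fun q => by
    by_cases hq : ∃ ξ, E ξ δ ∧ Φ q ξ
    · obtain ⟨ξ, hξ, hqξ⟩ := hq
      obtain ⟨ζ, hζ, hζξ, hqζ, hmin⟩ := (hδ.1.mem hξ).exists_min (P := Φ q) hqξ
      have hζδ : E ζ δ := hζξ.elim (fun h => h ▸ hξ) fun h => hδ.1.mem_trans hξ h
      refine ⟨ζ, ⟨hζδ, Or.inl ⟨hqζ, hmin⟩⟩, ?_⟩
      rintro η ⟨hη, ⟨h1, h2⟩ | ⟨h1, -⟩⟩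
      · rcases (hδ.1.mem hη).trichotomy hζ with h | h | h
        · exact absurd h1 (hmin η h)
        · exact h
        · exact absurd hqζ (h2 ζ h)
      · exact absurd ⟨ξ, hξ, hqξ⟩ h1
    · refine ⟨empty E, ⟨h0, Or.inr ⟨hq, rfl⟩⟩, ?_⟩
      rintro η ⟨hη, ⟨h1, -⟩ | ⟨-, h2⟩⟩
      · exact absurd ⟨η, hη, h1⟩ hq
      · exact h2
  have hd : DefF E fun v => the E (P (v 0)) := by unfold P; infer_instance
  obtain ⟨μ, hμ, hb⟩ := hQ.exists_bound hδ (fun q => the E (P q)) fun q _ =>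
    (the_spec (hP q)).1
  refine ⟨μ, hμ, fun q hq hex => ?_⟩
  have h1 := the_spec (E := E) (hP q)
  refine hmono q _ μ hq hμ ((hδ.1.mem hμ).1 _ (hb q hq)) ?_
  rcases h1.2 with h | h
  · exact h.1
  · exact absurd hex h.1

/-! ## Recursion -/

/-- Recursion along `δ`: the value at `β` is the least `μ` that is related to all earlier values. It
exists because `h` makes every earlier value related to all large `μ`, and fewer than `δ` many
thresholds have a common bound. The approximations `Ap` agree where both are defined, so they glue
to one function. -/
theorem IsInaccessible.exists_sequence {δ : M} (hδ : IsInaccessible E δ) (R : M → M → Prop)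
    [hR : DefP E fun v => R (v 0) (v 1)]
    (h : ∀ β, E β δ → ∃ μ, E μ δ ∧ ∀ μ', E μ' δ → Subset E μ μ' → R β μ') :
    ∃ g, IsFun E g δ δ ∧ ∀ β β', E β δ → E β' β → R (app E g β') (app E g β) := by
  have hR' := hR.comp₂
  let S : M → M → M → Prop := fun g β μ => ∀ β', E β' β → R (app E g β') μ
  let L : M → M → M → Prop := fun g β μ => E μ δ ∧ S g β μ ∧ ∀ μ', E μ' μ → ¬ S g β μ'
  have hL : ∀ {a b c : (ℕ → M) → M} [DefF E a] [DefF E b] [DefF E c],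
      DefP E fun v => L (a v) (b v) (c v) := by
    intros; unfold L S; infer_instance
  let Ap : M → M → Prop := fun g α => IsFun E g α δ ∧ ∀ β, E β α → L g β (app E g β)
  have hAp : ∀ {a b : (ℕ → M) → M} [DefF E a] [DefF E b], DefP E fun v => Ap (a v) (b v) := by
    intros; unfold Ap; infer_instance
  have hLuniq : ∀ {g g' β μ μ'}, (∀ β', E β' β → app E g β' = app E g' β') → L g β μ →
      L g' β μ' → μ = μ' := by
    intro g g' β μ μ' hgg h1 h2
    have hS : ∀ μ, S g β μ ↔ S g' β μ := fun μ =>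
      forall₂_congr fun β' hβ' => by rw [hgg β' hβ']
    rcases (hδ.1.mem h1.1).trichotomy (hδ.1.mem h2.1) with h | h | h
    · exact absurd ((hS _).1 h1.2.1) (h2.2.2 _ h)
    · exact h
    · exact absurd ((hS _).2 h2.2.1) (h1.2.2 _ h)
  have hLex : ∀ {g β}, E β δ → IsFun E g β δ → ∃ μ, L g β μ := by
    intro g β hβ hg
    obtain ⟨μ, hμ, hb⟩ := (hδ.sizeLT hβ).exists_uniform hδ
      (fun β' ξ => ∀ μ', E μ' δ → Subset E ξ μ' → R (app E g β') μ')
      fun q ξ ξ' _ _ hξ hq μ' hμ' hs => hq μ' hμ' (hξ.trans hs)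
    obtain ⟨ζ, hζ, hζμ, hS, hmin⟩ := (hδ.1.mem hμ).exists_min (P := fun μ => S g β μ)
      (hP := by unfold S; infer_instance)
      fun β' hβ' => hb β' hβ' (h _ (hg.app_mem hβ')) μ hμ (Subset.refl _)
    exact ⟨ζ, hζμ.elim (fun h => h ▸ hμ) fun h => hδ.1.mem_trans hμ h, hS, hmin⟩
  have hagree : ∀ {g g' α α' β}, Ap g α → Ap g' α' → E β δ → IsOrd E α → IsOrd E α' →
      E β α → E β α' → app E g β = app E g' β := by
    intro g g' α α' β hg hg' hβ hα hα'
    refine IsOrd.induction (E := E) (P := fun β => E β α → E β α' → app E g β = app E g' β)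
      (fun β _ ih h1 h2 => ?_) (hδ.1.mem hβ)
    exact hLuniq (fun β' hβ' => ih β' hβ' (hα.mem_trans h1 hβ') (hα'.mem_trans h2 hβ'))
      (hg.2 β h1) (hg'.2 β h2)
  let G : M → M := fun β => the E fun μ => ∃ g, Ap g β ∧ L g β μ
  have hG : DefF E fun v => G (v 0) := by unfold G; infer_instance
  have hGspec : ∀ {β g μ}, E β δ → Ap g β → L g β μ → G β = μ := by
    intro β g μ hβ hg hμ
    refine the_eq ⟨μ, ⟨g, hg, hμ⟩, ?_⟩ ⟨g, hg, hμ⟩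
    rintro μ' ⟨g', hg', hμ'⟩
    exact hLuniq (fun β' hβ' => hagree hg' hg (hδ.1.mem_trans hβ hβ') (hδ.1.mem hβ)
      (hδ.1.mem hβ) hβ' hβ') hμ' hμ
  have hstep : ∀ {α}, Subset E α δ → IsOrd E α → (∀ β, E β α → ∃ g, Ap g β) →
      Ap (lam E α G) α := by
    intro α hαδ hα ih
    have hval : ∀ {β g}, E β α → Ap g β → L g β (G β) := by
      intro β g hβ hg
      obtain ⟨μ, hμ⟩ := hLex (hαδ β hβ) hg.1
      rwa [hGspec (hαδ β hβ) hg hμ]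
    refine ⟨isFun_lam fun β hβ => ?_, fun β hβ => ?_⟩
    · obtain ⟨g, hg⟩ := ih β hβ
      exact (hval hβ hg).1
    · rw [app_lam_eq hβ]
      obtain ⟨g, hg⟩ := ih β hβ
      have hs : ∀ β', E β' β → app E g β' = app E (lam E α G) β' := fun β' hβ' => by
        have hβ'α := hα.mem_trans hβ hβ'
        rw [app_lam_eq hβ'α]
        obtain ⟨g', hg'⟩ := ih β' hβ'α
        refine hLuniq (fun β'' hβ'' => ?_) (hg.2 β' hβ') (hval hβ'α hg')
        have hβo := hα.mem hβ
        exact hagree hg hg' (hαδ _ (hα.mem_trans hβ'α hβ'')) hβo (hβo.mem hβ')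
          (hβo.mem_trans hβ' hβ'') hβ''
      have h1 := hval hβ hg
      have hS : ∀ μ, S g β μ ↔ S (lam E α G) β μ := fun μ =>
        forall₂_congr fun β' hβ' => by rw [hs β' hβ']
      exact ⟨h1.1, (hS _).1 h1.2.1, fun μ' hμ' h => h1.2.2 μ' hμ' ((hS _).2 h)⟩
  have hall : ∀ {β}, E β δ → ∃ g, Ap g β := by
    intro β hβ
    refine IsOrd.induction (E := E) (P := fun β => E β δ → ∃ g, Ap g β)
      (fun β hβ ih hβδ => ?_) (hδ.1.mem hβ) hβ
    exact ⟨_, hstep (hδ.1.1 β hβδ) hβ fun β' hβ' => ih β' hβ' (hδ.1.mem_trans hβδ hβ')⟩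
  have hfin := hstep (Subset.refl _) hδ.1 fun β hβ => hall hβ
  exact ⟨_, hfin.1, fun β β' hβ hβ' => (hfin.2 β hβ).2.1 β' hβ'⟩

end SetModel

namespace SetModel

variable {M : Type v} {E : M → M → Prop}

attribute [local instance 50] DefF.rename

/-! ## The cumulative hierarchy up to an inaccessible cardinal -/

/-- `m` is a transitive set closed under subsets and under the usual set operations. -/
structure IsUniverse (E : M → M → Prop) [IsZFC E] (m : M) : Prop where
  trans : ∀ {x y}, E x m → E y x → E y m
  sub : ∀ {x y}, E x m → Subset E y x → E y m
  upair : ∀ {x y}, E x m → E y m → E (SetModel.upair E x y) m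
  pow : ∀ {x}, E x m → E (SetModel.powerset E x) m
  sUnion : ∀ {x}, E x m → E (SetModel.sUnion E x) m
  omega : E (SetModel.omega E) m

variable [hZ : IsZFC E]

namespace IsUniverse

variable {m x y : M}

theorem opair (hm : IsUniverse E m) (hx : E x m) (hy : E y m) : E (opair E x y) m :=
  hm.upair (hm.upair hx hx) (hm.upair hx hy)

theorem opair_left (hm : IsUniverse E m) (h : E (SetModel.opair E x y) m) : E x m :=
  hm.trans (x := SetModel.upair E x x) (hm.trans h (by simp [SetModel.opair])) (by simp)

theorem opair_right (hm : IsUniverse E m) (h : E (SetModel.opair E x y) m) : E y m :=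
  hm.trans (x := SetModel.upair E x y) (hm.trans h (by simp [SetModel.opair])) (by simp)

theorem union (hm : IsUniverse E m) (hx : E x m) (hy : E y m) : E (union E x y) m := by
  have : SetModel.union E x y = SetModel.sUnion E (SetModel.upair E x y) :=
    ext E fun z => by simp
  exact this ▸ hm.sUnion (hm.upair hx hy)

theorem succ (hm : IsUniverse E m) (hx : E x m) : E (succ E x) m := by
  have : SetModel.succ E x = SetModel.union E x (SetModel.upair E x x) :=
    ext E fun z => by simp
  exact this ▸ hm.union hx (hm.upair hx hx)

theorem prod (hm : IsUniverse E m) (hx : E x m) (hy : E y m) : E (prod E x y) m := by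
  refine hm.sub (hm.pow (hm.pow (hm.union hx hy))) fun z hz => ?_
  obtain ⟨a, b, ha, hb, rfl⟩ := mem_prod.1 hz
  simp only [mem_powerset]
  intro w hw
  simp only [mem_powerset]
  intro c hc
  simp only [mem_union]
  rcases mem_upair.1 hw with rfl | rfl <;> rcases mem_upair.1 hc with rfl | rfl <;> simp [*]

theorem isFun (hm : IsUniverse E m) {f : M} (hx : E x m) (hy : E y m) (hf : IsFun E f x y) :
    E f m :=
  hm.sub (hm.prod hx hy) fun _ hz => hf.mem_prod hz

theorem funs (hm : IsUniverse E m) (hx : E x m) (hy : E y m) : E (funs E x y) m :=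
  hm.sub (hm.pow (hm.prod hx hy)) fun _ hf =>
    mem_powerset.2 fun _ hz => (mem_funs.1 hf).mem_prod hz

theorem nat (hm : IsUniverse E m) (hx : IsNat E x) : E x m := hm.trans hm.omega (mem_omega.2 hx)

theorem empty (hm : IsUniverse E m) : E (empty E) m := hm.nat isNat_empty

theorem tag (hm : IsUniverse E m) {k : ℕ} (hx : E x m) (hy : E y m) : E (tag E k x y) m :=
  hm.opair (hm.nat (isNat_num k)) (hm.opair hx hy)

end IsUniverse

/-- `δ` is an inaccessible cardinal and `f` is a function on `δ + 1` that enumerates the levels of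
the cumulative hierarchy. -/
structure Hierarchy (E : M → M → Prop) [IsZFC E] (δ f : M) : Prop where
  inacc : IsInaccessible E δ
  total : ∀ β, E β (succ E δ) → ∃! y, App E f β y
  spec : ∀ β y, E β (succ E δ) → App E f β y →
    ∀ x, E x y ↔ ∃ ξ w, E ξ β ∧ App E f ξ w ∧ Subset E x w

namespace Hierarchy

variable {δ f : M}

theorem isOrd (h : Hierarchy E δ f) : IsOrd E δ := h.inacc.1

theorem self_mem (_ : Hierarchy E δ f) : E δ (succ E δ) := by simp

theorem mem_succ (_ : Hierarchy E δ f) {ξ : M} (hξ : E ξ δ) : E ξ (succ E δ) := by simp [hξ]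

theorem trans (h : Hierarchy E δ f) {β ξ : M} (hβ : E β (succ E δ)) (hξ : E ξ β) : E ξ δ := by
  rcases SetModel.mem_succ.1 hβ with hβ | rfl
  · exact h.isOrd.mem_trans hβ hξ
  · exact hξ

theorem ord (h : Hierarchy E δ f) {β : M} (hβ : E β (succ E δ)) : IsOrd E β :=
  h.isOrd.succ.mem hβ

theorem app_spec (h : Hierarchy E δ f) {β : M} (hβ : E β (succ E δ)) : App E f β (app E f β) :=
  the_spec (h.total β hβ)

theorem app_iff (h : Hierarchy E δ f) {β y : M} (hβ : E β (succ E δ)) :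
    App E f β y ↔ y = app E f β :=
  ⟨fun hy => (the_eq (h.total β hβ) hy).symm, fun hy => hy ▸ h.app_spec hβ⟩

theorem mem_iff (h : Hierarchy E δ f) {β x : M} (hβ : E β (succ E δ)) :
    E x (app E f β) ↔ ∃ ξ, E ξ β ∧ Subset E x (app E f ξ) := by
  rw [h.spec β _ hβ (h.app_spec hβ)]
  refine exists_congr fun ξ => ⟨?_, fun ⟨hξ, hx⟩ => ⟨_, hξ, ?_, hx⟩⟩
  · rintro ⟨w, hξ, hw, hx⟩
    rw [h.app_iff (h.mem_succ (h.trans hβ hξ))] at hw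
    exact ⟨hξ, hw ▸ hx⟩
  · exact h.app_spec (h.mem_succ (h.trans hβ hξ))

theorem mem_of_subset (h : Hierarchy E δ f) {β x y : M} (hβ : E β (succ E δ))
    (hx : E x (app E f β)) (hy : Subset E y x) : E y (app E f β) := by
  obtain ⟨ξ, hξ, hxξ⟩ := (h.mem_iff hβ).1 hx
  exact (h.mem_iff hβ).2 ⟨ξ, hξ, hy.trans hxξ⟩

theorem mono (h : Hierarchy E δ f) {α β : M} (hα : E α (succ E δ)) (hβ : E β (succ E δ))
    (hs : Subset E α β) : Subset E (app E f α) (app E f β) := fun x hx => by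
  obtain ⟨ξ, hξ, hxξ⟩ := (h.mem_iff hα).1 hx
  exact (h.mem_iff hβ).2 ⟨ξ, hs ξ hξ, hxξ⟩

theorem mem_of_mem (h : Hierarchy E δ f) {β x y : M} (hβ : E β (succ E δ))
    (hx : E x (app E f β)) (hy : E y x) : E y (app E f β) := by
  obtain ⟨ξ, hξ, hxξ⟩ := (h.mem_iff hβ).1 hx
  exact h.mono (h.mem_succ (h.trans hβ hξ)) hβ ((h.ord hβ).1 ξ hξ) y (hxξ y hy)

theorem level_mem (h : Hierarchy E δ f) {β ξ : M} (hβ : E β (succ E δ)) (hξ : E ξ β) :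
    E (app E f ξ) (app E f β) := (h.mem_iff hβ).2 ⟨ξ, hξ, Subset.refl _⟩

theorem subset_level (h : Hierarchy E δ f) {β : M} (hβ : E β (succ E δ)) :
    Subset E β (app E f β) := by
  refine IsOrd.induction (E := E) (P := fun β => E β (succ E δ) → Subset E β (app E f β))
    (fun β _ ih hβ ξ hξ => ?_) (h.ord hβ) hβ
  exact (h.mem_iff hβ).2 ⟨ξ, hξ, ih ξ hξ (h.mem_succ (h.trans hβ hξ))⟩

theorem ord_mem (h : Hierarchy E δ f) {β ξ : M} (hβ : E β (succ E δ)) (hξ : E ξ β) :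
    E ξ (app E f β) := h.subset_level hβ ξ hξ

theorem isUniverse (h : Hierarchy E δ f) {β : M} (hβ : E β (succ E δ)) (hω : E (omega E) β)
    (hlim : ∀ ξ, E ξ β → E (succ E ξ) β) : IsUniverse E (app E f β) where
  trans hx hy := h.mem_of_mem hβ hx hy
  sub hx hy := h.mem_of_subset hβ hx hy
  omega := h.ord_mem hβ hω
  upair {x y} hx hy := by
    obtain ⟨ξ, hξ, hx⟩ := (h.mem_iff hβ).1 hx
    obtain ⟨η, hη, hy⟩ := (h.mem_iff hβ).1 hy
    obtain ⟨ζ, hζ, h1, h2⟩ := (h.ord hβ).exists_max hξ hη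
    have hs : ∀ {ξ}, E ξ β → E ξ (succ E δ) := fun hξ => h.mem_succ (h.trans hβ hξ)
    refine (h.mem_iff hβ).2 ⟨succ E ζ, hlim ζ hζ, fun z hz => ?_⟩
    refine (h.mem_iff (hs (hlim ζ hζ))).2 ⟨ζ, by simp, ?_⟩
    rcases mem_upair.1 hz with rfl | rfl
    · exact hx.trans (h.mono (hs hξ) (hs hζ) h1)
    · exact hy.trans (h.mono (hs hη) (hs hζ) h2)
  pow {x} hx := by
    obtain ⟨ξ, hξ, hx⟩ := (h.mem_iff hβ).1 hx
    have hs : ∀ {ξ}, E ξ β → E ξ (succ E δ) := fun hξ => h.mem_succ (h.trans hβ hξ)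
    refine (h.mem_iff hβ).2 ⟨succ E ξ, hlim ξ hξ, fun z hz => ?_⟩
    exact (h.mem_iff (hs (hlim ξ hξ))).2 ⟨ξ, by simp, (mem_powerset.1 hz).trans hx⟩
  sUnion {x} hx := by
    obtain ⟨ξ, hξ, hx⟩ := (h.mem_iff hβ).1 hx
    refine (h.mem_iff hβ).2 ⟨ξ, hξ, fun z hz => ?_⟩
    obtain ⟨w, hw, hz⟩ := mem_sUnion.1 hz
    exact h.mem_of_mem (h.mem_succ (h.trans hβ hξ)) (hx w hw) hz

theorem isUniverse_top (h : Hierarchy E δ f) : IsUniverse E (app E f δ) :=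
  h.isUniverse h.self_mem h.inacc.omega_mem fun _ hξ => h.inacc.succ_mem hξ

/-- The levels below `δ` have fewer than `δ` elements. -/
theorem sizeLT_level (h : Hierarchy E δ f) {ξ : M} (hξ : E ξ δ) : SizeLT E (app E f ξ) δ := by
  refine IsOrd.induction (E := E) (P := fun ξ => E ξ δ → SizeLT E (app E f ξ) δ)
    (fun ξ hξo ih hξ => ?_) (h.isOrd.mem hξ) hξ
  have hs : ∀ {η}, E η δ → E η (succ E δ) := h.mem_succ
  -- By induction each power set of an earlier level injects into an ordinal below `δ`. Injections
  -- and ordinals are chosen simultaneously, and regularity bounds the ordinals.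
  obtain ⟨c, hc, hcR⟩ := exists_choice (E := E) (a := ξ)
    (b := powerset E (prod E (powerset E (app E f δ)) δ))
    (fun η g => ∃ β, E β δ ∧ IsInj E g (powerset E (app E f η)) β) fun η hη => by
      have hηδ := h.isOrd.mem_trans hξ hη
      obtain ⟨β, g, hβ, hg⟩ := (ih η hη hηδ).powerset h.inacc
      refine ⟨g, mem_powerset.2 fun z hz => ?_, β, hβ, hg⟩
      obtain ⟨x, y, hx, hy, rfl⟩ := mem_prod.1 (hg.1.mem_prod hz)
      refine mem_prod.2 ⟨x, y, mem_powerset.2 ((mem_powerset.1 hx).trans ?_),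
        h.isOrd.mem_trans hβ hy, rfl⟩
      exact h.mono (hs hηδ) h.self_mem (h.isOrd.1 η hηδ)
  obtain ⟨d, hd, hdR⟩ := exists_choice (E := E) (a := ξ) (b := δ)
    (fun η β => IsInj E (app E c η) (powerset E (app E f η)) β) fun η hη => hcR η hη
  obtain ⟨β, hβ, hb⟩ := h.inacc.2.2.1 ξ d hξ hd
  obtain ⟨μ, hμ, hξμ, hβμ⟩ := h.isOrd.exists_max hξ hβ
  -- `η` is the least index of a level that includes `x`.
  let P : M → M → Prop := fun x η => E η ξ ∧ Subset E x (app E f η) ∧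
    ∀ η', E η' η → ¬ Subset E x (app E f η')
  have hP : ∀ x, E x (app E f ξ) → ∃! η, P x η := fun x hx => by
    obtain ⟨η, hη, hxη⟩ := (h.mem_iff (hs hξ)).1 hx
    obtain ⟨ζ, hζ, hζη, hxζ, hmin⟩ := (hξo.mem hη).exists_min
      (P := fun η => Subset E x (app E f η)) hxη
    refine ⟨ζ, ⟨hζη.elim (fun h => h ▸ hη) fun h => hξo.mem_trans hη h, hxζ, hmin⟩, ?_⟩
    rintro ζ' ⟨h1, h2, h3⟩
    rcases (hξo.mem h1).trichotomy hζ with h | h | h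
    · exact absurd h2 (hmin _ h)
    · exact h
    · exact absurd hxζ (h3 _ h)
  have hPd : DefF E fun v => the E (P (v 0)) := by unfold P; infer_instance
  have hPd' := hPd.comp₁ (F := fun x => the E (P x))
  have hval : ∀ x, E x (app E f ξ) →
      App E (app E c (the E (P x))) x (app E (app E c (the E (P x))) x) ∧
      E (app E (app E c (the E (P x))) x) μ := fun x hx => by
    obtain ⟨h1, h2, -⟩ := the_spec (E := E) (hP x hx)
    have h3 := hdR _ h1
    refine ⟨h3.1.app_spec (mem_powerset.2 h2), hβμ _ ?_⟩
    have h4 := hb _ _ (hd.app_spec h1)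
    exact (h.isOrd.mem hβ).mem_trans h4 (h3.1.app_mem (mem_powerset.2 h2))
  -- An element is coded by its least level and its value under the injection for that level. This
  -- is a Kuratowski pair of ordinals below `μ`, hence a member of the double power set of `μ`.
  refine (((h.inacc.sizeLT hμ).powerset h.inacc).powerset h.inacc).of_injOn
    (fun x => opair E (the E (P x)) (app E (app E c (the E (P x))) x))
    (fun x hx => ?_) fun x y hx hy hxy => ?_
  · have h1 := hξμ _ (the_spec (E := E) (hP x hx)).1
    have h2 := (hval x hx).2
    refine mem_powerset.2 fun z hz => mem_powerset.2 fun w hw => ?_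
    rcases mem_upair.1 hz with rfl | rfl <;> rcases mem_upair.1 hw with rfl | rfl <;>
      assumption
  · obtain ⟨h1, h2⟩ := opair_inj.1 hxy
    have h3 := (hval x hx).1
    rw [h2, h1] at h3
    exact (hdR _ (the_spec (E := E) (hP y hy)).1).2 _ _ _ h3 (hval y hy).1

theorem sizeLT (h : Hierarchy E δ f) {x : M} (hx : E x (app E f δ)) : SizeLT E x δ := by
  obtain ⟨ξ, hξ, hxξ⟩ := (h.mem_iff h.self_mem).1 hx
  exact (h.sizeLT_level hξ).of_subset hxξ

theorem isRank (h : Hierarchy E δ f) {α : M} (hα : E α (succ E δ)) :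
    IsRank E (app E f α) α := by
  have hs : ∀ {β}, E β (succ E α) → E β (succ E δ) := fun {β} hβ => by
    rcases SetModel.mem_succ.1 hβ with hβ | rfl
    · exact h.isOrd.succ.mem_trans hα hβ
    · exact hα
  refine ⟨f, succ E α, isSucc_iff.2 rfl, fun β hβ => h.total β (hs hβ),
    fun β y hβ hy => h.spec β y (hs hβ) hy, h.app_spec hα⟩

end Hierarchy

theorem IsRank.exists_hierarchy {δ w : M} (hδ : IsInaccessible E δ) (hw : IsRank E w δ) :
    ∃ f, Hierarchy E δ f ∧ w = app E f δ := by
  obtain ⟨f, s, hs, h1, h2, h3⟩ := hw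
  rw [isSucc_iff] at hs
  subst hs
  refine ⟨f, ⟨hδ, h1, h2⟩, ?_⟩
  exact (the_eq (h1 δ (by simp)) h3).symm

end SetModel

namespace SetModel

variable {M : Type v} {E : M → M → Prop} [hZ : IsZFC E]

attribute [local instance 50] DefF.rename

/-! ## Formulas -/

/-- A monotone definable operator on a powerset has a fixed point. -/
theorem exists_fixedPoint (B : M) (R : M → M → Prop) [hR : DefP E fun v => R (v 0) (v 1)]
    (hB : ∀ X z, Subset E X B → R X z → E z B)
    (hmono : ∀ X Y z, Subset E X Y → R X z → R Y z) : ∃ W, Subset E W B ∧ ∀ z, E z W ↔ R W z := by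
  have hR' := hR.comp₂
  -- The least fixed point, as the intersection of all closed subsets of `B` (Knaster–Tarski).
  let W := sep E B fun z => ∀ X, Subset E X B → (∀ w, R X w → E w X) → E z X
  have hW : ∀ {z}, E z W ↔ E z B ∧ ∀ X, Subset E X B → (∀ w, R X w → E w X) → E z X := mem_sep
  have hWB : Subset E W B := fun z hz => (hW.1 hz).1
  have h1 : ∀ z, R W z → E z W := fun z hz => hW.2 ⟨hB W z hWB hz, fun X hX hc =>
    hc z (hmono W X z (fun w hw => (hW.1 hw).2 X hX hc) hz)⟩
  refine ⟨W, hWB, fun z => ⟨fun hz => ?_, h1 z⟩⟩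
  have hm : ∀ {z}, E z (sep E W fun z => R W z) ↔ E z W ∧ R W z := mem_sep
  have hs : Subset E (sep E W fun z => R W z) W := fun z hz => (hm.1 hz).1
  refine (hm.1 ((hW.1 hz).2 _ (hs.trans hWB) fun w hw => ?_)).2
  have := hmono _ W w hs hw
  exact hm.2 ⟨h1 w this, this⟩

section Atom

variable {atom : M → Prop}

theorem isClosedUnderFormation_iff {P : M} : IsClosedUnderFormation E atom P ↔
    E (empty E) P ∧ (∀ i j, IsNat E i → IsNat E j → E (tag E 0 i j) P) ∧ (∀ c, atom c → E c P) ∧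
    (∀ p q, E p P → E q P → E (tag E 3 p q) P) ∧
    (∀ i p, IsNat E i → E p P → E (tag E 4 i p) P) := by
  simp only [IsClosedUnderFormation, isEmptySet_iff, isTagged_iff]
  constructor
  · rintro ⟨h1, h2, h3, h4, h5⟩
    exact ⟨h1 _ rfl, fun i j hi hj => h2 _ i j hi hj rfl, h3, fun p q hp hq => h4 _ p q hp hq rfl,
      fun i p hi hp => h5 _ i p hi hp rfl⟩
  · rintro ⟨h1, h2, h3, h4, h5⟩
    refine ⟨?_, ?_, h3, ?_, ?_⟩
    · rintro c rfl; exact h1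
    · rintro c i j hi hj rfl; exact h2 i j hi hj
    · rintro c p q hp hq rfl; exact h4 p q hp hq
    · rintro c i p hi hp rfl; exact h5 i p hi hp

theorem isFormula_empty : IsFormula E atom (empty E) := fun _ hP =>
  (isClosedUnderFormation_iff.1 hP).1

theorem isFormula_eq {i j : M} (hi : IsNat E i) (hj : IsNat E j) :
    IsFormula E atom (tag E 0 i j) := fun _ hP =>
  (isClosedUnderFormation_iff.1 hP).2.1 i j hi hj

theorem isFormula_atom {c : M} (hc : atom c) : IsFormula E atom c := fun _ hP =>
  (isClosedUnderFormation_iff.1 hP).2.2.1 c hc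

theorem IsFormula.imp {p q : M} (hp : IsFormula E atom p) (hq : IsFormula E atom q) :
    IsFormula E atom (tag E 3 p q) := fun P hP =>
  (isClosedUnderFormation_iff.1 hP).2.2.2.1 p q (hp P hP) (hq P hP)

theorem IsFormula.all {i p : M} (hi : IsNat E i) (hp : IsFormula E atom p) :
    IsFormula E atom (tag E 4 i p) := fun P hP =>
  (isClosedUnderFormation_iff.1 hP).2.2.2.2 i p hi (hp P hP)

/-- Induction on formulas. -/
theorem IsFormula.induction {U : M} (hU : IsClosedUnderFormation E atom U) {Q : M → Prop}
    [hQ : DefP E fun v => Q (v 0)] [ha : DefP E fun v => atom (v 0)] (h0 : Q (empty E))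
    (h1 : ∀ i j, IsNat E i → IsNat E j → Q (tag E 0 i j)) (h2 : ∀ c, atom c → Q c)
    (h3 : ∀ p q, IsFormula E atom p → IsFormula E atom q → Q p → Q q → Q (tag E 3 p q))
    (h4 : ∀ i p, IsNat E i → IsFormula E atom p → Q p → Q (tag E 4 i p)) {p : M}
    (hp : IsFormula E atom p) : Q p := by
  have hQ' := hQ.comp₁
  have ha' := ha.comp₁
  -- `IsFormula` quantifies over closed sets, so the class to which minimality is applied must be a
  -- set. The closed set `U` serves as a bound.
  have hm : ∀ {z}, E z (sep E U fun z => IsFormula E atom z ∧ Q z) ↔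
      E z U ∧ IsFormula E atom z ∧ Q z := mem_sep
  have hU' := isClosedUnderFormation_iff.1 hU
  refine (hm.1 (hp (sep E U fun z => IsFormula E atom z ∧ Q z)
    (isClosedUnderFormation_iff.2 ⟨?_, ?_, ?_, ?_, ?_⟩))).2.2
  · exact hm.2 ⟨hU'.1, isFormula_empty, h0⟩
  · exact fun i j hi hj => hm.2 ⟨hU'.2.1 i j hi hj, isFormula_eq hi hj, h1 i j hi hj⟩
  · exact fun c hc => hm.2 ⟨hU'.2.2.1 c hc, isFormula_atom hc, h2 c hc⟩
  · intro p q hp hq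
    obtain ⟨hp, hp', hp''⟩ := hm.1 hp
    obtain ⟨hq, hq', hq''⟩ := hm.1 hq
    exact hm.2 ⟨hU'.2.2.2.1 p q hp hq, hp'.imp hq', h3 p q hp' hq' hp'' hq''⟩
  · intro i p hi hp
    obtain ⟨hp, hp', hp''⟩ := hm.1 hp
    exact hm.2 ⟨hU'.2.2.2.2 i p hi hp, hp'.all hi, h4 i p hi hp' hp''⟩

end Atom

theorem memAtom_iff {c : M} : MemAtom E c ↔ ∃ i j, IsNat E i ∧ IsNat E j ∧ c = tag E 1 i j := by
  simp [MemAtom, isTagged_iff]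

theorem memVal_iff {a s i j : M} (hs : IsFun E s (omega E) a) (hi : IsNat E i) (hj : IsNat E j)
    (e : M → M → Prop) : MemVal E e (tag E 1 i j) s ↔ e (app E s i) (app E s j) := by
  simp only [MemVal, isTagged_iff, tag_inj, true_and]
  constructor
  · rintro ⟨i', j', x, y, ⟨rfl, rfl⟩, hx, hy, hxy⟩
    rwa [hs.app_eq hx, hs.app_eq hy]
  · intro h
    exact ⟨i, j, _, _, ⟨rfl, rfl⟩, hs.app_spec (mem_omega.2 hi), hs.app_spec (mem_omega.2 hj), h⟩

theorem IsUniverse.isClosed {U : M} (hU : IsUniverse E U) :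
    IsClosedUnderFormation E (MemAtom E) U := by
  refine isClosedUnderFormation_iff.2 ⟨hU.empty, fun i j hi hj => hU.tag (hU.nat hi) (hU.nat hj),
    fun c hc => ?_, fun p q hp hq => hU.tag hp hq, fun i p hi hp => hU.tag (hU.nat hi) hp⟩
  obtain ⟨i, j, hi, hj, rfl⟩ := memAtom_iff.1 hc
  exact hU.tag (hU.nat hi) (hU.nat hj)

/-! ## Truth in `(a, ∈)` -/

/-- `T` obeys the Tarski clauses for the structure `(a, ∈)`. -/
structure IsTruth (E : M → M → Prop) [IsZFC E] (a : M) (T : M → M → Prop) : Prop where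
  falsum : ∀ {s}, IsFun E s (omega E) a → ¬ T (empty E) s
  eq : ∀ {s i j}, IsFun E s (omega E) a → IsNat E i → IsNat E j →
    (T (tag E 0 i j) s ↔ app E s i = app E s j)
  mem : ∀ {s i j}, IsFun E s (omega E) a → IsNat E i → IsNat E j →
    (T (tag E 1 i j) s ↔ E (app E s i) (app E s j))
  imp : ∀ {s p q}, IsFun E s (omega E) a → IsFormula E (MemAtom E) p → IsFormula E (MemAtom E) q →
    (T (tag E 3 p q) s ↔ (T p s → T q s))
  all : ∀ {s i p}, IsFun E s (omega E) a → IsNat E i → IsFormula E (MemAtom E) p →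
    (T (tag E 4 i p) s ↔ ∀ x, E x a → T p (update E s i x))

theorem isSatisfactionSet_iff {a S : M} :
    IsSatisfactionSet E (MemAtom E) (MemVal E E) a S ↔ IsTruth E a (App E S) := by
  simp only [IsSatisfactionSet, isAssignment_iff, isEmptySet_iff, isTagged_iff]
  constructor
  · intro h
    refine ⟨fun hs => (h _ hs).1 _ rfl, fun {s i j} hs hi hj => ?_, fun {s i j} hs hi hj => ?_,
      fun {s p q} hs hp hq => (h s hs).2.2.2.1 _ p q hp hq rfl, fun {s i p} hs hi hp => ?_⟩
    · rw [(h s hs).2.1 _ i j hi hj rfl]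
      simp only [hs.app_iff, mem_omega, hi, hj, true_and]
      exact ⟨fun ⟨x, h1, h2⟩ => h1 ▸ h2, fun h => ⟨_, rfl, h⟩⟩
    · rw [(h s hs).2.2.1 _ (memAtom_iff.2 ⟨i, j, hi, hj, rfl⟩), memVal_iff hs hi hj]
    · rw [(h s hs).2.2.2.2 _ i p hi hp rfl]
      constructor
      · exact fun h' x hx => h' x _ hx ((isUpdate_iff hs hx hi).2 rfl)
      · intro h' x s' hx hs'
        rw [(isUpdate_iff hs hx hi).1 hs']
        exact h' x hx
  · intro h s hs
    refine ⟨?_, ?_, ?_, ?_, ?_⟩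
    · rintro c rfl
      exact h.falsum hs
    · rintro c i j hi hj rfl
      rw [h.eq hs hi hj]
      simp only [hs.app_iff, mem_omega, hi, hj, true_and]
      exact ⟨fun h => ⟨_, rfl, h⟩, fun ⟨x, h1, h2⟩ => h1 ▸ h2⟩
    · intro c hc
      obtain ⟨i, j, hi, hj, rfl⟩ := memAtom_iff.1 hc
      rw [h.mem hs hi hj, memVal_iff hs hi hj]
    · rintro c p q hp hq rfl
      exact h.imp hs hp hq
    · rintro c i p hi hp rfl
      rw [h.all hs hi hp]
      constructor
      · intro h' x s' hx hs'
        rw [(isUpdate_iff hs hx hi).1 hs']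
        exact h' x hx
      · exact fun h' x hx => h' x _ hx ((isUpdate_iff hs hx hi).2 rfl)

/-- The Tarski clauses determine truth by induction on formulas. The predicates need not be sets, so
the lemma can also compare truth in `V_γ` with truth in `V_δ`. -/
theorem IsTruth.unique {U a : M} (hU : IsUniverse E U) {T T' : M → M → Prop}
    [hTd : DefP E fun v => T (v 0) (v 1)] [hTd' : DefP E fun v => T' (v 0) (v 1)]
    (hT : IsTruth E a T) (hT' : IsTruth E a T') {p s : M} (hp : IsFormula E (MemAtom E) p)
    (hs : IsFun E s (omega E) a) : T p s ↔ T' p s := by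
  have h1 := hTd.comp₂
  have h2 := hTd'.comp₂
  suffices h : ∀ s, IsFun E s (omega E) a → (T p s ↔ T' p s) from h s hs
  refine IsFormula.induction (E := E) hU.isClosed
    (Q := fun p => ∀ s, IsFun E s (omega E) a → (T p s ↔ T' p s)) ?_ ?_ ?_ ?_ ?_ hp
  · intro s hs
    simp [hT.falsum hs, hT'.falsum hs]
  · intro i j hi hj s hs
    rw [hT.eq hs hi hj, hT'.eq hs hi hj]
  · intro c hc s hs
    obtain ⟨i, j, hi, hj, rfl⟩ := memAtom_iff.1 hc
    rw [hT.mem hs hi hj, hT'.mem hs hi hj]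
  · intro p q hp hq ihp ihq s hs
    rw [hT.imp hs hp hq, hT'.imp hs hp hq, ihp s hs, ihq s hs]
  · intro i p hi hp ih s hs
    rw [hT.all hs hi hp, hT'.all hs hi hp]
    exact forall₂_congr fun x hx => ih _ (isFun_update hs hx)

/-- The clause for implication is not monotone in the satisfaction relation. It becomes monotone
when a formula is paired with the whole set of assignments satisfying it: the operator `R` uses
earlier pairs only positively. Its fixed point is functional on formulas by induction, and
satisfaction is read off from it. -/
theorem exists_satisfactionSet {U : M} (hU : IsUniverse E U) (a : M) :
    ∃ S, IsTruth E a (App E S) := by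
  let A := funs E (omega E) a
  have hA : ∀ {s}, E s A ↔ IsFun E s (omega E) a := mem_funs
  let Fm := sep E U fun p => IsFormula E (MemAtom E) p
  have hFm : ∀ {p}, E p Fm ↔ IsFormula E (MemAtom E) p :=
    fun {p} => (mem_sep (E := E)).trans ⟨And.right, fun hp => ⟨hp U hU.isClosed, hp⟩⟩
  let tEq : M → M → M := fun i j => sep E A fun s => app E s i = app E s j
  let tMem : M → M → M := fun i j => sep E A fun s => E (app E s i) (app E s j)
  let tImp : M → M → M := fun X Y => sep E A fun s => E s X → E s Y
  let tAll : M → M → M := fun i X => sep E A fun s => ∀ x, E x a → E (update E s i x) X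
  let R : M → M → Prop := fun X z => z = opair E (empty E) (empty E) ∨
    (∃ i j, IsNat E i ∧ IsNat E j ∧ z = opair E (tag E 0 i j) (tEq i j)) ∨
    (∃ i j, IsNat E i ∧ IsNat E j ∧ z = opair E (tag E 1 i j) (tMem i j)) ∨
    (∃ p q Y Z, IsFormula E (MemAtom E) p ∧ IsFormula E (MemAtom E) q ∧ E (opair E p Y) X ∧
      E (opair E q Z) X ∧ z = opair E (tag E 3 p q) (tImp Y Z)) ∨
    (∃ i p Y, IsNat E i ∧ IsFormula E (MemAtom E) p ∧ E (opair E p Y) X ∧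
      z = opair E (tag E 4 i p) (tAll i Y))
  have hRd : DefP E fun v => R (v 0) (v 1) := by
    unfold R tEq tMem tImp tAll; infer_instance
  obtain ⟨W, -, hW⟩ := exists_fixedPoint (prod E Fm (powerset E A)) R (by
    have hsub : ∀ {P : M → Prop} [DefP E fun v => P (v 0)], E (sep E A P) (powerset E A) :=
      mem_powerset.2 fun s hs => (mem_sep.1 hs).1
    rintro X z - (rfl | ⟨i, j, hi, hj, rfl⟩ | ⟨i, j, hi, hj, rfl⟩ |
      ⟨p, q, Y, Z, hp, hq, -, -, rfl⟩ | ⟨i, p, Y, hi, hp, -, rfl⟩)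
    · exact mem_prod.2 ⟨_, _, hFm.2 isFormula_empty, mem_powerset.2 fun z hz =>
        absurd hz (not_mem_empty z), rfl⟩
    · exact mem_prod.2 ⟨_, _, hFm.2 (isFormula_eq hi hj), hsub, rfl⟩
    · exact mem_prod.2 ⟨_, _, hFm.2 (isFormula_atom (memAtom_iff.2 ⟨i, j, hi, hj, rfl⟩)), hsub, rfl⟩
    · exact mem_prod.2 ⟨_, _, hFm.2 (hp.imp hq), hsub, rfl⟩
    · exact mem_prod.2 ⟨_, _, hFm.2 (hp.all hi), hsub, rfl⟩) (by
    rintro X Y z hXY (h | h | h | ⟨p, q, Y, Z, hp, hq, h1, h2, rfl⟩ | ⟨i, p, Y, hi, hp, h1, rfl⟩)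
    · exact Or.inl h
    · exact Or.inr (Or.inl h)
    · exact Or.inr (Or.inr (Or.inl h))
    · exact Or.inr (Or.inr (Or.inr (Or.inl ⟨p, q, _, Z, hp, hq, hXY _ h1, hXY _ h2, rfl⟩)))
    · exact Or.inr (Or.inr (Or.inr (Or.inr ⟨i, p, _, hi, hp, hXY _ h1, rfl⟩))))
  -- Tags are injective and distinguish the kinds of formulas, so each formula matches exactly one
  -- clause of `R`.
  have w0 : ∀ {T}, E (opair E (empty E) T) W ↔ T = empty E := fun {T} => by
    rw [hW]
    have h : ∀ {k x y}, empty E ≠ tag E k x y := fun {k x y} h => tag_ne_empty h.symm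
    simp [R, h]
  have w1 : ∀ {i j T}, IsNat E i → IsNat E j →
      (E (opair E (tag E 0 i j) T) W ↔ T = tEq i j) := fun {i j T} hi hj => by
    rw [hW]
    simp only [R, opair_inj, tag_ne_empty, tag_inj, false_and, false_or]
    simp
    grind
  have w2 : ∀ {i j T}, IsNat E i → IsNat E j →
      (E (opair E (tag E 1 i j) T) W ↔ T = tMem i j) := fun {i j T} hi hj => by
    rw [hW]
    simp only [R, opair_inj, tag_ne_empty, tag_inj, false_and, false_or]
    simp
    grind
  have w3 : ∀ {p q T}, IsFormula E (MemAtom E) p → IsFormula E (MemAtom E) q →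
      (E (opair E (tag E 3 p q) T) W ↔ ∃ Y Z, E (opair E p Y) W ∧ E (opair E q Z) W ∧
        T = tImp Y Z) := fun {p q T} hp hq => by
    rw [hW]
    simp only [R, opair_inj, tag_ne_empty, tag_inj, false_and, false_or]
    simp
    grind
  have w4 : ∀ {i p T}, IsNat E i → IsFormula E (MemAtom E) p →
      (E (opair E (tag E 4 i p) T) W ↔ ∃ Y, E (opair E p Y) W ∧ T = tAll i Y) :=
    fun {i p T} hi hp => by
    rw [hW]
    simp only [R, opair_inj, tag_ne_empty, tag_inj, false_and, false_or]
    simp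
    grind
  have huniq : ∀ {p}, IsFormula E (MemAtom E) p → ∃! T, E (opair E p T) W := fun {p} hp => by
    refine IsFormula.induction (E := E) hU.isClosed (Q := fun p => ∃! T, E (opair E p T) W)
      ?_ ?_ ?_ ?_ ?_ hp
    · simp [w0]
    · intro i j hi hj
      simp [w1 hi hj]
    · intro c hc
      obtain ⟨i, j, hi, hj, rfl⟩ := memAtom_iff.1 hc
      simp [w2 hi hj]
    · rintro p q hp hq ⟨Y, hY, hY'⟩ ⟨Z, hZ, hZ'⟩
      refine ⟨tImp Y Z, (w3 hp hq).2 ⟨Y, Z, hY, hZ, rfl⟩, fun T hT => ?_⟩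
      obtain ⟨Y', Z', h1, h2, rfl⟩ := (w3 hp hq).1 hT
      rw [hY' _ h1, hZ' _ h2]
    · rintro i p hi hp ⟨Y, hY, hY'⟩
      refine ⟨tAll i Y, (w4 hi hp).2 ⟨Y, hY, rfl⟩, fun T hT => ?_⟩
      obtain ⟨Y', h1, rfl⟩ := (w4 hi hp).1 hT
      rw [hY' _ h1]
  let S := sep E (prod E Fm A) fun z => ∃ p s T, z = opair E p s ∧ E (opair E p T) W ∧ E s T
  have hS : ∀ {p s T}, IsFormula E (MemAtom E) p → IsFun E s (omega E) a → E (opair E p T) W →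
      (App E S p s ↔ E s T) := fun {p s T} hp hs hT => by
    rw [app_iff]
    simp only [S, mem_sep (E := E), mem_prod, opair_inj]
    constructor
    · rintro ⟨-, p', s', T', ⟨rfl, rfl⟩, h1, h2⟩
      rwa [(huniq hp).unique hT h1]
    · exact fun h => ⟨⟨p, s, hFm.2 hp, hA.2 hs, rfl, rfl⟩, p, s, T, ⟨rfl, rfl⟩, hT, h⟩
  refine ⟨S, fun {s} hs => ?_, fun {s i j} hs hi hj => ?_, fun {s i j} hs hi hj => ?_,
    fun {s p q} hs hp hq => ?_, fun {s i p} hs hi hp => ?_⟩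
  · rw [hS isFormula_empty hs (w0.2 rfl)]
    exact not_mem_empty s
  · rw [hS (isFormula_eq hi hj) hs ((w1 hi hj).2 rfl)]
    exact mem_sep.trans ⟨And.right, fun h => ⟨hA.2 hs, h⟩⟩
  · rw [hS (isFormula_atom (memAtom_iff.2 ⟨i, j, hi, hj, rfl⟩)) hs ((w2 hi hj).2 rfl)]
    exact mem_sep.trans ⟨And.right, fun h => ⟨hA.2 hs, h⟩⟩
  · obtain ⟨Y, hY, -⟩ := huniq hp
    obtain ⟨Z, hZ, -⟩ := huniq hq
    rw [hS (hp.imp hq) hs ((w3 hp hq).2 ⟨Y, Z, hY, hZ, rfl⟩), hS hp hs hY, hS hq hs hZ]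
    exact mem_sep.trans ⟨And.right, fun h => ⟨hA.2 hs, h⟩⟩
  · obtain ⟨Y, hY, -⟩ := huniq hp
    rw [hS (hp.all hi) hs ((w4 hi hp).2 ⟨Y, hY, rfl⟩)]
    refine (mem_sep.trans ⟨And.right, fun h => ⟨hA.2 hs, h⟩⟩).trans ?_
    exact forall₂_congr fun x hx => (hS hp (isFun_update hs hx) hY).symm

variable (E) in
/-- The formula `p` is true in `(a, ∈)` under the assignment `s`. -/
def Tr (a p s : M) : Prop := Sat E (MemAtom E) (MemVal E E) a p s

instance {a b c : (ℕ → M) → M} [DefF E a] [DefF E b] [DefF E c] :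
    DefP E fun v => Tr E (a v) (b v) (c v) := by
  unfold Tr; infer_instance

theorem tr_iff {U a S p s : M} (hU : IsUniverse E U) (hS : IsTruth E a (App E S))
    (hp : IsFormula E (MemAtom E) p) (hs : IsFun E s (omega E) a) :
    Tr E a p s ↔ App E S p s := by
  constructor
  · rintro ⟨S', hS', h⟩
    exact ((isSatisfactionSet_iff.1 hS').unique hU hS hp hs).1 h
  · exact fun h => ⟨S, isSatisfactionSet_iff.2 hS, h⟩

theorem isTruth_tr {U : M} (hU : IsUniverse E U) (a : M) : IsTruth E a (Tr E a) := by
  obtain ⟨S, hS⟩ := exists_satisfactionSet hU a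
  have h := fun {p s} => tr_iff (p := p) (s := s) hU hS
  refine ⟨fun {s} hs => ?_, fun {s i j} hs hi hj => ?_, fun {s i j} hs hi hj => ?_,
    fun {s p q} hs hp hq => ?_, fun {s i p} hs hi hp => ?_⟩
  · rw [h isFormula_empty hs]
    exact hS.falsum hs
  · rw [h (isFormula_eq hi hj) hs]
    exact hS.eq hs hi hj
  · rw [h (isFormula_atom (memAtom_iff.2 ⟨i, j, hi, hj, rfl⟩)) hs]
    exact hS.mem hs hi hj
  · rw [h (hp.imp hq) hs, h hp hs, h hq hs]
    exact hS.imp hs hp hq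
  · rw [h (hp.all hi) hs, hS.all hs hi hp]
    exact forall₂_congr fun x hx => (h hp (isFun_update hs hx)).symm

/-- The truth of a formula depends on the values of finitely many variables. -/
theorem IsTruth.exists_support {U a : M} (hU : IsUniverse E U) {T : M → M → Prop}
    [hTd : DefP E fun v => T (v 0) (v 1)] (hT : IsTruth E a T) {p : M}
    (hp : IsFormula E (MemAtom E) p) : ∃ n, IsNat E n ∧ ∀ s s', IsFun E s (omega E) a →
      IsFun E s' (omega E) a → (∀ k, E k n → app E s k = app E s' k) → (T p s ↔ T p s') := by
  have h1 := hTd.comp₂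
  have hmax : ∀ {i j}, IsNat E i → IsNat E j → ∃ n, IsNat E n ∧ Subset E i n ∧ Subset E j n := by
    intro i j hi hj
    obtain ⟨n, hn, h⟩ := isOrd_omega.exists_max (mem_omega.2 hi) (mem_omega.2 hj)
    exact ⟨n, mem_omega.1 hn, h⟩
  have hmax' : ∀ {i j}, IsNat E i → IsNat E j → ∃ n, IsNat E n ∧ E i n ∧ E j n := by
    intro i j hi hj
    obtain ⟨n, hn, h⟩ := hmax hi.succ hj.succ
    exact ⟨n, hn, h.1 _ (by simp), h.2 _ (by simp)⟩
  -- The bound `n` is a natural number of the model and may be nonstandard, like `p`; hence the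
  -- induction is the internal one.
  refine IsFormula.induction (E := E) hU.isClosed (Q := fun p => ∃ n, IsNat E n ∧ ∀ s s',
      IsFun E s (omega E) a → IsFun E s' (omega E) a → (∀ k, E k n → app E s k = app E s' k) →
      (T p s ↔ T p s')) ?_ ?_ ?_ ?_ ?_ hp
  · refine ⟨empty E, isNat_empty, fun s s' hs hs' _ => ?_⟩
    simp [hT.falsum hs, hT.falsum hs']
  · intro i j hi hj
    obtain ⟨n, hn, hin, hjn⟩ := hmax' hi hj
    refine ⟨n, hn, fun s s' hs hs' h => ?_⟩
    rw [hT.eq hs hi hj, hT.eq hs' hi hj, h i hin, h j hjn]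
  · intro c hc
    obtain ⟨i, j, hi, hj, rfl⟩ := memAtom_iff.1 hc
    obtain ⟨n, hn, hin, hjn⟩ := hmax' hi hj
    refine ⟨n, hn, fun s s' hs hs' h => ?_⟩
    rw [hT.mem hs hi hj, hT.mem hs' hi hj, h i hin, h j hjn]
  · rintro p q hp hq ⟨n, hn, h1⟩ ⟨m, hm, h2⟩
    obtain ⟨k, hk, hnk, hmk⟩ := hmax hn hm
    refine ⟨k, hk, fun s s' hs hs' h => ?_⟩
    rw [hT.imp hs hp hq, hT.imp hs' hp hq, h1 s s' hs hs' fun l hl => h l (hnk l hl),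
      h2 s s' hs hs' fun l hl => h l (hmk l hl)]
  · rintro i p hi hp ⟨n, hn, h1⟩
    refine ⟨n, hn, fun s s' hs hs' h => ?_⟩
    rw [hT.all hs hi hp, hT.all hs' hi hp]
    refine forall₂_congr fun x hx => h1 _ _ (isFun_update hs hx) (isFun_update hs' hx)
      fun k hk => ?_
    have hk' := hn.mem hk
    by_cases hki : k = i
    · rw [(app_update_eq hs hx hk').1 hki, (app_update_eq hs' hx hk').1 hki]
    · rw [(app_update_eq hs hx hk').2 hki, (app_update_eq hs' hx hk').2 hki, h k hk]

end SetModel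

namespace SetModel

variable {M : Type v} {E : M → M → Prop} [hZ : IsZFC E]

attribute [local instance 50] DefF.rename

/-! ## Closure points below an inaccessible cardinal -/

/-- The ordinal is the supremum of the first `ω` values of a recursive sequence whose successive
values are related by `R`. So it has cofinality `ω`, and an assignment in its level need not be
bounded below it; this is why formulas are shown to depend on finitely many variables. -/
theorem IsInaccessible.exists_closure {δ : M} (hδ : IsInaccessible E δ) (R : M → M → Prop)
    [hR : DefP E fun v => R (v 0) (v 1)]
    (h : ∀ β, E β δ → ∃ μ, E μ δ ∧ ∀ μ', E μ' δ → Subset E μ μ' → R β μ') :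
    ∃ γ, E γ δ ∧ E (omega E) γ ∧ (∀ ξ, E ξ γ → E (succ E ξ) γ) ∧
      ∀ β, E β γ → ∃ β' μ, E β' γ ∧ E μ γ ∧ E β β' ∧ R β' μ := by
  have hR' := hR.comp₂
  obtain ⟨g, hg, hgR⟩ := hδ.exists_sequence
    (fun β μ => R β μ ∧ E β μ ∧ E (omega E) μ) fun β hβ => by
      obtain ⟨μ, hμ, hb⟩ := h β hβ
      obtain ⟨ν, hν, h1, h2⟩ := hδ.1.exists_max hμ (hδ.succ_mem hβ)
      obtain ⟨ζ, hζ, h3, h4⟩ := hδ.1.exists_max hν (hδ.succ_mem hδ.omega_mem)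
      exact ⟨ζ, hζ, fun μ' hμ' hs => ⟨hb μ' hμ' ((h1.trans h3).trans hs),
        hs _ (h3 _ (h2 _ (by simp))), hs _ (h4 _ (by simp))⟩⟩
  obtain ⟨c, hc⟩ := isSet_image (E := E) (omega E) fun n => app E g n
  have hmem : ∀ {ξ}, E ξ (sUnion E c) ↔ ∃ n, IsNat E n ∧ E ξ (app E g n) := fun {ξ} => by
    simp only [mem_sUnion, hc, mem_omega]
    exact ⟨fun ⟨_, ⟨n, hn, rfl⟩, hy⟩ => ⟨n, hn, hy⟩, fun ⟨n, hn, hy⟩ => ⟨_, ⟨n, hn, rfl⟩, hy⟩⟩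
  have hnδ : ∀ {n}, IsNat E n → E n δ := fun hn =>
    hδ.1.mem_trans hδ.omega_mem (mem_omega.2 hn)
  have hgn : ∀ {n}, IsNat E n → E (app E g n) δ := fun hn => hg.app_mem (hnδ hn)
  have hstep : ∀ {n}, IsNat E n → R (app E g n) (app E g (succ E n)) ∧
      E (app E g n) (app E g (succ E n)) ∧ E (omega E) (app E g (succ E n)) := fun {n} hn =>
    hgR _ _ (hnδ hn.succ) (by simp)
  have hgγ : ∀ {n}, IsNat E n → E (app E g n) (sUnion E c) := fun {n} hn =>
    hmem.2 ⟨_, hn.succ, (hstep hn).2.1⟩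
  have hord : IsOrd E (sUnion E c) := isOrd_sUnion fun y hy => by
    obtain ⟨n, hn, rfl⟩ := (hc y).1 hy
    exact hδ.1.mem (hgn (mem_omega.1 hn))
  obtain ⟨β, hβ, hb⟩ := (hδ.sizeLT hδ.omega_mem).exists_bound hδ (fun n => app E g n)
    fun n hn => hgn (mem_omega.1 hn)
  refine ⟨sUnion E c, ?_, ?_, fun ξ hξ => ?_, fun β hβ => ?_⟩
  · have : Subset E (sUnion E c) β := fun ξ hξ => by
      obtain ⟨n, hn, hξ⟩ := hmem.1 hξ
      exact (hδ.1.mem hβ).mem_trans (hb n (mem_omega.2 hn)) hξ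
    rcases (hord.subset_iff (hδ.1.mem hβ)).1 this with h | h
    · exact hδ.1.mem_trans hβ h
    · exact h ▸ hβ
  · exact hmem.2 ⟨_, isNat_empty.succ, (hstep isNat_empty).2.2⟩
  · obtain ⟨n, hn, hξ⟩ := hmem.1 hξ
    have ho := hδ.1.mem (hgn hn)
    rcases ((ho.mem hξ).succ).trichotomy ho with h | h | h
    · exact hmem.2 ⟨n, hn, h⟩
    · exact h ▸ hgγ hn
    · rcases mem_succ.1 h with h | h
      · exact absurd hξ (not_mem_of_mem h)
      · exact absurd (h ▸ hξ) (not_mem_self (E := E) _)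
  · obtain ⟨n, hn, hξ⟩ := hmem.1 hβ
    exact ⟨_, _, hgγ hn, hgγ hn.succ, hξ, (hstep hn).1⟩

/-! ## The Vopěnka property -/

/-- Vopěnka's principle holds for the sets of structures contained in `V_δ`. -/
def VopenkaProperty (E : M → M → Prop) (δ w : M) : Prop :=
  ∀ F R m, SizeLT E F δ → SizeLT E R δ → Subset E m w → (∃ g, IsBij E g m δ) →
    IsClassOfStructures E F R {x | E x m} → HasElementaryEmbedding E F R {x | E x m}

namespace Hierarchy

variable {δ f : M}

/-- Vopěnka's principle for an unbounded definable class of structures. -/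
theorem hasElementaryEmbedding (h : Hierarchy E δ f) (hV : VopenkaProperty E δ (app E f δ))
    {F R : M} (hF : E F (app E f δ)) (hR : E R (app E f δ)) (X : M → Prop)
    [hX : DefP E fun v => X (v 0)] (hXδ : ∀ x, X x → E x (app E f δ))
    (hXs : IsClassOfStructures E F R {x | X x})
    (hunb : ¬ ∃ ξ, E ξ δ ∧ ∀ x, X x → E x (app E f ξ)) :
    HasElementaryEmbedding E F R {x | X x} := by
  have hX' := hX.comp₁
  -- `c β` is a member of the class outside the level `β`.
  obtain ⟨c, hc, hcX⟩ := exists_choice (E := E) (a := δ) (b := app E f δ)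
    (fun β x => X x ∧ ¬ E x (app E f β)) fun β hβ => by
      by_contra hn
      push Not at hn
      exact hunb ⟨β, hβ, fun x hx => hn x (hXδ x hx) hx⟩
  -- Along `g`, each structure already chosen lies in the level that the next choice avoids. Hence
  -- the choices are distinct and there are `δ` many of them.
  obtain ⟨g, hg, hgR⟩ := h.inacc.exists_sequence (fun β μ => E (app E c β) (app E f μ))
    fun β hβ => by
      obtain ⟨μ, hμ, hx⟩ := (h.mem_iff h.self_mem).1 (hc.app_mem hβ)
      refine ⟨succ E μ, h.inacc.succ_mem hμ, fun μ' hμ' hs => ?_⟩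
      exact (h.mem_iff (h.mem_succ hμ')).2 ⟨μ, hs _ (by simp), hx⟩
  have hG : DefF E fun v => app E c (app E g (v 0)) := inferInstance
  have hinj : ∀ {β β'}, E β δ → E β' δ → app E c (app E g β) = app E c (app E g β') →
      β = β' := by
    intro β β' hβ hβ' he
    rcases (h.isOrd.mem hβ).trichotomy (h.isOrd.mem hβ') with hlt | heq | hlt
    · exact absurd (he ▸ hgR _ _ hβ' hlt) (hcX _ (hg.app_mem hβ')).2
    · exact heq
    · exact absurd (he ▸ hgR _ _ hβ hlt) (hcX _ (hg.app_mem hβ)).2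
  obtain ⟨m, hm⟩ := isSet_image (E := E) δ fun β => app E c (app E g β)
  obtain ⟨e, he⟩ := isSet_image (E := E) δ fun β => opair E (app E c (app E g β)) β
  have hea : ∀ {x β}, App E e x β ↔ E β δ ∧ x = app E c (app E g β) := fun {x β} => by
    simp only [SetModel.app_iff, he, opair_inj]
    exact ⟨fun ⟨β', h1, h2, h3⟩ => h3 ▸ ⟨h1, h2⟩, fun ⟨h1, h2⟩ => ⟨β, h1, h2, rfl⟩⟩
  have hbij : IsBij E e m δ := by
    refine ⟨⟨⟨fun z hz => ?_, fun x hx => ?_⟩, fun x x' y hx hx' => ?_⟩, fun β hβ => ?_⟩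
    · obtain ⟨β, hβ, rfl⟩ := (he z).1 hz
      exact ⟨_, β, (hm _).2 ⟨β, hβ, rfl⟩, hβ, isOPair_iff.2 rfl⟩
    · obtain ⟨β, hβ, rfl⟩ := (hm x).1 hx
      exact ⟨β, hea.2 ⟨hβ, rfl⟩, fun β' hβ' => (hinj hβ (hea.1 hβ').1 (hea.1 hβ').2).symm⟩
    · rw [(hea.1 hx).2, (hea.1 hx').2]
    · exact ⟨_, hea.2 ⟨hβ, rfl⟩⟩
  have hmX : ∀ {x}, E x m → X x := fun {x} hx => by
    obtain ⟨β, hβ, rfl⟩ := (hm x).1 hx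
    exact (hcX _ (hg.app_mem hβ)).1
  obtain ⟨x, y, hx, hy, hxy⟩ := hV F R m (h.sizeLT hF) (h.sizeLT hR)
    (fun x hx => hXδ x (hmX hx)) ⟨e, hbij⟩ fun x hx => hXs x (hmX hx)
  exact ⟨x, y, hmX hx, hmX hy, hxy⟩

/-- The set of formulas of set theory belongs to `V_δ`. -/
theorem exists_formulaSet (h : Hierarchy E δ f) :
    ∃ Fm, E Fm (app E f δ) ∧ ∀ p, E p Fm ↔ IsFormula E (MemAtom E) p := by
  obtain ⟨l, hl, hω, hlim, -⟩ := h.inacc.exists_closure (fun _ _ => True) fun β hβ =>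
    ⟨β, hβ, fun _ _ _ => trivial⟩
  have hU := h.isUniverse (h.mem_succ hl) hω hlim
  refine ⟨sep E (app E f l) fun p => IsFormula E (MemAtom E) p,
    h.mem_of_subset h.self_mem (h.level_mem h.self_mem hl) fun p hp => (mem_sep.1 hp).1, fun p => ?_⟩
  exact mem_sep.trans ⟨And.right, fun hp => ⟨hp _ hU.isClosed, hp⟩⟩

end Hierarchy

/-! ## Reflecting ordinals -/

/-- There is an elementary embedding between the structures coded by `x` and `y`. -/
def Embeds (E : M → M → Prop) (F R x y : M) : Prop :=
  ∃ a f r a' f' r' j, IsStructureCode E F R x a f r ∧ IsStructureCode E F R y a' f' r' ∧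
    IsElementaryEmbedding E F R a f r a' f' r' j

/-- `x` codes a structure for the language `(F, R)`. -/
def CodesStructure (E : M → M → Prop) (F R x : M) : Prop :=
  ∃ a f r, IsStructureCode E F R x a f r

omit hZ in
instance {a b c d : (ℕ → M) → M} [DefF E a] [DefF E b] [DefF E c] [DefF E d] :
    DefP E fun v => Embeds E (a v) (b v) (c v) (d v) := by
  unfold Embeds; infer_instance

omit hZ in
instance {a b c : (ℕ → M) → M} [DefF E a] [DefF E b] [DefF E c] :
    DefP E fun v => CodesStructure E (a v) (b v) (c v) := by
  unfold CodesStructure; infer_instance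

variable (E) in
/-- `x` belongs to the class of `(F, R)`-structures in `w` that is defined by `p` and `s`. -/
def InStructureClass (w p s F R x : M) : Prop :=
  E x w ∧ Tr E w p (update E s (num E 0) x) ∧ CodesStructure E F R x

instance {a b c d e g : (ℕ → M) → M} [DefF E a] [DefF E b] [DefF E c] [DefF E d] [DefF E e]
    [DefF E g] : DefP E fun v => InStructureClass E (a v) (b v) (c v) (d v) (e v) (g v) := by
  unfold InStructureClass; infer_instance

/-- `γ` is a limit of limit ordinals that reflects truth in `V_δ`, the bounds for images under definable
relations, and the elementary embeddings between the members of definable classes. -/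
structure Reflects (E : M → M → Prop) [IsZFC E] (δ f γ : M) : Prop where
  mem : E γ δ
  omega : E (SetModel.omega E) γ
  limit : ∀ ξ, E ξ γ → E (succ E ξ) γ
  exists_limit : ∀ ξ, E ξ γ →
    ∃ l, E l γ ∧ E ξ l ∧ E (SetModel.omega E) l ∧ ∀ η, E η l → E (succ E η) l
  witness : ∀ {p s i x}, IsFormula E (MemAtom E) p → IsFun E s (SetModel.omega E) (app E f γ) →
    IsNat E i → E x (app E f δ) → ¬ Tr E (app E f δ) p (update E s i x) →
    ∃ x, E x (app E f γ) ∧ ¬ Tr E (app E f δ) p (update E s i x)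
  bound : ∀ {p s a}, IsFormula E (MemAtom E) p → IsFun E s (SetModel.omega E) (app E f γ) →
    E a (app E f γ) →
    (∀ x, E x a → ∃ y, E y (app E f γ) ∧
      Tr E (app E f δ) p (update E (update E s (num E 0) x) (num E 1) y)) →
    ∃ w, E w (app E f γ) ∧ ∀ x, E x a → ∃ y, E y w ∧
      Tr E (app E f δ) p (update E (update E s (num E 0) x) (num E 1) y)
  unbounded : ∀ {p s F R ξ}, IsFormula E (MemAtom E) p →
    IsFun E s (SetModel.omega E) (app E f γ) → E F (app E f γ) → E R (app E f γ) → E ξ δ →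
    (∀ x, InStructureClass E (app E f δ) p s F R x → E x (app E f ξ)) →
    ∃ w, E w (app E f γ) ∧ ∀ x, InStructureClass E (app E f δ) p s F R x → E x w
  embeds : ∀ {p s F R x y}, IsFormula E (MemAtom E) p →
    IsFun E s (SetModel.omega E) (app E f γ) → E F (app E f γ) → E R (app E f γ) →
    InStructureClass E (app E f δ) p s F R x → InStructureClass E (app E f δ) p s F R y →
    x ≠ y → Embeds E F R x y →
    ∃ x y, E x (app E f γ) ∧ E y (app E f γ) ∧ InStructureClass E (app E f δ) p s F R x ∧
      InStructureClass E (app E f δ) p s F R y ∧ x ≠ y ∧ Embeds E F R x y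

/-- Finitely many values of an assignment in a limit level are bounded. -/
theorem Hierarchy.exists_truncation {δ f γ s n : M} (h : Hierarchy E δ f) (hγ : E γ (succ E δ))
    (hω : E (SetModel.omega E) γ) (hlim : ∀ ξ, E ξ γ → E (succ E ξ) γ)
    (hs : IsFun E s (SetModel.omega E) (app E f γ)) (hn : IsNat E n) :
    ∃ β, E β γ ∧ ∀ β', E β' γ → Subset E β β' → ∃ s', IsFun E s' (SetModel.omega E) (app E f β') ∧
      ∀ k, E k n → app E s k = app E s' k := by
  have hs' : ∀ {β}, E β γ → E β (succ E δ) := fun hβ => h.mem_succ (h.trans hγ hβ)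
  have h1 : ∃ β, E β γ ∧ ∀ k, E k n → E (app E s k) (app E f β) := by
    refine hn.induction (P := fun n => ∃ β, E β γ ∧ ∀ k, E k n → E (app E s k) (app E f β))
      ⟨_, hω, fun k hk => absurd hk (not_mem_empty k)⟩ ?_
    rintro n hn ⟨β, hβ, hb⟩
    obtain ⟨ξ, hξ, hx⟩ := (h.mem_iff hγ).1 (hs.app_mem (mem_omega.2 hn))
    obtain ⟨ζ, hζ, h1, h2⟩ := (h.ord hγ).exists_max hβ (hlim ξ hξ)
    refine ⟨ζ, hζ, fun k hk => ?_⟩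
    rcases SetModel.mem_succ.1 hk with hk | rfl
    · exact h.mono (hs' hβ) (hs' hζ) h1 _ (hb k hk)
    · exact (h.mem_iff (hs' hζ)).2 ⟨ξ, h2 _ (by simp), hx⟩
  obtain ⟨β, hβ, hb⟩ := h1
  obtain ⟨ζ, hζ, h1, h2⟩ := (h.ord hγ).exists_max hβ hω
  refine ⟨ζ, hζ, fun β' hβ' hsub => ?_⟩
  -- The values of `s` at arguments outside `n` are replaced by `∅`.
  let P : M → M → Prop := fun k y => (E k n ∧ y = app E s k) ∨ (¬ E k n ∧ y = SetModel.empty E)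
  have hP : ∀ k, ∃! y, P k y := fun k => by
    by_cases hk : E k n <;> simp [P, hk]
  have hd : DefF E fun v => the E (P (v 0)) := by unfold P; infer_instance
  refine ⟨lam E (SetModel.omega E) fun k => the E (P k), isFun_lam fun k _ => ?_, fun k hk => ?_⟩
  · rcases the_spec (E := E) (hP k) with ⟨hk, he⟩ | ⟨-, he⟩
    · rw [he]
      exact h.mono (hs' hβ) (hs' hβ') (h1.trans hsub) _ (hb k hk)
    · rw [he]
      exact h.ord_mem (hs' hβ') (hsub _ (h2 _ (mem_omega.2 isNat_empty)))
  · rw [app_lam_eq (F := fun k => the E (P k)) (mem_omega.2 (hn.mem hk))]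
    rcases the_spec (E := E) (hP k) with ⟨_, he⟩ | ⟨hk', -⟩
    · exact he.symm
    · exact absurd hk hk'

end SetModel

/-! ### Existence of reflecting ordinals -/

namespace SetModel

variable {M : Type v} {E : M → M → Prop}

attribute [local instance 50] DefF.rename

theorem _root_.DefP.comp₅ {R : M → M → M → M → M → Prop}
    (hR : DefP E fun v => R (v 0) (v 1) (v 2) (v 3) (v 4)) (f₀ f₁ f₂ f₃ f₄ : (ℕ → M) → M)
    [DefF E f₀] [DefF E f₁] [DefF E f₂] [DefF E f₃] [DefF E f₄] :
    DefP E fun v => R (f₀ v) (f₁ v) (f₂ v) (f₃ v) (f₄ v) := by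
  refine DefP.congr (P := fun v => ∃ x₄ x₃ x₂ x₁ x₀, x₀ = f₀ v ∧ x₁ = f₁ v ∧ x₂ = f₂ v ∧ x₃ = f₃ v ∧
    x₄ = f₄ v ∧ R x₀ x₁ x₂ x₃ x₄) inferInstance fun v => by simp

variable [hZ : IsZFC E]

variable {δ f : M}

/-- Monotone definable conditions that hold at some ordinal below `δ` hold uniformly for all formulas
and all parameters in a fixed level. -/
theorem Hierarchy.exists_uniform (h : Hierarchy E δ f) {β : M} (hβ : E β δ)
    (Φ : M → M → M → M → M → Prop)
    [hΦ : DefP E fun v => Φ (v 0) (v 1) (v 2) (v 3) (v 4)]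
    (hmono : ∀ p s a b ξ ξ', E ξ δ → E ξ' δ → Subset E ξ ξ' →
      Φ p s a b ξ → Φ p s a b ξ') :
    ∃ μ, E μ δ ∧ ∀ μ', E μ' δ → Subset E μ μ' → ∀ p s a b, IsFormula E (MemAtom E) p →
      IsFun E s (omega E) (app E f β) →
      E a (app E f β) → E b (app E f β) → (∃ ξ, E ξ δ ∧ Φ p s a b ξ) → Φ p s a b μ' := by
  have hΦ' := hΦ.comp₅
  obtain ⟨Fm, hFm, hF⟩ := h.exists_formulaSet
  have hU := h.isUniverse_top
  have hβ' := h.level_mem h.self_mem hβ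
  -- All parameters are packed into one tuple. The tuples form an element of `V_δ`, hence a small
  -- set, and the bound for a single parameter applies.
  have hQ : E (prod E Fm (prod E (funs E (omega E) (app E f β))
      (prod E (app E f β) (app E f β)))) (app E f δ) :=
    hU.prod hFm (hU.prod (hU.funs hU.omega hβ') (hU.prod hβ' hβ'))
  obtain ⟨μ, hμ, hb⟩ := (h.sizeLT hQ).exists_uniform h.inacc
    (fun q ξ => E ξ δ ∧ ∃ p s a b, q = opair E p (opair E s (opair E a b)) ∧ Φ p s a b ξ)
    (fun q ξ ξ' _ hξ' hs ⟨hξ, p, s, a, b, hq, hp⟩ =>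
      ⟨hξ', p, s, a, b, hq, hmono _ _ _ _ _ _ hξ hξ' hs hp⟩)
  refine ⟨μ, hμ, fun μ' hμ' hs p s a b hp hsf ha hb' ⟨ξ, hξ, hx⟩ => ?_⟩
  obtain ⟨-, p', s', a', b', he, hx⟩ := hb (opair E p (opair E s (opair E a b)))
    (mem_prod.2 ⟨_, _, (hF p).2 hp, mem_prod.2 ⟨_, _, mem_funs.2 hsf,
      mem_prod.2 ⟨_, _, ha, hb', rfl⟩, rfl⟩, rfl⟩) ⟨ξ, hξ, hξ, p, s, a, b, rfl, hx⟩
  simp only [opair_inj] at he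
  obtain ⟨rfl, rfl, rfl, rfl⟩ := he
  exact hmono _ _ _ _ _ _ hμ hμ' hs hx

theorem app_update_congr {a s s' i x k n : M} (hs : IsFun E s (omega E) a)
    (hs' : IsFun E s' (omega E) a) (hx : E x a) (hn : IsNat E n)
    (h : ∀ k, E k n → app E s k = app E s' k) (hk : E k n) :
    app E (update E s i x) k = app E (update E s' i x) k := by
  by_cases hi : k = i
  · rw [(app_update_eq hs hx (hn.mem hk)).1 hi, (app_update_eq hs' hx (hn.mem hk)).1 hi]
  · rw [(app_update_eq hs hx (hn.mem hk)).2 hi, (app_update_eq hs' hx (hn.mem hk)).2 hi, h k hk]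

/-- An assignment in a limit level may be replaced by one in a lower level. -/
theorem Hierarchy.exists_equivalent {γ p s a b : M} (h : Hierarchy E δ f) (hγ : E γ δ)
    (hω : E (omega E) γ) (hlim : ∀ ξ, E ξ γ → E (succ E ξ) γ)
    (hp : IsFormula E (MemAtom E) p) (hs : IsFun E s (omega E) (app E f γ))
    (ha : E a (app E f γ)) (hb : E b (app E f γ)) :
    ∃ β, E β γ ∧ ∀ β', E β' γ → Subset E β β' → E a (app E f β') ∧ E b (app E f β') ∧
      ∃ s', IsFun E s' (omega E) (app E f β') ∧
        (∀ i x, E x (app E f δ) → (Tr E (app E f δ) p (update E s i x) ↔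
          Tr E (app E f δ) p (update E s' i x))) ∧
        ∀ i x j y, E x (app E f δ) → E y (app E f δ) →
          (Tr E (app E f δ) p (update E (update E s i x) j y) ↔
            Tr E (app E f δ) p (update E (update E s' i x) j y)) := by
  have hγ' := h.mem_succ hγ
  have ho := h.ord hγ'
  -- Only the values of `s` below `n` matter. They fit into one lower level even if `s` is unbounded
  -- in the level `γ`.
  obtain ⟨n, hn, hsupp⟩ := (isTruth_tr h.isUniverse_top (app E f δ)).exists_support
    h.isUniverse_top hp
  obtain ⟨β, hβ, ht⟩ := h.exists_truncation hγ' hω hlim hs hn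
  obtain ⟨α₁, hα₁, ha⟩ := (h.mem_iff hγ').1 ha
  obtain ⟨α₂, hα₂, hb⟩ := (h.mem_iff hγ').1 hb
  obtain ⟨α, hα, h1, h2⟩ := ho.exists_max (hlim _ hα₁) (hlim _ hα₂)
  obtain ⟨ζ, hζ, h3, h4⟩ := ho.exists_max hβ hα
  refine ⟨ζ, hζ, fun β' hβ' hsub => ?_⟩
  have hβδ := h.mem_succ (h.trans hγ' hβ')
  obtain ⟨s', hs', he⟩ := ht β' hβ' (h3.trans hsub)
  have hsW := hs.mono fun x hx => h.mono hγ' h.self_mem (h.isOrd.1 _ hγ) _ (hs.app_mem hx)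
  have hsW' := hs'.mono fun x hx =>
    h.mono hβδ h.self_mem (h.isOrd.1 _ (h.trans hγ' hβ')) _ (hs'.app_mem hx)
  refine ⟨(h.mem_iff hβδ).2 ⟨α₁, hsub _ (h4 _ (h1 _ (by simp))), ha⟩,
    (h.mem_iff hβδ).2 ⟨α₂, hsub _ (h4 _ (h2 _ (by simp))), hb⟩, s', hs', fun i x hx => ?_,
    fun i x j y hx hy => ?_⟩
  · exact hsupp _ _ (isFun_update hsW hx) (isFun_update hsW' hx) fun k hk =>
      app_update_congr hsW hsW' hx hn he hk
  · exact hsupp _ _ (isFun_update (isFun_update hsW hx) hy)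
      (isFun_update (isFun_update hsW' hx) hy) fun k hk =>
      app_update_congr (isFun_update hsW hx) (isFun_update hsW' hx) hy hn
        (fun k hk => app_update_congr hsW hsW' hx hn he hk) hk

variable (E) in
/-- The condition `Φ` holds at `μ` for all parameters in the level `β` for which it holds
somewhere. -/
def HoldsUniformly (δ f : M) (Φ : M → M → M → M → M → Prop) (β μ : M) : Prop :=
  ∀ p s a b, IsFormula E (MemAtom E) p → IsFun E s (omega E) (app E f β) →
    E a (app E f β) → E b (app E f β) → (∃ ξ, E ξ δ ∧ Φ p s a b ξ) → Φ p s a b μ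

theorem defP_holdsUniformly (Φ : M → M → M → M → M → Prop)
    [hΦ : DefP E fun v => Φ (v 0) (v 1) (v 2) (v 3) (v 4)] :
    DefP E fun v => HoldsUniformly E δ f Φ (v 0) (v 1) := by
  have hΦ' := hΦ.comp₅
  unfold HoldsUniformly
  infer_instance

theorem IsInaccessible.exists_limit (hδ : IsInaccessible E δ) {ξ : M} (hξ : E ξ δ) :
    ∃ l, E l δ ∧ E ξ l ∧ E (omega E) l ∧ ∀ η, E η l → E (succ E η) l := by
  obtain ⟨l, hl, hω, hlim, hcl⟩ := hδ.exists_closure (fun _ μ => E ξ μ) fun β hβ =>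
    ⟨_, hδ.succ_mem hξ, fun μ' _ hs => hs _ (by simp)⟩
  obtain ⟨β', μ, -, hμ, -, hξμ⟩ := hcl _ hω
  exact ⟨l, hl, (hδ.1.mem hl).mem_trans hμ hξμ, hω, hlim⟩

/-- A closure point for four monotone conditions: counterexamples to a formula, bounds for the
values on a set, bounds for a class of structures, and embedded pairs in such a class. Parameters in
the level `γ` are first replaced by equivalent ones in a level `β` below `γ`; the conditions then
hold at some `μ` below `γ`. -/
theorem Hierarchy.exists_reflects (h : Hierarchy E δ f) : ∃ γ, Reflects E δ f γ := by
  have hU := h.isUniverse_top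
  -- Here `a` is the index of the variable, and `b` is a dummy that gives all conditions the same
  -- arguments.
  let Φ₁ : M → M → M → M → M → Prop := fun p s a b ξ =>
    ∃ x, E x (app E f ξ) ∧ ¬ Tr E (app E f δ) p (update E s a x)
  let Φ₂ : M → M → M → M → M → Prop := fun p s a b ξ =>
    ∀ x, E x a → ∃ y, E y (app E f ξ) ∧
      Tr E (app E f δ) p (update E (update E s (num E 0) x) (num E 1) y)
  let Φ₃ : M → M → M → M → M → Prop := fun p s a b ξ =>
    ∀ x, InStructureClass E (app E f δ) p s a b x → E x (app E f ξ)
  let Φ₄ : M → M → M → M → M → Prop := fun p s a b ξ =>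
    ∃ x y, E x (app E f ξ) ∧ E y (app E f ξ) ∧ InStructureClass E (app E f δ) p s a b x ∧
      InStructureClass E (app E f δ) p s a b y ∧ x ≠ y ∧ Embeds E a b x y
  have d₁ : DefP E fun v => Φ₁ (v 0) (v 1) (v 2) (v 3) (v 4) := by unfold Φ₁; infer_instance
  have d₂ : DefP E fun v => Φ₂ (v 0) (v 1) (v 2) (v 3) (v 4) := by unfold Φ₂; infer_instance
  have d₃ : DefP E fun v => Φ₃ (v 0) (v 1) (v 2) (v 3) (v 4) := by unfold Φ₃; infer_instance
  have d₄ : DefP E fun v => Φ₄ (v 0) (v 1) (v 2) (v 3) (v 4) := by unfold Φ₄; infer_instance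
  have hmono : ∀ {ξ ξ'}, E ξ δ → E ξ' δ → Subset E ξ ξ' → Subset E (app E f ξ) (app E f ξ') :=
    fun hξ hξ' hs => h.mono (h.mem_succ hξ) (h.mem_succ hξ') hs
  have r₁ := defP_holdsUniformly (E := E) (δ := δ) (f := f) Φ₁
  have r₂ := defP_holdsUniformly (E := E) (δ := δ) (f := f) Φ₂
  have r₃ := defP_holdsUniformly (E := E) (δ := δ) (f := f) Φ₃
  have r₄ := defP_holdsUniformly (E := E) (δ := δ) (f := f) Φ₄
  obtain ⟨γ, hγ, hω, hlim, hcl⟩ := h.inacc.exists_closure (fun β μ =>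
    (E μ δ ∧ ∃ l, E l μ ∧ E β l ∧ E (omega E) l ∧ ∀ η, E η l → E (succ E η) l) ∧
      HoldsUniformly E δ f Φ₁ β μ ∧ HoldsUniformly E δ f Φ₂ β μ ∧
      HoldsUniformly E δ f Φ₃ β μ ∧ HoldsUniformly E δ f Φ₄ β μ) fun β hβ => by
    obtain ⟨μ₁, hμ₁, h₁⟩ := h.exists_uniform hβ Φ₁ fun p s a b ξ ξ' hξ hξ' hs ⟨x, hx, ht⟩ =>
      ⟨x, hmono hξ hξ' hs _ hx, ht⟩
    obtain ⟨μ₂, hμ₂, h₂⟩ := h.exists_uniform hβ Φ₂ fun p s a b ξ ξ' hξ hξ' hs hp x hx =>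
      (hp x hx).imp fun y hy => ⟨hmono hξ hξ' hs _ hy.1, hy.2⟩
    obtain ⟨μ₃, hμ₃, h₃⟩ := h.exists_uniform hβ Φ₃ fun p s a b ξ ξ' hξ hξ' hs hp x hx =>
      hmono hξ hξ' hs _ (hp x hx)
    obtain ⟨μ₄, hμ₄, h₄⟩ := h.exists_uniform hβ Φ₄
      fun p s a b ξ ξ' hξ hξ' hs ⟨x, y, hx, hy, ht⟩ =>
        ⟨x, y, hmono hξ hξ' hs _ hx, hmono hξ hξ' hs _ hy, ht⟩
    obtain ⟨ν₁, hν₁, e₁, e₂⟩ := h.isOrd.exists_max hμ₁ hμ₂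
    obtain ⟨ν₂, hν₂, e₃, e₄⟩ := h.isOrd.exists_max hμ₃ hμ₄
    obtain ⟨l, hl, hβl⟩ := h.inacc.exists_limit hβ
    obtain ⟨ν₃, hν₃, e₅, e₆⟩ := h.isOrd.exists_max hν₁ hν₂
    obtain ⟨ν, hν, e₇, e₈⟩ := h.isOrd.exists_max hν₃ (h.inacc.succ_mem hl)
    exact ⟨ν, hν, fun μ' hμ' hs => ⟨⟨hμ', l, hs _ (e₈ _ (by simp)), hβl⟩,
      h₁ μ' hμ' (((e₁.trans e₅).trans e₇).trans hs),
      h₂ μ' hμ' (((e₂.trans e₅).trans e₇).trans hs), h₃ μ' hμ' (((e₃.trans e₆).trans e₇).trans hs),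
      h₄ μ' hμ' (((e₄.trans e₆).trans e₇).trans hs)⟩⟩
  have hγ' := h.mem_succ hγ
  have hmem : ∀ {x}, E x (app E f γ) → E x (app E f δ) := fun hx =>
    h.mono hγ' h.self_mem (h.isOrd.1 _ hγ) _ hx
  have hUγ := h.isUniverse hγ' hω hlim
  have key : ∀ {p s a b}, IsFormula E (MemAtom E) p → IsFun E s (omega E) (app E f γ) →
      E a (app E f γ) → E b (app E f γ) → ∃ s' β μ, E β γ ∧ E μ γ ∧
      IsFun E s' (omega E) (app E f β) ∧ E a (app E f β) ∧ E b (app E f β) ∧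
      (∀ i x, E x (app E f δ) → (Tr E (app E f δ) p (update E s i x) ↔
          Tr E (app E f δ) p (update E s' i x))) ∧
        (∀ i x j y, E x (app E f δ) → E y (app E f δ) →
          (Tr E (app E f δ) p (update E (update E s i x) j y) ↔
            Tr E (app E f δ) p (update E (update E s' i x) j y))) ∧
      HoldsUniformly E δ f Φ₁ β μ ∧ HoldsUniformly E δ f Φ₂ β μ ∧
      HoldsUniformly E δ f Φ₃ β μ ∧ HoldsUniformly E δ f Φ₄ β μ := by
    intro p s a b hp hs ha hb
    obtain ⟨β, hβ, heq⟩ := h.exists_equivalent hγ hω hlim hp hs ha hb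
    obtain ⟨β', μ, hβ', hμ, hlt, -, hR⟩ := hcl β hβ
    obtain ⟨ha', hb', s', hs', h1, h2⟩ := heq β' hβ' ((h.ord hγ').mem hβ' |>.1 _ hlt)
    exact ⟨s', β', μ, hβ', hμ, hs', ha', hb', h1, h2, hR⟩
  have hlev : ∀ {μ x}, E μ γ → E x (app E f μ) → E x (app E f γ) := fun hμ hx =>
    h.mem_of_mem hγ' (h.level_mem hγ' hμ) hx
  refine ⟨γ, hγ, hω, hlim, fun ξ hξ => ?_, fun {p s i x} hp hs hi hx ht => ?_, fun {p s a} hp hs ha hR => ?_,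
    fun {p s F R ξ} hp hs hF hR hξ hb => ?_, fun {p s F R x y} hp hs hF hR hx hy hne he => ?_⟩
  · obtain ⟨β', μ, -, hμ, hlt, ⟨-, l, hl, hβl, hl'⟩, -⟩ := hcl ξ hξ
    have ho := h.ord (h.mem_succ (h.trans hγ' hμ))
    exact ⟨l, (h.ord hγ').mem_trans hμ hl, (ho.mem hl).mem_trans hβl hlt, hl'⟩
  · obtain ⟨s', β, μ, hβ, hμ, hs', ha', -, e1, -, u, -⟩ := key hp hs (hUγ.nat hi) (hUγ.nat hi)
    obtain ⟨ξ, hξ, hxξ⟩ := (h.mem_iff h.self_mem).1 hx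
    obtain ⟨y, hy, hty⟩ := u p s' i i hp hs' ha' ha' ⟨succ E ξ, h.inacc.succ_mem hξ, x,
      (h.mem_iff (h.mem_succ (h.inacc.succ_mem hξ))).2 ⟨ξ, by simp, hxξ⟩, by rwa [← e1 i x hx]⟩
    exact ⟨y, hlev hμ hy, by rwa [e1 i y (hmem (hlev hμ hy))]⟩
  · obtain ⟨s', β, μ, hβ, hμ, hs', ha', -, -, e2, -, u, -⟩ := key hp hs ha ha
    have haγ : ∀ {x}, E x a → E x (app E f δ) := fun hx => hmem (hUγ.trans ha hx)
    -- The hypothesis says that `γ` itself is a bound. As `γ` is below `δ`, uniformity supplies a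
    -- bound `μ` below `γ`.
    have := u p s' a a hp hs' ha' ha' ⟨γ, hγ, fun x hx => by
      obtain ⟨y, hy, ht⟩ := hR x hx
      exact ⟨y, hy, (e2 _ _ _ _ (haγ hx) (hmem hy)).1 ht⟩⟩
    refine ⟨_, h.level_mem hγ' hμ, fun x hx => ?_⟩
    obtain ⟨y, hy, ht⟩ := this x hx
    exact ⟨y, hy, (e2 _ _ _ _ (haγ hx) (hmem (hlev hμ hy))).2 ht⟩
  · obtain ⟨s', β, μ, hβ, hμ, hs', hF', hR', e1, -, -, -, u, -⟩ := key hp hs hF hR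
    have e : ∀ x, InStructureClass E (app E f δ) p s F R x ↔
        InStructureClass E (app E f δ) p s' F R x := fun x =>
      and_congr_right fun hx => and_congr_left fun _ => e1 _ _ hx
    exact ⟨_, h.level_mem hγ' hμ, fun x hx => u p s' F R hp hs' hF' hR'
      ⟨ξ, hξ, fun x hx => hb x ((e x).2 hx)⟩ x ((e x).1 hx)⟩
  · obtain ⟨s', β, μ, hβ, hμ, hs', hF', hR', e1, -, -, -, -, u⟩ := key hp hs hF hR
    have e : ∀ x, InStructureClass E (app E f δ) p s F R x ↔
        InStructureClass E (app E f δ) p s' F R x := fun x =>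
      and_congr_right fun hx => and_congr_left fun _ => e1 _ _ hx
    obtain ⟨α₁, hα₁, hx₁⟩ := (h.mem_iff h.self_mem).1 hx.1
    obtain ⟨α₂, hα₂, hy₂⟩ := (h.mem_iff h.self_mem).1 hy.1
    obtain ⟨α, hα, h1, h2⟩ := h.isOrd.exists_max (h.inacc.succ_mem hα₁) (h.inacc.succ_mem hα₂)
    obtain ⟨x', y', hx', hy', hcx, hcy, hne', he'⟩ := u p s' F R hp hs' hF' hR' ⟨α, hα, x, y,
      (h.mem_iff (h.mem_succ hα)).2 ⟨α₁, h1 _ (by simp), hx₁⟩,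
      (h.mem_iff (h.mem_succ hα)).2 ⟨α₂, h2 _ (by simp), hy₂⟩,
      (e x).1 hx, (e y).1 hy, hne, he⟩
    exact ⟨x', y', hlev hμ hx', hlev hμ hy', (e x').2 hcx, (e y').2 hcy, hne', he'⟩

end SetModel

namespace SetModel

variable {M : Type v} {E : M → M → Prop} [hZ : IsZFC E]

attribute [local instance 50] DefF.rename

/-! ## Absoluteness for universes -/

theorem IsFun.comp {a b c f g k : M} (hf : IsFun E f a b) (hg : IsFun E g b c)
    (hk : IsComp E k g f) : IsFun E k a c := by
  have hk' : ∀ {x w}, App E k x w ↔ ∃ y, App E f x y ∧ App E g y w := fun {x w} => by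
    rw [SetModel.app_iff, hk]
    simp only [isOPair_iff, opair_inj]
    exact ⟨fun ⟨_, y, _, ⟨rfl, rfl⟩, h⟩ => ⟨y, h⟩, fun ⟨y, h⟩ => ⟨_, y, _, ⟨rfl, rfl⟩, h⟩⟩
  refine ⟨fun z hz => ?_, fun x hx => ?_⟩
  · obtain ⟨x, y, w, hz, h1, h2⟩ := (hk z).1 hz
    exact ⟨x, w, hf.app_mem_left h1, hg.app_mem_right h2, hz⟩
  · refine ⟨_, hk'.2 ⟨_, hf.app_spec hx, hg.app_spec (hf.app_mem hx)⟩, fun w hw => ?_⟩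
    obtain ⟨y, h1, h2⟩ := hk'.1 hw
    rw [hf.app_eq h1, hg.app_eq h2]

/-- The structure `(X, e)` is isomorphic to the universe `m` of the model, and every member of `m`
belongs to a smaller universe. -/
structure IsInner {X : Type*} (E : M → M → Prop) [IsZFC E] (e : X → X → Prop) (ι : X → M) (m : M) :
    Prop where
  inj : ∀ {x y}, ι x = ι y → x = y
  rel : ∀ {x y}, e x y ↔ E (ι x) (ι y)
  mem : ∀ x, E (ι x) m
  lift : ∀ {y}, E y m → ∃ x, ι x = y
  isUniverse : IsUniverse E m
  exists_universe : ∀ {y}, E y m → ∃ U, E U m ∧ IsUniverse E U ∧ E y U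

namespace IsInner

variable {X : Type*} {e : X → X → Prop} {ι : X → M} {m : M}

theorem mem_of_mem (h : IsInner E e ι m) {x : X} {y : M} (hy : E y (ι x)) : E y m :=
  h.isUniverse.trans (h.mem x) hy

theorem lift_mem (h : IsInner E e ι m) {x : X} {y : M} (hy : E y (ι x)) : ∃ y', ι y' = y :=
  h.lift (h.mem_of_mem hy)

theorem eq_iff (h : IsInner E e ι m) {x y : X} : ι x = ι y ↔ x = y := ⟨h.inj, fun h => h ▸ rfl⟩

theorem forall_mem (h : IsInner E e ι m) {x : X} {P : M → Prop} :
    (∀ z, e z x → P (ι z)) ↔ ∀ z, E z (ι x) → P z := by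
  refine ⟨fun H z hz => ?_, fun H z hz => H _ (h.rel.1 hz)⟩
  obtain ⟨z, rfl⟩ := h.lift_mem hz
  exact H z (h.rel.2 hz)

theorem forall_iff (h : IsInner E e ι m) {P : M → Prop} :
    (∀ z, P (ι z)) ↔ ∀ z, E z m → P z := by
  refine ⟨fun H z hz => ?_, fun H z => H _ (h.mem z)⟩
  obtain ⟨z, rfl⟩ := h.lift hz
  exact H z

theorem exists_iff (h : IsInner E e ι m) {P : M → Prop} :
    (∃ z, P (ι z)) ↔ ∃ z, E z m ∧ P z := by
  refine ⟨fun ⟨z, hz⟩ => ⟨_, h.mem z, hz⟩, fun ⟨z, hz, hP⟩ => ?_⟩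
  obtain ⟨z, rfl⟩ := h.lift hz
  exact ⟨z, hP⟩

/-- The basic tool for absoluteness: a quantifier over the inner structure may be read in the whole
model as soon as every witness is forced into `m`. -/
theorem exists_iff' (h : IsInner E e ι m) {P : M → Prop} (hP : ∀ z, P z → E z m) :
    (∃ z, P (ι z)) ↔ ∃ z, P z :=
  h.exists_iff.trans (exists_congr fun z => ⟨And.right, fun hz => ⟨hP z hz, hz⟩⟩)

theorem forall_iff' (h : IsInner E e ι m) {P : M → Prop} (hP : ∀ z, ¬ E z m → P z) :
    (∀ z, P (ι z)) ↔ ∀ z, P z :=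
  h.forall_iff.trans (forall_congr' fun z => ⟨fun hz => by
    by_cases hm : E z m
    exacts [hz hm, hP z hm], fun hz _ => hz⟩)

theorem opair_mem (h : IsInner E e ι m) {x : X} {y z : M} (hy : E (opair E y z) (ι x)) :
    E y m ∧ E z m :=
  ⟨h.isUniverse.opair_left (h.mem_of_mem hy), h.isUniverse.opair_right (h.mem_of_mem hy)⟩

theorem isEmptySet (h : IsInner E e ι m) {x : X} : IsEmptySet e x ↔ IsEmptySet E (ι x) :=
  h.forall_mem (P := fun _ => False)

theorem subset (h : IsInner E e ι m) {x y : X} : Subset e x y ↔ Subset E (ι x) (ι y) := by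
  simp only [Subset, ← h.forall_mem, ← h.rel]

theorem isPair (h : IsInner E e ι m) {x y z : X} :
    IsPair e z x y ↔ IsPair E (ι z) (ι x) (ι y) := by
  unfold IsPair
  rw [← h.forall_iff']
  · simp only [h.rel, h.eq_iff]
  · intro w hw
    refine iff_of_false (fun hw' => hw (h.mem_of_mem hw')) ?_
    rintro (rfl | rfl) <;> exact hw (h.mem _)

theorem isOPair (h : IsInner E e ι m) {x y z : X} :
    IsOPair e z x y ↔ IsOPair E (ι z) (ι x) (ι y) := by
  unfold IsOPair
  simp only [h.isPair]
  rw [h.exists_iff' (P := fun a => ∃ b, IsPair E a (ι x) (ι x) ∧ IsPair E (ι b) (ι x) (ι y) ∧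
    IsPair E (ι z) a (ι b)) fun a ⟨b, hb⟩ => h.mem_of_mem ((hb.2.2 a).2 (Or.inl rfl))]
  refine exists_congr fun a => ?_
  exact h.exists_iff' (P := fun b => IsPair E a (ι x) (ι x) ∧ IsPair E b (ι x) (ι y) ∧
    IsPair E (ι z) a b) fun b hb => h.mem_of_mem ((hb.2.2 b).2 (Or.inr rfl))

theorem isSucc (h : IsInner E e ι m) {x y : X} : IsSucc e y x ↔ IsSucc E (ι y) (ι x) := by
  unfold IsSucc
  rw [← h.forall_iff']
  · simp only [h.rel, h.eq_iff]
  · intro w hw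
    refine iff_of_false (fun hw' => hw (h.mem_of_mem hw')) ?_
    rintro (h' | rfl)
    exacts [hw (h.mem_of_mem h'), hw (h.mem _)]

theorem isOrd (h : IsInner E e ι m) {x : X} : IsOrd e x ↔ IsOrd E (ι x) := by
  simp only [IsOrd, h.subset]
  refine and_congr (h.forall_mem (P := fun y => Subset E y (ι x))) ?_
  rw [← h.forall_mem]
  exact forall_congr' fun y => imp_congr_right fun _ => h.forall_mem (P := fun z => Subset E z (ι y))

theorem isNat (h : IsInner E e ι m) {x : X} : IsNat e x ↔ IsNat E (ι x) := by
  simp only [IsNat, h.isOrd]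
  refine and_congr_right fun _ => ?_
  rw [← h.forall_iff' fun k hk hx => absurd (hx.elim (fun he => he ▸ h.mem _) h.mem_of_mem) hk]
  refine forall_congr' fun k => ?_
  rw [h.eq_iff, h.rel, h.isEmptySet]
  refine imp_congr_right fun _ => or_congr_right ?_
  simp only [h.isSucc]
  exact h.exists_iff' (P := fun l => IsSucc E (ι k) l)
    fun l hl => h.mem_of_mem ((hl l).2 (Or.inr rfl))

theorem isOmega (h : IsInner E e ι m) {w : X} : IsOmega e w ↔ IsOmega E (ι w) := by
  unfold IsOmega
  rw [← h.forall_iff' fun n hn => iff_of_false (fun hn' => hn (h.mem_of_mem hn'))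
    fun hn' => hn (h.isUniverse.nat hn')]
  simp only [h.rel, h.isNat]

theorem isNumeral (h : IsInner E e ι m) {k : ℕ} {x : X} :
    IsNumeral e k x ↔ IsNumeral E k (ι x) := by
  induction k generalizing x with
  | zero => exact h.isEmptySet
  | succ k ih =>
    simp only [IsNumeral, ih, h.isSucc]
    exact h.exists_iff' (P := fun y => IsNumeral E k y ∧ IsSucc E (ι x) y)
      fun y hy => h.mem_of_mem ((hy.2 y).2 (Or.inr rfl))

theorem app (h : IsInner E e ι m) {f x y : X} : App e f x y ↔ App E (ι f) (ι x) (ι y) := by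
  simp only [App, h.rel, h.isOPair]
  exact h.exists_iff' (P := fun z => E z (ι f) ∧ IsOPair E z (ι x) (ι y))
    fun z hz => h.mem_of_mem hz.1

theorem app_mem (h : IsInner E e ι m) {f : X} {x y : M} (hx : App E (ι f) x y) :
    E x m ∧ E y m := h.opair_mem (SetModel.app_iff.1 hx)

theorem isFun (h : IsInner E e ι m) {f a b : X} : IsFun e f a b ↔ IsFun E (ι f) (ι a) (ι b) := by
  unfold IsFun
  rw [← h.forall_mem, ← h.forall_mem]
  refine and_congr (forall_congr' fun z => imp_congr_right fun _ => ?_)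
    (forall_congr' fun x => imp_congr_right fun _ => ?_)
  · simp only [h.rel, h.isOPair]
    constructor
    · rintro ⟨x, y, hx⟩
      exact ⟨_, _, hx⟩
    · rintro ⟨x, y, hx, hy, hz⟩
      obtain ⟨x, rfl⟩ := h.lift_mem hx
      obtain ⟨y, rfl⟩ := h.lift_mem hy
      exact ⟨_, _, hx, hy, hz⟩
  · simp only [h.app]
    constructor
    · rintro ⟨y, hy, hu⟩
      refine ⟨_, hy, fun y' hy' => ?_⟩
      obtain ⟨y', rfl⟩ := h.lift (h.app_mem hy').2
      exact congrArg ι (hu y' hy')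
    · rintro ⟨y, hy, hu⟩
      obtain ⟨y, rfl⟩ := h.lift (h.app_mem hy).2
      exact ⟨y, hy, fun y' hy' => h.inj (hu _ hy')⟩

theorem isComp (h : IsInner E e ι m) {k g f : X} :
    IsComp e k g f ↔ IsComp E (ι k) (ι g) (ι f) := by
  unfold IsComp
  have : ∀ z, ¬ E z m → (E z (ι k) ↔
      ∃ x y w, IsOPair E z x w ∧ App E (ι f) x y ∧ App E (ι g) y w) := fun z hz => by
    refine iff_of_false (fun hz' => hz (h.mem_of_mem hz')) ?_
    rintro ⟨x, y, w, h1, h2, h3⟩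
    rw [isOPair_iff.1 h1] at hz
    exact hz (h.isUniverse.opair (h.app_mem h2).1 (h.app_mem h3).2)
  rw [← h.forall_iff' this]
  refine forall_congr' fun z => iff_congr h.rel ?_
  simp only [h.isOPair, h.app]
  constructor
  · rintro ⟨x, y, w, hx⟩
    exact ⟨_, _, _, hx⟩
  · rintro ⟨x, y, w, h1, h2, h3⟩
    obtain ⟨x, rfl⟩ := h.lift (h.app_mem h2).1
    obtain ⟨y, rfl⟩ := h.lift (h.app_mem h2).2
    obtain ⟨w, rfl⟩ := h.lift (h.app_mem h3).2
    exact ⟨_, _, _, h1, h2, h3⟩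

theorem isTagged (h : IsInner E e ι m) {k : ℕ} {c x y : X} :
    IsTagged e k c x y ↔ IsTagged E k (ι c) (ι x) (ι y) := by
  simp only [IsTagged, h.isNumeral, h.isOPair]
  constructor
  · rintro ⟨t, z, ht⟩
    exact ⟨_, _, ht⟩
  · rintro ⟨t, z, h1, h2, h3⟩
    obtain ⟨t, rfl⟩ := h.lift (h.isUniverse.opair_left (isOPair_iff.1 h3 ▸ h.mem c))
    obtain ⟨z, rfl⟩ := h.lift (h.isUniverse.opair_right (isOPair_iff.1 h3 ▸ h.mem c))
    exact ⟨_, _, h1, h2, h3⟩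

theorem isTagged_mem (h : IsInner E e ι m) {k : ℕ} {c : X} {x y : M}
    (hc : IsTagged E k (ι c) x y) : E x m ∧ E y m := by
  have h1 := h.isUniverse.opair_right (isTagged_iff.1 hc ▸ h.mem c)
  exact ⟨h.isUniverse.opair_left h1, h.isUniverse.opair_right h1⟩

theorem isAssignment (h : IsInner E e ι m) {a s : X} :
    IsAssignment e a s ↔ IsAssignment E (ι a) (ι s) := by
  simp only [IsAssignment, h.isOmega, h.isFun]
  exact h.exists_iff' (P := fun w => IsOmega E w ∧ IsFun E (ι s) w (ι a))
    fun w hw => isOmega_iff.1 hw.1 ▸ h.isUniverse.omega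

theorem lift_assignment (h : IsInner E e ι m) {a : X} {s : M} (hs : IsAssignment E (ι a) s) :
    ∃ s', ι s' = s :=
  h.lift (h.isUniverse.isFun h.isUniverse.omega (h.mem a) (isAssignment_iff.1 hs))

theorem isUpdate (h : IsInner E e ι m) {a s i x s' : X} :
    IsUpdate e a s i x s' ↔ IsUpdate E (ι a) (ι s) (ι i) (ι x) (ι s') := by
  simp only [IsUpdate, h.isAssignment, h.app]
  refine and_congr_right fun _ => and_congr_right fun _ => ?_
  rw [← h.forall_iff' fun n hn _ hn' => absurd (h.isUniverse.nat hn') hn]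
  refine forall_congr' fun n => ?_
  rw [← h.forall_iff' fun y hy _ _ => iff_of_false (fun h' => hy (h.app_mem h').2)
    fun h' => hy (h.app_mem h').2]
  simp only [h.isNat, ne_eq, h.eq_iff]

end IsInner

end SetModel

/-! ### Absoluteness of formulas, satisfaction, structures and embeddings -/

namespace SetModel

variable {M : Type v} {E : M → M → Prop} [hZ : IsZFC E]

attribute [local instance 50] DefF.rename

omit hZ in
theorem IsClosedUnderFormation.atom_mem {atom : M → Prop} {P c : M}
    (hP : IsClosedUnderFormation E atom P) (hc : atom c) : E c P := hP.2.2.1 c hc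

/-- The atomic formulas `atom₀` of the inner structure correspond to the atomic formulas `atom`, and
they belong to a universe. -/
structure AtomsAgree {X : Type*} (E : M → M → Prop) (ι : X → M) (m : M) (atom₀ : X → Prop)
    (atom : M → Prop) : Prop where
  iff : ∀ {c}, atom₀ c ↔ atom (ι c)
  closed : ∃ U, E U m ∧ IsClosedUnderFormation E atom U
  defP : DefP E fun v => atom (v 0)

namespace IsInner

variable {X : Type*} {e : X → X → Prop} {ι : X → M} {m : M}

section

variable {atom₀ : X → Prop} {atom : M → Prop}

theorem atom_mem (h : IsInner E e ι m) (ha : AtomsAgree E ι m atom₀ atom) {c : M} (hc : atom c) :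
    E c m := by
  obtain ⟨U, hU, hcl⟩ := ha.closed
  exact h.isUniverse.trans hU (hcl.atom_mem hc)

theorem isClosedUnderFormation (h : IsInner E e ι m) (ha : AtomsAgree E ι m atom₀ atom) {P : X} :
    IsClosedUnderFormation e atom₀ P ↔ IsClosedUnderFormation E atom (ι P) := by
  have hT : ∀ {k c x y}, E x m → E y m → IsTagged E k c x y → E c m := fun hx hy hc =>
    isTagged_iff.1 hc ▸ h.isUniverse.tag hx hy
  simp only [IsClosedUnderFormation, h.isEmptySet, h.rel, h.isNat, h.isTagged, ha.iff]
  constructor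
  · rintro ⟨h1, h2, h3, h4, h5⟩
    refine ⟨fun c hc => ?_, fun c i j hi hj hc => ?_, fun c hc => ?_, fun c p q hp hq hc => ?_,
      fun c i p hi hp hc => ?_⟩
    · obtain ⟨c, rfl⟩ := h.lift (isEmptySet_iff.1 hc ▸ h.isUniverse.empty)
      exact h1 c hc
    · obtain ⟨i, rfl⟩ := h.lift (h.isUniverse.nat hi)
      obtain ⟨j, rfl⟩ := h.lift (h.isUniverse.nat hj)
      obtain ⟨c, rfl⟩ := h.lift (hT (h.mem _) (h.mem _) hc)
      exact h2 c i j hi hj hc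
    · obtain ⟨c, rfl⟩ := h.lift (h.atom_mem ha hc)
      exact h3 c hc
    · obtain ⟨p, rfl⟩ := h.lift_mem hp
      obtain ⟨q, rfl⟩ := h.lift_mem hq
      obtain ⟨c, rfl⟩ := h.lift (hT (h.mem _) (h.mem _) hc)
      exact h4 c p q hp hq hc
    · obtain ⟨i, rfl⟩ := h.lift (h.isUniverse.nat hi)
      obtain ⟨p, rfl⟩ := h.lift_mem hp
      obtain ⟨c, rfl⟩ := h.lift (hT (h.mem _) (h.mem _) hc)
      exact h5 c i p hi hp hc
  · rintro ⟨h1, h2, h3, h4, h5⟩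
    exact ⟨fun c => h1 _, fun c i j => h2 _ _ _, fun c => h3 _, fun c p q => h4 _ _ _,
      fun c i p => h5 _ _ _⟩

theorem exists_formulaSet (h : IsInner E e ι m) (ha : AtomsAgree E ι m atom₀ atom) :
    ∃ Fm, E Fm m ∧ ∀ p, E p Fm ↔ IsFormula E atom p := by
  have := ha.defP
  have := this.comp₁
  have : ∀ (σ : ℕ → ℕ) (i : ℕ), DefP E fun v => (fun _ => atom) (fun n => v (σ n)) (v i) :=
    fun σ i => inferInstance
  have : DefP E fun v => IsFormula E atom (v 0) := inferInstance
  have := this.comp₁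
  obtain ⟨U, hU, hcl⟩ := ha.closed
  refine ⟨sep E U (IsFormula E atom), h.isUniverse.sub hU fun x hx => (mem_sep.1 hx).1, fun p => ?_⟩
  exact mem_sep.trans ⟨And.right, fun hp => ⟨hp U hcl, hp⟩⟩

/-- The inner structure quantifies over fewer closed sets. This makes no difference, because the set
of all formulas belongs to `m` and is itself closed. -/
theorem isFormula (h : IsInner E e ι m) (ha : AtomsAgree E ι m atom₀ atom) {p : X} :
    IsFormula e atom₀ p ↔ IsFormula E atom (ι p) := by
  constructor
  · intro hp
    obtain ⟨Fm, hFm, hF⟩ := h.exists_formulaSet ha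
    obtain ⟨Fm, rfl⟩ := h.lift hFm
    refine (hF _).1 (h.rel.1 (hp Fm ((h.isClosedUnderFormation ha).2 ?_)))
    refine isClosedUnderFormation_iff.2 ⟨?_, fun i j hi hj => ?_, fun c hc => ?_,
      fun p q hp hq => ?_, fun i p hi hp => ?_⟩ <;> rw [hF] at *
    · exact isFormula_empty
    · exact isFormula_eq hi hj
    · exact isFormula_atom hc
    · exact hp.imp hq
    · exact hp.all hi
  · exact fun hp P hP => h.rel.2 (hp _ ((h.isClosedUnderFormation ha).1 hP))

theorem formula_mem (h : IsInner E e ι m) (ha : AtomsAgree E ι m atom₀ atom) {p : M}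
    (hp : IsFormula E atom p) : E p m := by
  obtain ⟨U, hU, hcl⟩ := ha.closed
  exact h.isUniverse.trans hU (hp U hcl)

theorem isSatisfactionSet (h : IsInner E e ι m) (ha : AtomsAgree E ι m atom₀ atom)
    {val₀ : X → X → Prop} {val : M → M → Prop} {a : X}
    (hval : ∀ {c s}, atom (ι c) → IsAssignment E (ι a) (ι s) → (val₀ c s ↔ val (ι c) (ι s)))
    {S : X} :
    IsSatisfactionSet e atom₀ val₀ a S ↔ IsSatisfactionSet E atom val (ι a) (ι S) := by
  simp only [IsSatisfactionSet, h.isEmptySet, h.isAssignment, h.isNat, h.isTagged, ha.iff, h.app,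
    h.isFormula ha, h.isUpdate, h.rel]
  have hT : ∀ {k c x y}, E x m → E y m → IsTagged E k c x y → E c m := fun hx hy hc =>
    isTagged_iff.1 hc ▸ h.isUniverse.tag hx hy
  constructor
  · intro H s hs
    obtain ⟨s, rfl⟩ := h.lift_assignment hs
    obtain ⟨h1, h2, h3, h4, h5⟩ := H s hs
    refine ⟨fun c hc => ?_, fun c i j hi hj hc => ?_, fun c hc => ?_, fun c p q hp hq hc => ?_,
      fun c i p hi hp hc => ?_⟩
    · obtain ⟨c, rfl⟩ := h.lift (isEmptySet_iff.1 hc ▸ h.isUniverse.empty)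
      exact h1 c hc
    · obtain ⟨i, rfl⟩ := h.lift (h.isUniverse.nat hi)
      obtain ⟨j, rfl⟩ := h.lift (h.isUniverse.nat hj)
      obtain ⟨c, rfl⟩ := h.lift (hT (h.mem _) (h.mem _) hc)
      exact (h2 c i j hi hj hc).trans (h.exists_iff'
        (P := fun x => App E (ι s) (ι i) x ∧ App E (ι s) (ι j) x) fun x hx => (h.app_mem hx.1).2)
    · obtain ⟨c, rfl⟩ := h.lift (h.atom_mem ha hc)
      rw [h3 c hc, hval hc hs]
    · obtain ⟨p, rfl⟩ := h.lift (h.formula_mem ha hp)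
      obtain ⟨q, rfl⟩ := h.lift (h.formula_mem ha hq)
      obtain ⟨c, rfl⟩ := h.lift (hT (h.mem _) (h.mem _) hc)
      exact h4 c p q hp hq hc
    · obtain ⟨i, rfl⟩ := h.lift (h.isUniverse.nat hi)
      obtain ⟨p, rfl⟩ := h.lift (h.formula_mem ha hp)
      obtain ⟨c, rfl⟩ := h.lift (hT (h.mem _) (h.mem _) hc)
      rw [h5 c i p hi hp hc]
      refine ⟨fun H x s' hx hs' => ?_, fun H x s' => H _ _⟩
      obtain ⟨x, rfl⟩ := h.lift_mem hx
      obtain ⟨s', rfl⟩ := h.lift_assignment hs'.1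
      exact H x s' hx hs'
  · intro H s hs
    obtain ⟨h1, h2, h3, h4, h5⟩ := H _ hs
    refine ⟨fun c => h1 _, fun c i j hi hj hc => ?_, fun c hc => ?_, fun c p q => h4 _ _ _,
      fun c i p hi hp hc => ?_⟩
    · exact (h2 _ _ _ hi hj hc).trans (h.exists_iff'
        (P := fun x => App E (ι s) (ι i) x ∧ App E (ι s) (ι j) x)
          fun x hx => (h.app_mem hx.1).2).symm
    · rw [h3 _ hc, hval hc hs]
    · rw [h5 _ _ _ hi hp hc]
      refine ⟨fun H x s' => H _ _, fun H x s' hx hs' => ?_⟩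
      obtain ⟨x, rfl⟩ := h.lift_mem hx
      obtain ⟨s', rfl⟩ := h.lift_assignment hs'.1
      exact H x s' hx hs'

/-- A satisfaction set of the model need not belong to `m`. Its restriction to pairs of a formula
and an assignment does, and this restriction obeys the same clauses. -/
theorem sat (h : IsInner E e ι m) (ha : AtomsAgree E ι m atom₀ atom)
    {val₀ : X → X → Prop} {val : M → M → Prop} {a : X}
    (hval : ∀ {c s}, atom (ι c) → IsAssignment E (ι a) (ι s) → (val₀ c s ↔ val (ι c) (ι s)))
    {p s : X} (hp : IsFormula E atom (ι p)) (hs : IsAssignment E (ι a) (ι s)) :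
    Sat e atom₀ val₀ a p s ↔ Sat E atom val (ι a) (ι p) (ι s) := by
  constructor
  · rintro ⟨S, hS, hps⟩
    exact ⟨_, (h.isSatisfactionSet ha hval).1 hS, h.app.1 hps⟩
  · rintro ⟨S, hS, hps⟩
    obtain ⟨Fm, hFm, hF⟩ := h.exists_formulaSet ha
    have hA : E (prod E Fm (funs E (omega E) (ι a))) m :=
      h.isUniverse.prod hFm (h.isUniverse.funs h.isUniverse.omega (h.mem a))
    obtain ⟨S', hS'⟩ := h.lift (h.isUniverse.sub hA (y := sep E (prod E Fm (funs E (omega E) (ι a)))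
      fun z => E z S) fun z hz => (mem_sep.1 hz).1)
    have hSS : ∀ {p s}, IsFormula E atom p → IsAssignment E (ι a) s →
        (App E (ι S') p s ↔ App E S p s) := fun {p s} hp hs => by
      rw [SetModel.app_iff, SetModel.app_iff, hS', mem_sep (E := E)]
      exact ⟨And.right, fun h => ⟨SetModel.mem_prod.2 ⟨_, _, (hF _).2 hp,
        mem_funs.2 (isAssignment_iff.1 hs), rfl⟩, h⟩⟩
    refine ⟨S', (h.isSatisfactionSet ha hval).2 fun s hs => ?_, h.app.2 ((hSS hp hs).2 hps)⟩
    obtain ⟨h1, h2, h3, h4, h5⟩ := hS s hs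
    refine ⟨fun c hc => ?_, fun c i j hi hj hc => ?_, fun c hc => ?_, fun c p q hp hq hc => ?_,
      fun c i p hi hp hc => ?_⟩
    · rw [hSS (isEmptySet_iff.1 hc ▸ isFormula_empty) hs]
      exact h1 c hc
    · rw [hSS (isTagged_iff.1 hc ▸ isFormula_eq hi hj) hs]
      exact h2 c i j hi hj hc
    · rw [hSS (isFormula_atom hc) hs]
      exact h3 c hc
    · rw [hSS (isTagged_iff.1 hc ▸ hp.imp hq) hs, hSS hp hs, hSS hq hs]
      exact h4 c p q hp hq hc
    · rw [hSS (isTagged_iff.1 hc ▸ hp.all hi) hs, h5 c i p hi hp hc]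
      exact forall_congr' fun x => forall_congr' fun s' => imp_congr_right fun _ =>
        imp_congr_right fun hs' => (hSS hp hs'.1).symm

end

theorem memAtoms (h : IsInner E e ι m) : AtomsAgree E ι m (MemAtom e) (MemAtom E) where
  iff := fun {c} => by
    simp only [MemAtom, h.isNat, h.isTagged]
    constructor
    · rintro ⟨i, j, hi⟩
      exact ⟨_, _, hi⟩
    · rintro ⟨i, j, hi, hj, hc⟩
      obtain ⟨i, rfl⟩ := h.lift (h.isUniverse.nat hi)
      obtain ⟨j, rfl⟩ := h.lift (h.isUniverse.nat hj)
      exact ⟨_, _, hi, hj, hc⟩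
  closed := by
    obtain ⟨U, hU, hUu, -⟩ := h.exists_universe h.isUniverse.empty
    exact ⟨U, hU, hUu.isClosed⟩
  defP := inferInstance

theorem memVal (h : IsInner E e ι m) {c s : X} : MemVal e e c s ↔ MemVal E E (ι c) (ι s) := by
  simp only [MemVal, h.isTagged, h.app, h.rel]
  constructor
  · rintro ⟨i, j, x, y, hi⟩
    exact ⟨_, _, _, _, hi⟩
  · rintro ⟨i, j, x, y, h1, h2, h3, h4⟩
    obtain ⟨i, rfl⟩ := h.lift (h.app_mem h2).1
    obtain ⟨j, rfl⟩ := h.lift (h.app_mem h3).1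
    obtain ⟨x, rfl⟩ := h.lift (h.app_mem h2).2
    obtain ⟨y, rfl⟩ := h.lift (h.app_mem h3).2
    exact ⟨_, _, _, _, h1, h2, h3, h4⟩

theorem isSymbol (h : IsInner E e ι m) {L σ n : X} :
    IsSymbol e L σ n ↔ IsSymbol E (ι L) (ι σ) (ι n) := by
  simp only [IsSymbol, h.rel, h.isNat, h.isOPair]
  refine and_congr_right fun _ => and_congr_right fun _ => ?_
  exact h.exists_iff' (P := fun s => IsOPair E (ι σ) s (ι n)) fun s hs =>
    h.isUniverse.opair_left (isOPair_iff.1 hs ▸ h.mem σ)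

theorem isStructure (h : IsInner E e ι m) {F R a f r : X} :
    IsStructure e F R a f r ↔ IsStructure E (ι F) (ι R) (ι a) (ι f) (ι r) := by
  have hU := h.isUniverse
  have hop : ∀ {z : X} {x y}, IsOPair E (ι z) x y → E x m ∧ E y m := fun {z x y} hz =>
    ⟨hU.opair_left (isOPair_iff.1 hz ▸ h.mem z), hU.opair_right (isOPair_iff.1 hz ▸ h.mem z)⟩
  simp only [IsStructure, h.rel, h.isOPair, h.isSymbol, h.isFun]
  refine and_congr (h.exists_iff' (P := fun x => E x (ι a)) fun x hx => h.mem_of_mem hx)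
    (and_congr ?_ (and_congr ?_ ?_))
  · rw [← h.forall_mem]
    refine forall_congr' fun z => imp_congr h.rel.symm ?_
    constructor
    · rintro ⟨w, σ, n, t, y, hw⟩
      exact ⟨_, _, _, _, _, hw⟩
    · rintro ⟨w, σ, n, t, y, h1, h2, h3, h4, h5⟩
      obtain ⟨w, rfl⟩ := h.lift (hop h1).1
      obtain ⟨y, rfl⟩ := h.lift (hop h1).2
      obtain ⟨σ, rfl⟩ := h.lift (hop h2).1
      obtain ⟨t, rfl⟩ := h.lift (hop h2).2
      obtain ⟨n, rfl⟩ := h.lift (hU.nat h3.2.1)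
      exact ⟨_, _, _, _, _, h1, h2, h3, h4, h5⟩
  · have key : ∀ σ n t, IsSymbol E (ι F) (ι σ) (ι n) → IsFun E (ι t) (ι n) (ι a) →
        ((∃! y, ∃ z w, IsOPair E (ι z) (ι w) (ι y) ∧ IsOPair E (ι w) (ι σ) (ι t) ∧ E (ι z) (ι f)) ↔
          ∃! y, ∃ z w, IsOPair E z w y ∧ IsOPair E w (ι σ) (ι t) ∧ E z (ι f)) := by
      intro σ n t _ _
      have key : ∀ {y}, (∃ z w, IsOPair E z w y ∧ IsOPair E w (ι σ) (ι t) ∧ E z (ι f)) →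
          ∃ y', ι y' = y ∧
            ∃ z w, IsOPair E (ι z) (ι w) y ∧ IsOPair E (ι w) (ι σ) (ι t) ∧ E (ι z) (ι f) := by
        rintro y ⟨z, w, h1, h2, h3⟩
        obtain ⟨z, rfl⟩ := h.lift_mem h3
        obtain ⟨w, rfl⟩ := h.lift (hop h1).1
        obtain ⟨y, rfl⟩ := h.lift (hop h1).2
        exact ⟨y, rfl, _, _, h1, h2, h3⟩
      constructor
      · rintro ⟨y, ⟨z, w, h1⟩, hu⟩
        refine ⟨ι y, ⟨_, _, h1⟩, fun y' hy' => ?_⟩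
        obtain ⟨y', rfl, hy'⟩ := key hy'
        exact congrArg ι (hu y' hy')
      · rintro ⟨y, hy, hu⟩
        obtain ⟨y, rfl, hy⟩ := key hy
        exact ⟨y, hy, fun y' ⟨z, w, h1⟩ => h.inj (hu _ ⟨_, _, h1⟩)⟩
    constructor
    · intro H σ n t hσ ht
      obtain ⟨σ, rfl⟩ := h.lift_mem hσ.1
      obtain ⟨n, rfl⟩ := h.lift (hU.nat hσ.2.1)
      obtain ⟨t, rfl⟩ := h.lift (hU.isFun (h.mem n) (h.mem a) ht)
      exact (key _ _ _ hσ ht).1 (H _ _ _ hσ ht)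
    · exact fun H σ n t hσ ht => (key _ _ _ hσ ht).2 (H _ _ _ hσ ht)
  · rw [← h.forall_mem]
    refine forall_congr' fun z => imp_congr h.rel.symm ?_
    constructor
    · rintro ⟨σ, n, t, hw⟩
      exact ⟨_, _, _, hw⟩
    · rintro ⟨σ, n, t, h1, h2, h3⟩
      obtain ⟨σ, rfl⟩ := h.lift (hop h1).1
      obtain ⟨t, rfl⟩ := h.lift (hop h1).2
      obtain ⟨n, rfl⟩ := h.lift (hU.nat h2.2.1)
      exact ⟨_, _, _, h1, h2, h3⟩

theorem isStructureCode (h : IsInner E e ι m) {F R x a f r : X} :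
    IsStructureCode e F R x a f r ↔ IsStructureCode E (ι F) (ι R) (ι x) (ι a) (ι f) (ι r) := by
  simp only [IsStructureCode, h.isStructure, h.isOPair]
  refine and_congr_right fun _ => ?_
  exact h.exists_iff' (P := fun z => IsOPair E z (ι f) (ι r) ∧ IsOPair E (ι x) (ι a) z)
    fun z hz => h.isUniverse.opair_right (isOPair_iff.1 hz.2 ▸ h.mem x)

theorem structAtoms (h : IsInner E e ι m) (F R : X) :
    AtomsAgree E ι m (StructAtom e F R) (StructAtom E (ι F) (ι R)) where
  iff := fun {c} => by
    simp only [StructAtom, h.isSymbol, h.isOmega, h.isFun, h.isTagged, h.isOPair, h.isNat]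
    constructor
    · rintro (⟨σ, n, t, w, h1⟩ | ⟨σ, n, t, w, d, j, h1⟩)
      exacts [Or.inl ⟨_, _, _, _, h1⟩, Or.inr ⟨_, _, _, _, _, _, h1⟩]
    · rintro (⟨σ, n, t, w, h1, h2, h3, h4⟩ | ⟨σ, n, t, w, d, j, h1, h2, h3, h4, h5, h6⟩)
      · obtain ⟨σ, rfl⟩ := h.lift (h.isTagged_mem h4).1
        obtain ⟨t, rfl⟩ := h.lift (h.isTagged_mem h4).2
        obtain ⟨n, rfl⟩ := h.lift (h.isUniverse.nat h1.2.1)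
        obtain ⟨w, rfl⟩ := h.lift (isOmega_iff.1 h2 ▸ h.isUniverse.omega)
        exact Or.inl ⟨_, _, _, _, h1, h2, h3, h4⟩
      · obtain ⟨d, rfl⟩ := h.lift (h.isTagged_mem h6).1
        obtain ⟨j, rfl⟩ := h.lift (h.isTagged_mem h6).2
        obtain ⟨σ, rfl⟩ := h.lift (h.isUniverse.opair_left (isOPair_iff.1 h4 ▸ h.mem d))
        obtain ⟨t, rfl⟩ := h.lift (h.isUniverse.opair_right (isOPair_iff.1 h4 ▸ h.mem d))
        obtain ⟨n, rfl⟩ := h.lift (h.isUniverse.nat h1.2.1)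
        obtain ⟨w, rfl⟩ := h.lift (isOmega_iff.1 h2 ▸ h.isUniverse.omega)
        exact Or.inr ⟨_, _, _, _, _, _, h1, h2, h3, h4, h5, h6⟩
  closed := by
    -- A smaller universe that contains the whole language contains all atomic formulas.
    obtain ⟨U, hU, hUu, hFR⟩ := h.exists_universe (h.isUniverse.opair (h.mem F) (h.mem R))
    have hF := hUu.opair_left hFR
    have hR := hUu.opair_right hFR
    refine ⟨U, hU, isClosedUnderFormation_iff.2 ⟨hUu.empty,
      fun i j hi hj => hUu.tag (hUu.nat hi) (hUu.nat hj), ?_, fun p q hp hq => hUu.tag hp hq,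
      fun i p hi hp => hUu.tag (hUu.nat hi) hp⟩⟩
    rintro c (⟨σ, n, t, w, h1, h2, h3, h4⟩ | ⟨σ, n, t, w, d, j, h1, h2, h3, h4, h5, h6⟩)
    · rw [isTagged_iff.1 h4]
      rw [isOmega_iff.1 h2] at h3
      exact hUu.tag (hUu.trans hR h1.1) (hUu.isFun (hUu.nat h1.2.1) hUu.omega h3)
    · rw [isTagged_iff.1 h6, isOPair_iff.1 h4]
      rw [isOmega_iff.1 h2] at h3
      exact hUu.tag (hUu.opair (hUu.trans hF h1.1) (hUu.isFun (hUu.nat h1.2.1) hUu.omega h3))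
        (hUu.nat h5)
  defP := inferInstance

theorem structVal (h : IsInner E e ι m) {f r c s : X} :
    StructVal e f r c s ↔ StructVal E (ι f) (ι r) (ι c) (ι s) := by
  have hU := h.isUniverse
  have hop : ∀ {z : X} {x y}, IsOPair E (ι z) x y → E x m ∧ E y m := fun {z x y} hz =>
    ⟨hU.opair_left (isOPair_iff.1 hz ▸ h.mem z), hU.opair_right (isOPair_iff.1 hz ▸ h.mem z)⟩
  simp only [StructVal, h.isTagged, h.isComp, h.isOPair, h.rel, h.app]
  constructor
  · rintro (⟨σ, t, t', z, h1⟩ | ⟨σ, t, d, j, t', d', y, z, h1⟩)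
    exacts [Or.inl ⟨_, _, _, _, h1⟩, Or.inr ⟨_, _, _, _, _, _, _, _, h1⟩]
  · rintro (⟨σ, t, t', z, h1, h2, h3, h4⟩ | ⟨σ, t, d, j, t', d', y, z, h1, h2, h3, h4, h5, h6, h7⟩)
    · obtain ⟨z, rfl⟩ := h.lift_mem h4
      obtain ⟨t', rfl⟩ := h.lift (hop h3).2
      obtain ⟨σ, rfl⟩ := h.lift (hop h3).1
      obtain ⟨t, rfl⟩ := h.lift (h.isTagged_mem h1).2
      exact Or.inl ⟨_, _, _, _, h1, h2, h3, h4⟩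
    · obtain ⟨z, rfl⟩ := h.lift_mem h7
      obtain ⟨d', rfl⟩ := h.lift (hop h6).1
      obtain ⟨y, rfl⟩ := h.lift (hop h6).2
      obtain ⟨t', rfl⟩ := h.lift (hop h4).2
      obtain ⟨σ, rfl⟩ := h.lift (hop h4).1
      obtain ⟨d, rfl⟩ := h.lift (h.isTagged_mem h1).1
      obtain ⟨j, rfl⟩ := h.lift (h.isTagged_mem h1).2
      obtain ⟨t, rfl⟩ := h.lift (hop h2).2
      exact Or.inr ⟨_, _, _, _, _, _, _, _, h1, h2, h3, h4, h5, h6, h7⟩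

/-- Only the passage from the model to the inner structure is needed: embeddings are found in the
model and then used inside. -/
theorem isElementaryEmbedding (h : IsInner E e ι m) {F R a f r a' f' r' j : X}
    (hj : IsElementaryEmbedding E (ι F) (ι R) (ι a) (ι f) (ι r) (ι a') (ι f') (ι r') (ι j)) :
    IsElementaryEmbedding e F R a f r a' f' r' j := by
  refine ⟨h.isFun.2 hj.1, fun p s s' hp hs hs' => ?_⟩
  have hp := (h.isFormula (h.structAtoms F R)).1 hp
  have hs := h.isAssignment.1 hs
  have hs' := h.isComp.1 hs'
  rw [h.sat (h.structAtoms F R) (fun _ _ => h.structVal) hp hs,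
    h.sat (h.structAtoms F R) (fun _ _ => h.structVal) hp
      (isAssignment_iff.2 ((isAssignment_iff.1 hs).comp hj.1 hs'))]
  exact hj.2 _ _ _ hp hs hs'

theorem codesStructure (h : IsInner E e ι m) {F R x : X} (hx : CodesStructure e F R x) :
    CodesStructure E (ι F) (ι R) (ι x) := by
  obtain ⟨a, f, r, hx⟩ := hx
  exact ⟨_, _, _, h.isStructureCode.1 hx⟩

theorem lift_structureCode (h : IsInner E e ι m) {F R x : X} {a f r : M}
    (hx : IsStructureCode E (ι F) (ι R) (ι x) a f r) :
    ∃ a' f' r', a = ι a' ∧ f = ι f' ∧ r = ι r' := by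
  obtain ⟨-, z, h1, h2⟩ := hx
  rw [isOPair_iff.1 h1] at h2
  have hm := isOPair_iff.1 h2 ▸ h.mem x
  obtain ⟨a, rfl⟩ := h.lift (h.isUniverse.opair_left hm)
  obtain ⟨f, rfl⟩ := h.lift (h.isUniverse.opair_left (h.isUniverse.opair_right hm))
  obtain ⟨r, rfl⟩ := h.lift (h.isUniverse.opair_right (h.isUniverse.opair_right hm))
  exact ⟨a, f, r, rfl, rfl, rfl⟩

theorem embeds (h : IsInner E e ι m) {F R x y : X} (hxy : Embeds E (ι F) (ι R) (ι x) (ι y)) :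
    Embeds e F R x y := by
  obtain ⟨a, f, r, a', f', r', j, hx, hy, hj⟩ := hxy
  obtain ⟨a, f, r, rfl, rfl, rfl⟩ := h.lift_structureCode hx
  obtain ⟨a', f', r', rfl, rfl, rfl⟩ := h.lift_structureCode hy
  obtain ⟨j, rfl⟩ := h.lift (h.isUniverse.isFun (h.mem a) (h.mem a') hj.1)
  exact ⟨a, f, r, a', f', r', j, h.isStructureCode.2 hx, h.isStructureCode.2 hy,
    h.isElementaryEmbedding hj⟩

end IsInner

end SetModel

namespace SetModel

variable {M : Type v} {E : M → M → Prop} [hZ : IsZFC E]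

attribute [local instance 50] DefF.rename

/-! ## Inner models of ZFC -/

namespace IsInner

variable {X : Type*} {e : X → X → Prop} {ι : X → M} {m : M}

/-- A universe satisfies ZFC if the images of its members under the relations of the replacement
scheme are bounded. -/
theorem zfcAxioms (h : IsInner E e ι m) {D₁ : Set X → Prop} {D₂ : Set (X × X) → Prop}
    (h₁ : ∀ D, D₁ D → ∃ P : M → Prop, (DefP E fun v => P (v 0)) ∧ ∀ x, x ∈ D ↔ P (ι x))
    (h₂ : ∀ D, D₂ D → ∃ P : M → M → Prop, (DefP E fun v => P (v 0) (v 1)) ∧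
      (∀ x y, (x, y) ∈ D ↔ P (ι x) (ι y)) ∧ ∀ a, E a m → (∀ x, E x a → ∃ y, E y m ∧ P x y) →
        ∃ w, E w m ∧ ∀ x, E x a → ∃ y, E y w ∧ P x y) : ZFCAxioms e D₁ D₂ where
  extensionality x y hxy := h.inj (ext E fun z => by
    constructor
    · intro hz
      obtain ⟨z, rfl⟩ := h.lift_mem hz
      exact h.rel.1 ((hxy z).1 (h.rel.2 hz))
    · intro hz
      obtain ⟨z, rfl⟩ := h.lift_mem hz
      exact h.rel.1 ((hxy z).2 (h.rel.2 hz)))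
  foundation x := by
    rintro ⟨y, hy⟩
    obtain ⟨z, hz, hmin⟩ := hZ.out.foundation (ι x) ⟨_, h.rel.1 hy⟩
    obtain ⟨z, rfl⟩ := h.lift_mem hz
    exact ⟨z, h.rel.2 hz, fun w hw hwz => hmin _ (h.rel.1 hw) (h.rel.1 hwz)⟩
  pairing x y := by
    obtain ⟨z, hz⟩ := h.lift (h.isUniverse.upair (h.mem x) (h.mem y))
    exact ⟨z, fun w => by rw [h.rel, hz, mem_upair (E := E), h.eq_iff, h.eq_iff]⟩
  union x := by
    obtain ⟨z, hz⟩ := h.lift (h.isUniverse.sUnion (h.mem x))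
    refine ⟨z, fun w => ?_⟩
    simp only [h.rel, hz, mem_sUnion]
    exact (h.exists_iff' (P := fun y => E y (ι x) ∧ E (ι w) y) fun y hy => h.mem_of_mem hy.1).symm
  powerset x := by
    obtain ⟨z, hz⟩ := h.lift (h.isUniverse.pow (h.mem x))
    refine ⟨z, fun w => ?_⟩
    rw [h.rel, hz, mem_powerset (E := E)]
    exact h.subset.symm
  infinity := by
    obtain ⟨z, hz⟩ := h.lift h.isUniverse.omega
    obtain ⟨o, ho⟩ := h.lift h.isUniverse.empty
    refine ⟨z, ⟨o, h.rel.2 ?_, fun w hw => ?_⟩, fun n hn => ?_⟩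
    · rw [ho, hz]
      exact mem_omega.2 isNat_empty
    · exact not_mem_empty _ (ho ▸ h.rel.1 hw)
    · obtain ⟨k, hk⟩ := h.lift (h.isUniverse.succ (h.mem n))
      refine ⟨k, h.rel.2 ?_, fun w => ?_⟩
      · rw [hk, hz]
        exact mem_omega.2 (mem_omega.1 (hz ▸ h.rel.1 hn)).succ
      · rw [h.rel, hk, mem_succ (E := E), h.eq_iff, h.rel]
  separation D hD a := by
    obtain ⟨P, hP, hDP⟩ := h₁ D hD
    obtain ⟨b, hb⟩ := h.lift (h.isUniverse.sub (h.mem a) (y := sep E (ι a) P)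
      fun z hz => (mem_sep.1 hz).1)
    exact ⟨b, fun x => by rw [h.rel, hb, mem_sep (E := E), hDP, h.rel]⟩
  replacement D hD a ha := by
    obtain ⟨P, hP, hDP, hbd⟩ := h₂ D hD
    have hP' := hP.comp₂
    obtain ⟨w, hw, hb⟩ := hbd (ι a) (h.mem a) fun x hx => by
      obtain ⟨x, rfl⟩ := h.lift_mem hx
      obtain ⟨y, hy, -⟩ := ha x (h.rel.2 hx)
      exact ⟨_, h.mem y, (hDP _ _).1 hy⟩
    obtain ⟨b, hb'⟩ := h.lift (h.isUniverse.sub hw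
      (y := sep E w fun y => ∃ x, E x (ι a) ∧ P x y) fun z hz => (mem_sep.1 hz).1)
    refine ⟨b, fun y => ?_⟩
    rw [h.rel, hb', mem_sep (E := E)]
    constructor
    · rintro ⟨-, x, hx, hxy⟩
      obtain ⟨x, rfl⟩ := h.lift_mem hx
      exact ⟨x, h.rel.2 hx, (hDP _ _).2 hxy⟩
    · rintro ⟨x, hx, hxy⟩
      refine ⟨?_, _, h.rel.1 hx, (hDP _ _).1 hxy⟩
      -- The bound `w` contains some value at `x`; uniqueness identifies it with `y`.
      obtain ⟨y', hy', hP'⟩ := hb _ (h.rel.1 hx)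
      obtain ⟨y', rfl⟩ := h.lift (h.isUniverse.trans hw hy')
      rwa [(ha x hx).unique hxy ((hDP _ _).2 hP')]
  choice a ha hdisj := by
    obtain ⟨c, hc⟩ := hZ.out.choice (ι a) (fun x hx => by
        obtain ⟨x, rfl⟩ := h.lift_mem hx
        obtain ⟨y, hy⟩ := ha x (h.rel.2 hx)
        exact ⟨_, h.rel.1 hy⟩) fun x y z hx hy hzx hzy => by
      obtain ⟨x, rfl⟩ := h.lift_mem hx
      obtain ⟨y, rfl⟩ := h.lift_mem hy
      obtain ⟨z, rfl⟩ := h.lift_mem hzx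
      exact congrArg ι (hdisj x y z (h.rel.2 hx) (h.rel.2 hy) (h.rel.2 hzx) (h.rel.2 hzy))
    obtain ⟨c', hc'⟩ := h.lift (h.isUniverse.sub (h.isUniverse.sUnion (h.mem a))
      (y := sep E (sUnion E (ι a)) fun z => E z c) fun z hz => (mem_sep.1 hz).1)
    refine ⟨c', fun x hx => ?_⟩
    have hcc : ∀ {y}, e y x → (e y c' ↔ E (ι y) c) := fun {y} hy => by
      rw [h.rel, hc', mem_sep (E := E), mem_sUnion (E := E)]
      exact ⟨And.right, fun h' => ⟨⟨_, h.rel.1 hx, h.rel.1 hy⟩, h'⟩⟩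
    obtain ⟨y, ⟨hy, hyc⟩, hu⟩ := hc _ (h.rel.1 hx)
    obtain ⟨y, rfl⟩ := h.lift_mem hy
    exact ⟨y, ⟨h.rel.2 hy, (hcc (h.rel.2 hy)).2 hyc⟩, fun y' ⟨hy', hyc'⟩ =>
      h.inj (hu _ ⟨h.rel.1 hy', (hcc hy').1 hyc'⟩)⟩

end IsInner

/-- The class `D` is defined over `(m, ∈)` by a formula of the model. -/
def Coded₁ {X : Type*} (E : M → M → Prop) [IsZFC E] (ι : X → M) (m : M) (D : Set X) : Prop :=
  ∃ p s, IsFormula E (MemAtom E) p ∧ IsFun E s (omega E) m ∧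
    ∀ x, x ∈ D ↔ Tr E m p (update E s (num E 0) (ι x))

/-- The binary relation `D` is defined over `(m, ∈)` by a formula of the model. -/
def Coded₂ {X : Type*} (E : M → M → Prop) [IsZFC E] (ι : X → M) (m : M) (D : Set (X × X)) : Prop :=
  ∃ p s, IsFormula E (MemAtom E) p ∧ IsFun E s (omega E) m ∧
    ∀ x y, (x, y) ∈ D ↔ Tr E m p (update E (update E s (num E 0) (ι x)) (num E 1) (ι y))

/-- In `ConSentence` membership is given by a set of pairs. It need only agree with `E` on the
domain for truth to be unchanged. -/
theorem sat_memVal_congr {m p s : M} {e : M → M → Prop} (he : ∀ x y, E x m → E y m → (e x y ↔ E x y)) :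
    Sat E (MemAtom E) (MemVal E e) m p s ↔ Tr E m p s := by
  have hval : ∀ {c s}, IsAssignment E m s → (MemVal E e c s ↔ MemVal E E c s) := fun {c s} hs => by
    have hs := isAssignment_iff.1 hs
    constructor
    · rintro ⟨i, j, x, y, h1, h2, h3, h4⟩
      exact ⟨i, j, x, y, h1, h2, h3, (he _ _ (hs.app_mem_right h2) (hs.app_mem_right h3)).1 h4⟩
    · rintro ⟨i, j, x, y, h1, h2, h3, h4⟩
      exact ⟨i, j, x, y, h1, h2, h3, (he _ _ (hs.app_mem_right h2) (hs.app_mem_right h3)).2 h4⟩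
  refine exists_congr fun S => and_congr_left fun _ => ?_
  refine forall_congr' fun s => imp_congr_right fun hs => ?_
  simp only [hval hs]

theorem InternallyDefinable₁.coded {m : M} {e : M → M → Prop}
    (he : ∀ x y, E x m → E y m → (e x y ↔ E x y)) {D : Set {x : M // E x m}}
    (hD : InternallyDefinable₁ E m e D) : Coded₁ E (fun x : {x : M // E x m} => x.1) m D := by
  obtain ⟨p, s, i, hp, hs, hi, hD⟩ := hD
  rw [isNumeral_iff] at hi
  subst hi
  rw [isAssignment_iff] at hs
  refine ⟨p, s, hp, hs, fun x => (hD x).trans ?_⟩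
  simp only [isUpdate_iff hs x.2 (isNat_num 0), exists_eq_left, sat_memVal_congr he]

theorem InternallyDefinable₂.coded {m : M} {e : M → M → Prop}
    (he : ∀ x y, E x m → E y m → (e x y ↔ E x y)) {D : Set ({x : M // E x m} × {x : M // E x m})}
    (hD : InternallyDefinable₂ E m e D) : Coded₂ E (fun x : {x : M // E x m} => x.1) m D := by
  obtain ⟨p, s, i, j, hp, hs, hi, hj, hD⟩ := hD
  rw [isNumeral_iff] at hi hj
  subst hi hj
  rw [isAssignment_iff] at hs
  refine ⟨p, s, hp, hs, fun x y => (hD x y).trans ?_⟩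
  simp only [isUpdate_iff hs x.2 (isNat_num 0), exists_and_left, exists_eq_left,
    isUpdate_iff (isFun_update hs x.2) y.2 (isNat_num 1), sat_memVal_congr he]

variable {δ f γ : M} {X : Type*} {e : X → X → Prop} {ι : X → M}

/-- The Tarski–Vaught argument: on assignments in `V_γ`, truth in `V_δ` obeys the Tarski clauses of
`V_γ`, where `witness` supplies the universal quantifier. Uniqueness of truth does the rest. -/
theorem Reflects.tr_iff (h : Hierarchy E δ f) (hr : Reflects E δ f γ) {p s : M}
    (hp : IsFormula E (MemAtom E) p) (hs : IsFun E s (SetModel.omega E) (app E f γ)) :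
    Tr E (app E f γ) p s ↔ Tr E (app E f δ) p s := by
  have hγ := h.mem_succ hr.mem
  have hU := h.isUniverse_top
  have hm : ∀ {x}, E x (app E f γ) → E x (app E f δ) := fun hx =>
    h.mono hγ h.self_mem (h.isOrd.1 _ hr.mem) _ hx
  have hm' : ∀ {s}, IsFun E s (SetModel.omega E) (app E f γ) → IsFun E s (SetModel.omega E) (app E f δ) := fun hs =>
    hs.mono fun x hx => hm (hs.app_mem hx)
  have hT := isTruth_tr hU (app E f δ)
  refine (isTruth_tr hU (app E f γ)).unique (T' := Tr E (app E f δ)) hU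
    ⟨fun hs => hT.falsum (hm' hs), fun hs => hT.eq (hm' hs), fun hs => hT.mem (hm' hs),
      fun hs => hT.imp (hm' hs), fun {s i p} hs hi hp => ?_⟩ hp hs
  rw [hT.all (hm' hs) hi hp]
  refine ⟨fun H x hx => H x (hm hx), fun H x hx => ?_⟩
  by_contra hn
  obtain ⟨y, hy, hn⟩ := hr.witness hp hs hi hx hn
  exact hn (H y hy)

theorem Hierarchy.isInner (h : Hierarchy E δ f) (inj : ∀ {x y}, ι x = ι y → x = y)
    (rel : ∀ {x y}, e x y ↔ E (ι x) (ι y)) (mem : ∀ x, E (ι x) (app E f δ))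
    (lift : ∀ {y}, E y (app E f δ) → ∃ x, ι x = y) : IsInner E e ι (app E f δ) := by
  refine ⟨inj, rel, mem, lift, h.isUniverse_top, fun {y} hy => ?_⟩
  obtain ⟨ξ, hξ, hy⟩ := (h.mem_iff h.self_mem).1 hy
  obtain ⟨l, hl, hξl, hω, hlim⟩ := h.inacc.exists_limit hξ
  exact ⟨_, h.level_mem h.self_mem hl, h.isUniverse (h.mem_succ hl) hω hlim,
    (h.mem_iff (h.mem_succ hl)).2 ⟨ξ, hξl, hy⟩⟩

theorem Reflects.isInner (h : Hierarchy E δ f) (hr : Reflects E δ f γ)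
    (inj : ∀ {x y}, ι x = ι y → x = y) (rel : ∀ {x y}, e x y ↔ E (ι x) (ι y))
    (mem : ∀ x, E (ι x) (SetModel.app E f γ))
    (lift : ∀ {y}, E y (SetModel.app E f γ) → ∃ x, ι x = y) :
    IsInner E e ι (SetModel.app E f γ) := by
  have hγ := h.mem_succ hr.mem
  refine ⟨inj, rel, mem, lift, h.isUniverse hγ hr.omega hr.limit, fun {y} hy => ?_⟩
  obtain ⟨ξ, hξ, hy⟩ := (h.mem_iff hγ).1 hy
  obtain ⟨l, hl, hξl, hω, hlim⟩ := hr.exists_limit ξ hξ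
  have hl' := h.mem_succ (h.trans hγ hl)
  exact ⟨_, h.level_mem hγ hl, h.isUniverse hl' hω hlim, (h.mem_iff hl').2 ⟨ξ, hξl, hy⟩⟩

/-- `V_δ` satisfies ZFC if `δ` is inaccessible. -/
theorem Hierarchy.zfcAxioms (h : Hierarchy E δ f) (hI : IsInner E e ι (app E f δ))
    {D₁ : Set X → Prop} {D₂ : Set (X × X) → Prop} (h₁ : ∀ D, D₁ D → Coded₁ E ι (app E f δ) D)
    (h₂ : ∀ D, D₂ D → Coded₂ E ι (app E f δ) D) : ZFCAxioms e D₁ D₂ := by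
  refine hI.zfcAxioms (fun D hD => ?_) fun D hD => ?_
  · obtain ⟨p, s, -, -, hps⟩ := h₁ D hD
    exact ⟨fun x => Tr E (app E f δ) p (update E s (num E 0) x), inferInstance, hps⟩
  · obtain ⟨p, s, -, -, hps⟩ := h₂ D hD
    have hP : DefP E fun v =>
      Tr E (app E f δ) p (update E (update E s (num E 0) (v 0)) (num E 1) (v 1)) := inferInstance
    refine ⟨fun x y => Tr E (app E f δ) p (update E (update E s (num E 0) x) (num E 1) y), hP, hps,
      fun a ha hy => ?_⟩
    have hP' := hP.comp₂
      (R := fun x y => Tr E (app E f δ) p (update E (update E s (num E 0) x) (num E 1) y))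
    obtain ⟨μ, hμ, hb⟩ := (h.sizeLT ha).exists_uniform h.inacc
      (fun x ξ => E ξ δ ∧ ∃ y, E y (app E f ξ) ∧
        Tr E (app E f δ) p (update E (update E s (num E 0) x) (num E 1) y))
      fun x ξ ξ' _ hξ' hs ⟨hξ, y, hy, ht⟩ =>
        ⟨hξ', y, h.mono (h.mem_succ hξ) (h.mem_succ hξ') hs _ hy, ht⟩
    refine ⟨_, h.level_mem h.self_mem hμ, fun x hx => (hb x hx ?_).2⟩
    obtain ⟨y, hy, ht⟩ := hy x hx
    obtain ⟨ξ, hξ, hyξ⟩ := (h.mem_iff h.self_mem).1 hy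
    have hξ' := h.inacc.succ_mem hξ
    exact ⟨_, hξ', hξ', y, (h.mem_iff (h.mem_succ hξ')).2 ⟨ξ, by simp, hyξ⟩, ht⟩

/-- By elementarity the relation may be evaluated in `V_δ` instead of `V_γ`, and for that version
`bound` gives replacement. -/
theorem Reflects.zfcAxioms (h : Hierarchy E δ f) (hr : Reflects E δ f γ)
    (hI : IsInner E e ι (app E f γ))
    {D₁ : Set X → Prop} {D₂ : Set (X × X) → Prop} (h₁ : ∀ D, D₁ D → Coded₁ E ι (app E f γ) D)
    (h₂ : ∀ D, D₂ D → Coded₂ E ι (app E f γ) D) : ZFCAxioms e D₁ D₂ := by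
  refine hI.zfcAxioms (fun D hD => ?_) fun D hD => ?_
  · obtain ⟨p, s, -, -, hps⟩ := h₁ D hD
    exact ⟨fun x => Tr E (SetModel.app E f γ) p (update E s (num E 0) x), inferInstance, hps⟩
  · obtain ⟨p, s, hp, hs, hps⟩ := h₂ D hD
    refine ⟨fun x y => Tr E (SetModel.app E f δ) p (update E (update E s (num E 0) x) (num E 1) y),
      inferInstance, fun x y => ?_, fun a ha hy => hr.bound hp hs ha hy⟩
    rw [hps, hr.tr_iff h hp (isFun_update (isFun_update hs (hI.mem x)) (hI.mem y))]

/-- By elementarity `D` is the trace on `V_γ` of the class that the same formula defines over `V_δ`.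
A bound for that class would reflect below `γ` and make `D` a set. So the class is unbounded, the
Vopěnka property gives an embedded pair in `V_δ`, and `embeds` replaces it by a pair in `V_γ`. -/
theorem Reflects.vopenkaScheme (h : Hierarchy E δ f) (hV : VopenkaProperty E δ (app E f δ))
    (hr : Reflects E δ f γ) (hI : IsInner E e ι (app E f γ)) {D₁ : Set X → Prop}
    (h₁ : ∀ D, D₁ D → Coded₁ E ι (app E f γ) D) : VopenkaScheme e D₁ := by
  intro F R D hD hprop hstr
  obtain ⟨p, s, hp, hs, hps⟩ := h₁ D hD
  have hm : ∀ {x}, E x (SetModel.app E f γ) → E x (SetModel.app E f δ) := fun hx =>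
    h.mono (h.mem_succ hr.mem) h.self_mem (h.isOrd.1 _ hr.mem) _ hx
  have hDC : ∀ x, x ∈ D ↔ InStructureClass E (SetModel.app E f δ) p s (ι F) (ι R) (ι x) :=
    fun x => by
      have he : x ∈ D ↔ Tr E (SetModel.app E f δ) p (update E s (num E 0) (ι x)) := by
        rw [hps, hr.tr_iff h hp (isFun_update hs (hI.mem x))]
      exact ⟨fun hx => ⟨hm (hI.mem x), he.1 hx, hI.codesStructure (hstr x hx)⟩,
        fun hx => he.2 hx.2.1⟩
  have hunb : ¬ ∃ ξ, E ξ δ ∧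
      ∀ x, InStructureClass E (SetModel.app E f δ) p s (ι F) (ι R) x → E x (SetModel.app E f ξ) := by
    rintro ⟨ξ, hξ, hb⟩
    obtain ⟨w, hw, hb⟩ := hr.unbounded hp hs (hI.mem F) (hI.mem R) hξ hb
    obtain ⟨c, hc⟩ := hI.lift (hI.isUniverse.sub hw (y := sep E w
      fun x => InStructureClass E (SetModel.app E f δ) p s (ι F) (ι R) x)
        fun z hz => (mem_sep.1 hz).1)
    refine hprop ⟨c, fun x => ?_⟩
    rw [hI.rel, hc, mem_sep (E := E), hDC]
    exact ⟨And.right, fun hx => ⟨hb _ hx, hx⟩⟩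
  obtain ⟨x, y, hx, hy, hxy, he⟩ := h.hasElementaryEmbedding hV (hm (hI.mem F)) (hm (hI.mem R))
    (fun x => InStructureClass E (SetModel.app E f δ) p s (ι F) (ι R) x) (fun x hx => hx.1)
    (fun x hx => hx.2.2) hunb
  obtain ⟨x, y, hxγ, hyγ, hx, hy, hxy, he⟩ :=
    hr.embeds hp hs (hI.mem F) (hI.mem R) hx hy hxy he
  obtain ⟨x, rfl⟩ := hI.lift hxγ
  obtain ⟨y, rfl⟩ := hI.lift hyγ
  exact ⟨x, y, (hDC x).2 hx, (hDC y).2 hy, fun h => hxy (h ▸ rfl), hI.embeds he⟩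

/-- A Vopěnka cardinal yields a Vopěnka-scheme cardinal. -/
theorem Reflects.isVopenkaSchemeCardinal (h : Hierarchy E δ f)
    (hV : VopenkaProperty E δ (app E f δ)) (hr : Reflects E δ f γ) :
    IsVopenkaSchemeCardinal E γ := by
  have hI : IsInner E (restrict E (SetModel.app E f γ) E) (fun x => x.1) (SetModel.app E f γ) :=
    hr.isInner h Subtype.ext Iff.rfl (fun x => x.2) fun hy => ⟨⟨_, hy⟩, rfl⟩
  exact ⟨h.isOrd.mem hr.mem, _, h.isRank (h.mem_succ hr.mem),
    hr.zfcAxioms h hI (fun D hD => hD.coded fun _ _ _ _ => Iff.rfl)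
      fun D hD => hD.coded fun _ _ _ _ => Iff.rfl,
    hr.vopenkaScheme h hV hI fun D hD => hD.coded fun _ _ _ _ => Iff.rfl⟩

/-- A Vopěnka-scheme cardinal below `δ` found by reflection is one in the sense of `V_δ`. -/
theorem Reflects.isVopenkaSchemeCardinal_inner (h : Hierarchy E δ f)
    (hV : VopenkaProperty E δ (app E f δ)) (hr : Reflects E δ f γ)
    (hI : IsInner E e ι (app E f δ)) : ∃ γ', IsVopenkaSchemeCardinal e γ' := by
  have hγ := h.mem_succ hr.mem
  have hU := hI.isUniverse
  obtain ⟨γ', rfl⟩ := hI.lift (h.ord_mem h.self_mem hr.mem)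
  obtain ⟨v, hv⟩ := hI.lift (h.level_mem h.self_mem hr.mem)
  have hs : ∀ {β}, E β (succ E (ι γ')) → E β δ := fun {β} hβ => by
    rcases SetModel.mem_succ.1 hβ with hβ | rfl
    exacts [h.trans hγ hβ, hr.mem]
  have hγδ := h.inacc.succ_mem hr.mem
  -- The initial segment of the hierarchy up to `γ` is an element of `V_δ`, and certifies there that
  -- `v` is the level `γ`.
  obtain ⟨g, hg⟩ := hI.lift (y := lam E (succ E (ι γ')) fun β => SetModel.app E f β)
    (hU.isFun (h.ord_mem h.self_mem hγδ) (h.level_mem h.self_mem hγδ) (isFun_lam fun β hβ => by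
      refine (h.mem_iff (h.mem_succ hγδ)).2 ⟨ι γ', by simp, h.mono (h.mem_succ (hs hβ)) hγ ?_⟩
      rcases SetModel.mem_succ.1 hβ with hβ | rfl
      exacts [(h.ord hγ).1 _ hβ, Subset.refl _]))
  obtain ⟨s, hs'⟩ := hI.lift (hU.succ (h.ord_mem h.self_mem hr.mem))
  have hga : ∀ {β y}, App E (ι g) β y ↔ E β (succ E (ι γ')) ∧ y = SetModel.app E f β := by
    intro β y
    rw [hg, app_lam]
  have hrank : IsRank e v γ' := by
    refine ⟨g, s, ?_, fun β hβ => ?_, fun β y hβ hy x => ?_, ?_⟩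
    · rw [hI.isSucc, hs']
      exact isSucc_iff.2 rfl
    · have hβ := hs' ▸ hI.rel.1 hβ
      obtain ⟨y, hy⟩ := hI.lift (h.level_mem h.self_mem (hs hβ))
      refine ⟨y, hI.app.2 (hga.2 ⟨hβ, hy⟩), fun y' hy' => hI.inj ?_⟩
      rw [(hga.1 (hI.app.1 hy')).2, hy]
    · have hβ := hs' ▸ hI.rel.1 hβ
      have hβo := h.mem_succ (hs hβ)
      have hy := (hga.1 (hI.app.1 hy)).2
      rw [hI.rel, hy, h.mem_iff hβo]
      have hββ : ∀ {ξ}, E ξ (ι β) → E ξ (succ E (ι γ')) := fun hξ => by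
        rcases SetModel.mem_succ.1 hβ with hβ | hβ
        · exact SetModel.mem_succ.2 (Or.inl ((h.ord hγ).mem_trans hβ hξ))
        · exact SetModel.mem_succ.2 (Or.inl (hβ ▸ hξ))
      constructor
      · rintro ⟨ξ, hξ, hx⟩
        obtain ⟨ξ, rfl⟩ := hI.lift_mem hξ
        obtain ⟨w, hw⟩ := hI.lift (h.level_mem h.self_mem (h.trans hβo hξ))
        exact ⟨ξ, w, hI.rel.2 hξ, hI.app.2 (hga.2 ⟨hββ hξ, hw⟩), hI.subset.2 (hw ▸ hx)⟩
      · rintro ⟨ξ, w, hξ, hw, hx⟩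
        exact ⟨ι ξ, hI.rel.1 hξ, (hga.1 (hI.app.1 hw)).2 ▸ hI.subset.1 hx⟩
    · exact hI.app.2 (hga.2 ⟨by simp, hv⟩)
  -- The level `γ` as computed inside `V_δ` is inner in the original model as well, so the results
  -- on reflecting ordinals apply to it directly.
  have hI' : IsInner E (restrict e v e) (fun x => ι x.1) (SetModel.app E f (ι γ')) := by
    refine hr.isInner h (fun h => Subtype.ext (hI.inj h)) hI.rel (fun x => hv ▸ hI.rel.1 x.2)
      fun {y} hy => ?_
    obtain ⟨y, rfl⟩ := hI.lift_mem (x := v) (hv ▸ hy)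
    exact ⟨⟨y, hI.rel.2 (hv ▸ hy)⟩, rfl⟩
  have hsat : ∀ {p s : X}, IsFormula e (MemAtom e) p → IsFun E (ι s) (SetModel.omega E) (ι v) →
      (Sat e (MemAtom e) (MemVal e e) v p s ↔ Tr E (ι v) (ι p) (ι s)) := fun hp hs =>
    hI.sat hI.memAtoms (fun _ _ => hI.memVal) ((hI.isFormula hI.memAtoms).1 hp)
      (isAssignment_iff.2 hs)
  have hup : ∀ {s i x s' : X}, IsFun E (ι s) (SetModel.omega E) (ι v) → IsNat E (ι i) → e x v →
      (IsUpdate e v s i x s' ↔ ι s' = update E (ι s) (ι i) (ι x)) := fun hs hi hx => by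
    rw [hI.isUpdate, isUpdate_iff hs (hI.rel.1 hx) hi]
  have hlift : ∀ {s i x}, IsFun E (ι s) (SetModel.omega E) (ι v) → e x v →
      ∃ s', ι s' = update E (ι s) i (ι x) ∧ IsFun E (ι s') (SetModel.omega E) (ι v) :=
    fun {s i x} hs hx => by
      have hf := isFun_update (i := i) hs (hI.rel.1 hx)
      obtain ⟨s', hs'⟩ := hI.lift (hU.isFun hU.omega (hI.mem v) hf)
      exact ⟨s', hs', hs' ▸ hf⟩
  -- By absoluteness of satisfaction, what `V_δ` considers definable over `v` is coded by a formula
  -- of the model.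
  have h₁ : ∀ D, InternallyDefinable₁ e v e D →
      Coded₁ E (fun x : {x // e x v} => ι x.1) (SetModel.app E f (ι γ')) D := by
    rintro D ⟨p, s, i, hp, hs, hi, hD⟩
    rw [hI.isAssignment, isAssignment_iff] at hs
    rw [hI.isNumeral, isNumeral_iff] at hi
    refine ⟨ι p, ι s, (hI.isFormula hI.memAtoms).1 hp, hv ▸ hs, fun x => ?_⟩
    rw [hD, ← hv, ← hi]
    obtain ⟨s', hs', hf⟩ := hlift (i := ι i) hs x.2
    simp only [hup hs (hi ▸ isNat_num 0) x.2]
    constructor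
    · rintro ⟨s'', he, ht⟩
      rw [← he]
      obtain rfl := hI.inj (he.trans hs'.symm)
      exact (hsat hp hf).1 ht
    · exact fun ht => ⟨s', hs', (hsat hp hf).2 (hs' ▸ ht)⟩
  have h₂ : ∀ D, InternallyDefinable₂ e v e D →
      Coded₂ E (fun x : {x // e x v} => ι x.1) (SetModel.app E f (ι γ')) D := by
    rintro D ⟨p, s, i, j, hp, hs, hi, hj, hD⟩
    rw [hI.isAssignment, isAssignment_iff] at hs
    rw [hI.isNumeral, isNumeral_iff] at hi hj
    refine ⟨ι p, ι s, (hI.isFormula hI.memAtoms).1 hp, hv ▸ hs, fun x y => ?_⟩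
    rw [hD, ← hv, ← hi, ← hj]
    obtain ⟨s', hs', hf⟩ := hlift (i := ι i) hs x.2
    obtain ⟨s'', hs'', hf'⟩ := hlift (i := ι j) hf y.2
    constructor
    · rintro ⟨t', t'', he, he', ht⟩
      rw [hup hs (hi ▸ isNat_num 0) x.2] at he
      obtain rfl := hI.inj (he.trans hs'.symm)
      rw [hup hf (hj ▸ isNat_num 1) y.2] at he'
      obtain rfl := hI.inj (he'.trans hs''.symm)
      rw [← hs', ← hs'']
      exact (hsat hp hf').1 ht
    · rw [← hs', ← hs'']
      exact fun ht => ⟨s', s'', (hup hs (hi ▸ isNat_num 0) x.2).2 hs',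
        (hup hf (hj ▸ isNat_num 1) y.2).2 hs'', (hsat hp hf').2 ht⟩
  exact ⟨γ', hI.isOrd.2 (h.isOrd.mem hr.mem), v, hrank, hr.zfcAxioms h hI' h₁ h₂,
    hr.vopenkaScheme h hV hI' h₁⟩

end SetModel

/-! ### The consistency statements -/

theorem existsVopenkaSchemeCardinal_of_existsVopenkaCardinal {M : Type v} {E : M → M → Prop}
    (hM : ModelsZFC E) (h : ExistsVopenkaCardinal M E) : ExistsVopenkaSchemeCardinal M E := by
  have : SetModel.IsZFC E := ⟨hM⟩
  obtain ⟨δ, hδ, w, hw, hV⟩ := h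
  obtain ⟨f, hf, rfl⟩ := hw.exists_hierarchy hδ
  obtain ⟨γ, hγ⟩ := hf.exists_reflects
  exact ⟨γ, hγ.isVopenkaSchemeCardinal hf hV⟩

/-- The set model is `V_δ`, with its membership relation collected into the set `r` of pairs. It
satisfies ZFC since `δ` is inaccessible, and a reflecting `γ` is a Vopěnka-scheme cardinal in its
sense. -/
theorem conSentence_of_existsVopenkaCardinal {M : Type v} {E : M → M → Prop}
    (hM : ModelsZFC E) (h : ExistsVopenkaCardinal M E) :
    ConSentence ExistsVopenkaSchemeCardinal M E := by
  have : SetModel.IsZFC E := ⟨hM⟩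
  obtain ⟨δ, hδ, w, hw, hV⟩ := h
  obtain ⟨f, hf, rfl⟩ := hw.exists_hierarchy hδ
  obtain ⟨γ, hγ⟩ := hf.exists_reflects
  let m := SetModel.app E f δ
  obtain ⟨r, hr⟩ := SetModel.isSet_sep E (SetModel.prod E m m)
    fun z => ∃ x y, z = SetModel.opair E x y ∧ E x y
  have hrel : ∀ x y, E x m → E y m → (SetModel.App E r x y ↔ E x y) := fun x y hx hy => by
    rw [SetModel.app_iff, hr]
    constructor
    · rintro ⟨-, x', y', h1, h2⟩
      obtain ⟨rfl, rfl⟩ := SetModel.opair_inj.1 h1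
      exact h2
    · exact fun h => ⟨SetModel.mem_prod.2 ⟨x, y, hx, hy, rfl⟩, x, y, rfl, h⟩
  have hI : SetModel.IsInner E (SetModel.restrict E m (SetModel.App E r)) (fun x => x.1) m :=
    hf.isInner Subtype.ext (fun {x y} => hrel _ _ x.2 y.2) (fun x => x.2)
      fun hy => ⟨⟨_, hy⟩, rfl⟩
  exact ⟨m, r, hf.zfcAxioms hI (fun D hD => hD.coded hrel) fun D hD => hD.coded hrel,
    hγ.isVopenkaSchemeCardinal_inner hf hV hI⟩

/-! ## Closed unbounded sets below an inaccessible cardinal -/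

namespace VopenkaCardinal

open Cardinal ZFSet

/-- Regularity of `δ`. The index types live one universe higher because families are indexed by sets
of type `ZFSet` or `Ordinal`, hence the lifts. -/
theorem exists_bound {δ : Cardinal.{u}} (hδ : δ.IsInaccessible) {ι : Type (u + 1)}
    (hι : #ι < lift.{u + 1} δ) (f : ι → Ordinal.{u}) (hf : ∀ i, f i < δ.ord) :
    ∃ μ < δ.ord, ∀ i, f i ≤ μ := by
  refine ⟨⨆ i, f i, Ordinal.lift_iSup_lt_of_lt_cof ?_ hf, fun i => ?_⟩
  · rw [← Ordinal.lift_cof, hδ.isRegular.cof_ord]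
    exact (lift_id'.{u, u + 1} #ι).symm ▸ hι
  · exact le_ciSup (f := f) ⟨δ.ord, by rintro _ ⟨i, rfl⟩; exact (hf i).le⟩ i

theorem mk_Iio_lt {δ : Cardinal.{u}} {o : Ordinal.{u}} (ho : o < δ.ord) :
    #(Set.Iio o) < lift.{u + 1} δ := by
  rw [mk_Iio_ordinal, lift_lt]
  exact lt_ord.1 ho

/-- Closed, since an ordinal below a supremum is below an earlier closure point. Unbounded, since
`ω` many steps of bounding `H` on initial segments reach a closure point, which is below `δ` by
regularity and uncountability. -/
theorem isClub_closurePoints {δ : Cardinal.{u}} (hδ : δ.IsInaccessible)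
    (H : Ordinal.{u} → Ordinal.{u}) (hH : ∀ ξ < δ.ord, H ξ < δ.ord) {ζ : Ordinal.{u}}
    (hζ : ζ < δ.ord) :
    IsClub {α : Set.Iio δ.ord | ζ < α.1 ∧ ∀ ξ < α.1, H ξ < α.1} := by
  constructor
  · intro t ht ⟨a, ha⟩ _ x hx
    refine ⟨(ht ha).1.trans_le (hx.1 ha), fun ξ hξ => ?_⟩
    obtain ⟨b, hb, hlt⟩ := (lt_isLUB_iff hx).1 (show (⟨ξ, hξ.trans x.2⟩ : Set.Iio δ.ord) < x from hξ)
    exact ((ht hb).2 ξ hlt).trans_le (hx.1 hb)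
  · rintro ⟨α, hα⟩
    have hlim := isSuccLimit_ord hδ.aleph0_lt.le
    have step : ∀ o : Set.Iio δ.ord, ∃ μ : Set.Iio δ.ord, o < μ ∧ ∀ ξ ≤ o.1, H ξ < μ := by
      rintro ⟨o, ho⟩
      have ho' := hlim.succ_lt ho
      obtain ⟨μ, hμ, hb⟩ := exists_bound hδ (mk_Iio_lt ho') (fun ξ => H ξ.1)
        fun ξ => hH _ (ξ.2.trans ho')
      refine ⟨⟨max (Order.succ o) (Order.succ μ), max_lt ho' (hlim.succ_lt hμ)⟩,
        (Order.lt_succ o).trans_le (le_max_left _ _), fun ξ hξ => ?_⟩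
      exact (hb ⟨ξ, Order.lt_succ_of_le hξ⟩).trans_lt
        ((Order.lt_succ μ).trans_le (le_max_right _ _))
    choose g hg hgH using step
    let s : ℕ → Set.Iio δ.ord := fun n => g^[n] (max ⟨ζ, hζ⟩ ⟨α, hα⟩)
    have hs : ∀ n, s (n + 1) = g (s n) := fun n => Function.iterate_succ_apply' _ _ _
    obtain ⟨μ, hμ, hb⟩ := exists_bound hδ (ι := ULift ℕ)
      (by simpa using hδ.aleph0_lt) (fun n => (s n.down).1) fun n => (s n.down).2
    have hbdd : BddAbove (Set.range fun n => (s n).1) := ⟨μ, by rintro _ ⟨n, rfl⟩; exact hb ⟨n⟩⟩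
    have hlt : ∀ n, (s n).1 < ⨆ n, (s n).1 := fun n =>
      (show (s n).1 < (s (n + 1)).1 by rw [hs]; exact hg _).trans_le
        (le_ciSup (f := fun n => (s n).1) hbdd (n + 1))
    have h0 : max ζ α < ⨆ n, (s n).1 := by
      refine lt_of_le_of_lt (max_le ?_ ?_) (hlt 0)
      exacts [show (⟨ζ, hζ⟩ : Set.Iio δ.ord) ≤ s 0 from le_max_left _ _,
        show (⟨α, hα⟩ : Set.Iio δ.ord) ≤ s 0 from le_max_right _ _]
    refine ⟨⟨⨆ n, (s n).1, (ciSup_le fun n => hb ⟨n⟩).trans_lt hμ⟩,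
      ⟨(le_max_left ζ α).trans_lt h0, fun ξ hξ => ?_⟩, ((le_max_right ζ α).trans_lt h0).le⟩
    · obtain ⟨n, hn⟩ := (lt_ciSup_iff hbdd).1 hξ
      refine (hgH _ _ hn.le).trans ?_
      rw [← hs]
      exact hlt _

/-- The side condition of `IsClub.inter`. -/
theorem cof_Iio_ne {δ : Cardinal.{u}} (hδ : δ.IsInaccessible) :
    Order.cof (Set.Iio δ.ord) ≠ ℵ₀ := by
  rw [Ordinal.cof_Iio, ← Ordinal.lift_cof, hδ.isRegular.cof_ord]
  have : ℵ₀ < lift.{u + 1} δ := by simpa using hδ.aleph0_lt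
  exact this.ne'

theorem card_lt_of_mem {δ : Cardinal.{u}} (hδ : δ.IsInaccessible) {x : ZFSet.{u}}
    (hx : x ∈ V_ δ.ord) : x.card < δ := by
  obtain ⟨o, ho, hxo⟩ := mem_vonNeumann'.1 hx
  refine (card_mono hxo).trans_lt ?_
  rw [card_vonNeumann, ← hδ.preBeth_ord]
  exact preBeth_strictMono ho

theorem mem_of_card_lt {δ : Cardinal.{u}} (hδ : δ.IsInaccessible) {x : ZFSet.{u}}
    (hx : x ⊆ V_ δ.ord) (hc : x.card < δ) : x ∈ V_ δ.ord := by
  have hι : #x < lift.{u + 1} δ := by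
    rw [cardinalMk_coe_sort, lift_lt]
    exact hc
  obtain ⟨μ, hμ, hb⟩ := exists_bound hδ hι (fun y => rank y.1) fun y => mem_vonNeumann.1 (hx y.2)
  rw [mem_vonNeumann]
  refine (rank_le_iff.2 fun y hy => ?_).trans_lt ((isSuccLimit_ord hδ.aleph0_lt.le).succ_lt hμ)
  exact Order.lt_succ_of_le (hb ⟨y, hy⟩)

/-- The elements of `V_δ`. -/
abbrev Level (α : Ordinal.{u}) : Type (u + 1) := {x : ZFSet.{u} // x ∈ V_ α}

theorem mk_level_lt {δ : Cardinal.{u}} (hδ : δ.IsInaccessible) {α : Ordinal.{u}} (hα : α < δ.ord) :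
    #(Level α) < lift.{u + 1} δ := by
  have h := card_lt_of_mem hδ (vonNeumann_mem_of_lt hα)
  rw [← lift_lt.{u, u + 1}, ← cardinalMk_coe_sort] at h
  exact h

theorem exists_level_of_list {α : Ordinal.{u}} (hα : Order.IsSuccLimit α) (l : List ZFSet.{u})
    (hl : ∀ x ∈ l, x ∈ V_ α) : ∃ β < α, ∀ x ∈ l, x ∈ V_ β := by
  induction l with
  | nil => exact ⟨0, hα.bot_lt, by simp⟩
  | cons x l ih =>
    obtain ⟨β, hβ, hb⟩ := ih fun y hy => hl y (List.mem_cons_of_mem _ hy)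
    have hx := mem_vonNeumann.1 (hl x List.mem_cons_self)
    refine ⟨max β (Order.succ (rank x)), max_lt hβ (hα.succ_lt hx), fun y hy => ?_⟩
    rcases List.mem_cons.1 hy with rfl | hy
    · exact mem_vonNeumann.2 ((Order.lt_succ _).trans_le (le_max_right _ _))
    · exact vonNeumann_subset_of_le (le_max_left _ _) (hb y hy)

/-- There is a club of strong limit cardinals at which countably many conditions on ordinals, with
parameters from a level of the hierarchy, reflect. -/
theorem exists_club {δ : Cardinal.{u}} (hδ : δ.IsInaccessible) {ι : Type*} [Countable ι]
    (Φ : ι → List (Level δ.ord) → Ordinal.{u} → Prop) :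
    ∃ C : Set (Set.Iio δ.ord), IsClub C ∧ ∀ α ∈ C, ∃ γ : Cardinal.{u}, γ.ord = α.1 ∧ ℵ₀ < γ ∧
      γ.IsStrongLimit ∧ ∀ i l, (∀ x ∈ l, x.1 ∈ V_ α.1) →
        (∃ ξ < δ.ord, Φ i l ξ) → ∃ ξ < α.1, Φ i l ξ := by
  classical
  -- Some ordinal at which the condition holds, or 0 where the condition never holds.
  let F : ι → List (Level δ.ord) → Ordinal.{u} := fun i l =>
    if h : ∃ ξ < δ.ord, Φ i l ξ then h.choose else 0
  have h0 : 0 < δ.ord := (isSuccLimit_ord hδ.aleph0_lt.le).bot_lt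
  have hF : ∀ i l, F i l < δ.ord := fun i l => by
    simp only [F]
    split_ifs with h
    exacts [h.choose_spec.1, h0]
  have hFΦ : ∀ i l, (∃ ξ < δ.ord, Φ i l ξ) → Φ i l (F i l) := fun i l h => by
    simp only [F, dif_pos h]
    exact h.choose_spec.2
  -- There are fewer than `δ` parameter lists from `V_β`, so their witnesses are bounded. Exceeding
  -- the cardinality of `V_β` as well makes the closure points strong limit cardinals.
  have step : ∀ β, ∃ μ, β < δ.ord → μ < δ.ord ∧ β < μ ∧ (V_ β).card.ord < μ ∧
      ∀ i l, (∀ x ∈ l, x.1 ∈ V_ β) → F i l < μ := by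
    intro β
    by_cases hβ : β < δ.ord
    swap
    · exact ⟨0, fun h => absurd h hβ⟩
    have hincl : ∀ x : Level β, x.1 ∈ V_ δ.ord := fun x => vonNeumann_subset_of_le hβ.le x.2
    have hL : #(List (Level β)) < lift.{u + 1} δ := by
      refine (mk_list_le_max _).trans_lt (max_lt ?_ (mk_level_lt hδ hβ))
      simpa using hδ.aleph0_lt
    obtain ⟨e, he⟩ := exists_injective_nat ι
    let up : Level β → Level δ.ord := fun x => ⟨x.1, hincl x⟩
    -- The index type may live in any universe. The bound is taken for each value of an injection
    -- into `ℕ`, and then over `ℕ`.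
    have hfib : ∀ n : ℕ, ∃ μ < δ.ord, ∀ l : List (Level β), ∀ i, e i = n →
        F i (l.map up) ≤ μ := by
      intro n
      by_cases hn : ∃ i, e i = n
      · obtain ⟨i, rfl⟩ := hn
        obtain ⟨μ, hμ, hb⟩ := exists_bound hδ hL
          (fun l : List (Level β) => F i (l.map up))
            fun l => hF _ _
        exact ⟨μ, hμ, fun l j hj => he hj ▸ hb l⟩
      · exact ⟨0, h0, fun l i hi => absurd ⟨i, hi⟩ hn⟩
    choose m hm hmb using hfib
    obtain ⟨μ, hμ, hb⟩ := exists_bound hδ (ι := ULift ℕ) (by simpa using hδ.aleph0_lt)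
      (fun n => m n.down) fun n => hm _
    have hc : (V_ β).card.ord < δ.ord := by
      rw [ord_lt_ord]
      exact card_lt_of_mem hδ (vonNeumann_mem_of_lt hβ)
    refine ⟨Order.succ (max β (max (V_ β).card.ord μ)), fun _ =>
      ⟨(isSuccLimit_ord hδ.aleph0_lt.le).succ_lt (max_lt hβ (max_lt hc hμ)),
        Order.lt_succ_of_le (le_max_left _ _),
        Order.lt_succ_of_le ((le_max_left _ _).trans (le_max_right _ _)), fun i l hl => ?_⟩⟩
    refine Order.lt_succ_of_le (le_trans ?_ ((le_max_right _ _).trans (le_max_right _ _)))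
    have := hmb (e i) (l.attach.map fun x => ⟨x.1.1, hl x.1 x.2⟩) i rfl
    rw [List.map_map] at this
    have hid : l.attach.map (up ∘
      fun x => ⟨x.1.1, hl x.1 x.2⟩) = l := List.attach_map_subtype_val l
    rw [hid] at this
    exact this.trans (hb ⟨e i⟩)
  choose H hH using step
  refine ⟨_, isClub_closurePoints hδ H (fun ξ hξ => (hH ξ hξ).1)
    (ζ := Ordinal.omega0) (by rw [← ord_aleph0, ord_lt_ord]; exact hδ.aleph0_lt),
    fun α hα => ?_⟩
  obtain ⟨α, hαδ⟩ := α
  obtain ⟨hω, hcl⟩ := hα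
  simp only at hω hcl ⊢
  have hlim : Order.IsSuccLimit α := by
    refine Order.isSuccLimit_iff_of_orderBot.2 ⟨(Ordinal.omega0_pos.trans hω).ne',
      Order.isSuccPrelimit_of_succ_lt fun β hβ => ?_⟩
    exact (Order.succ_le_of_lt (hH β (hβ.trans hαδ)).2.1).trans_lt (hcl β hβ)
  -- `V_{β+1}` has at least `2 ^ |β|` elements. This yields both that `α` is a cardinal, by Cantor's
  -- theorem, and that it is a strong limit.
  have hpow : ∀ β < α, ((2 : Cardinal.{u}) ^ β.card).ord < α := fun β hβ => by
    have hβ' := hlim.succ_lt hβ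
    refine lt_of_le_of_lt ?_ ((hH _ (hβ'.trans hαδ)).2.2.1.trans (hcl _ hβ'))
    rw [ord_le_ord, Order.succ_eq_add_one, vonNeumann_add_one, card_powerset]
    exact power_le_power_left two_ne_zero (Ordinal.card_le_card_vonNeumann β)
  have hord : α.card.ord = α := by
    refine (ord_card_le α).antisymm (not_lt.1 fun h => ?_)
    have := Ordinal.card_le_card (hpow _ h).le
    rw [card_ord, card_ord] at this
    exact (cantor α.card).not_ge this
  have hω' : ℵ₀ < α.card := by
    rw [← ord_lt_ord, ord_aleph0, hord]
    exact hω
  refine ⟨α.card, hord, hω', ⟨(aleph0_pos.trans hω').ne', fun c hc => ?_⟩,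
    fun i l hl ⟨ξ, hξ, hΦ⟩ => ?_⟩
  · rw [← ord_lt_ord, hord] at hc ⊢
    simpa using hpow _ hc
  -- A finite list in a limit level already lies in an earlier level. So no condition on the
  -- cofinality of `α` is needed, and every closure point reflects.
  · obtain ⟨β, hβ, hb⟩ := exists_level_of_list hlim (l.map Subtype.val) (by simpa using hl)
    exact ⟨F i l, ((hH β (hβ.trans hαδ)).2.2.2 i l (by simpa using hb)).trans (hcl β hβ),
      hFΦ i l ⟨ξ, hξ, hΦ⟩⟩

end VopenkaCardinal

/-! ## Reflection of the Vopěnka scheme -/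

namespace VopenkaCardinal

open Cardinal ZFSet FirstOrder

instance : Countable setLang.Symbols := by
  have h1 : IsEmpty (Σ n, setLang.Functions n) := ⟨fun ⟨_, f⟩ => nomatch f⟩
  have h2 : Subsingleton (Σ n, setLang.Relations n) :=
    ⟨fun ⟨_, r⟩ ⟨_, r'⟩ => by cases r; cases r'; rfl⟩
  exact inferInstanceAs (Countable ((Σ n, setLang.Functions n) ⊕ (Σ n, setLang.Relations n)))

/-- The formula `φ` holds in `(X, E)` under the assignment that is given by the list `l`, with
default value `d`. -/
def Holds {X : Type*} (E : X → X → Prop) (d : X) (φ : setLang.Formula ℕ) (l : List X) : Prop :=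
  let := relStructure E
  φ.Realize fun n => l.getD n d

/-- Only finitely many parameters occur in a formula. They are listed behind the `k` free variables,
which leaves a parameter-free formula; there are countably many of these. -/
theorem exists_formula_of_definable {X : Type*} {E : X → X → Prop} (d : X) {k : ℕ}
    {s : Set (Fin k → X)}
    (h : letI := relStructure E; (Set.univ : Set X).Definable setLang s) :
    ∃ (φ : setLang.Formula ℕ) (l : List X), ∀ v, v ∈ s ↔ Holds E d φ (List.ofFn v ++ l) := by
  classical
  let := relStructure E
  obtain ⟨ψ, rfl⟩ := Set.definable_iff_exists_formula_sum.1 h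
  let L := ψ.freeVarFinset.toList
  have hL : ∀ a : ψ.freeVarFinset, ∃ (n : ℕ) (h : n < L.length), L[n] = a.1 := fun a =>
    List.mem_iff_getElem.1 (Finset.mem_toList.2 a.2)
  choose ix hlt hix using hL
  let g : ψ.freeVarFinset → ℕ := fun a => Sum.elim (fun _ => k + ix a) (fun i => i.1) a.1
  refine ⟨ψ.restrictFreeVar g, L.map (Sum.elim Subtype.val fun _ => d), fun v => ?_⟩
  refine (Language.BoundedFormula.realize_restrictFreeVar (Sum.elim Subtype.val v) ?_).symm
  rintro ⟨a | i, ha⟩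
  · have h1 := hlt ⟨_, ha⟩
    simp only [g, Sum.elim_inl]
    rw [List.getD_append_right _ _ _ _ (by simp), List.getD_eq_getElem _ _ (by simpa using h1)]
    simp [hix ⟨_, ha⟩]
  · simp only [g, Sum.elim_inr]
    rw [List.getD_append _ _ _ _ (by simp), List.getD_eq_getElem _ _ (by simp)]
    simp

theorem exists_formula₁ {X : Type*} {E : X → X → Prop} (d : X) {D : Set X}
    (h : IsDefinableClass E D) :
    ∃ (φ : setLang.Formula ℕ) (l : List X), ∀ x, x ∈ D ↔ Holds E d φ (x :: l) := by
  obtain ⟨φ, l, hφ⟩ := exists_formula_of_definable d h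
  exact ⟨φ, l, fun x => by simpa using hφ fun _ => x⟩

theorem exists_formula₂ {X : Type*} {E : X → X → Prop} (d : X) {D : Set (X × X)}
    (h : IsDefinableRelation E D) :
    ∃ (φ : setLang.Formula ℕ) (l : List X), ∀ x y, (x, y) ∈ D ↔ Holds E d φ (x :: y :: l) := by
  obtain ⟨φ, l, hφ⟩ := exists_formula_of_definable d h
  exact ⟨φ, l, fun x y => by simpa [List.ofFn_succ] using hφ ![x, y]⟩

/-- The Tarski–Vaught criterion. -/
theorem holds_map_iff {X Y : Type*} {E : X → X → Prop} {E' : Y → Y → Prop} {f : X → Y}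
    (hf : Function.Injective f) (hE : ∀ x y, E x y ↔ E' (f x) (f y)) (d : X)
    (htv : ∀ (φ : setLang.Formula ℕ) (l : List X), (∃ y, Holds E' (f d) φ (y :: l.map f)) →
      ∃ x, Holds E' (f d) φ (f x :: l.map f)) (φ : setLang.Formula ℕ) (l : List X) :
    Holds E' (f d) φ (l.map f) ↔ Holds E d φ l := by
  let := relStructure E
  let := relStructure E'
  let e : X ↪[setLang] Y :=
    { toFun := f
      inj' := hf
      map_fun' := fun g => nomatch g
      map_rel' := by
        rintro _ ⟨⟩ t
        exact (hE _ _).symm }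
  let hel := Language.Embedding.toElementaryEmbedding e fun n φ x a ha => by
    -- The last variable, for which a witness is sought, goes to the head of the list, and the
    -- others move up by one.
    let g : Empty ⊕ Fin (n + 1) → ℕ :=
      Sum.elim Empty.elim (Fin.lastCases 0 fun i => i.1 + 1)
    have key : ∀ a, Holds E' (f d) (φ.toFormula.relabel g) (a :: (List.ofFn x).map f) ↔
        φ.Realize default (Fin.snoc (e ∘ x) a) := fun a => by
      rw [Holds, Language.Formula.realize_relabel, Language.BoundedFormula.realize_toFormula]
      refine iff_of_eq (congrArg₂ _ (Subsingleton.elim _ _) (funext fun i => ?_))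
      refine Fin.lastCases ?_ (fun i => ?_) i
      · simp [g]
      · simp only [g, Sum.elim_inr, Fin.lastCases_castSucc, Function.comp_apply, Fin.snoc_castSucc]
        simp
        rfl
    obtain ⟨b, hb⟩ := htv _ (List.ofFn x) ⟨a, (key a).2 ha⟩
    exact ⟨b, (key _).1 hb⟩
  refine Iff.trans (iff_of_eq ?_) (hel.map_formula φ fun n => l.getD n d)
  exact congrArg (Language.Formula.Realize φ) (funext fun n => List.getD_map l d f)

end VopenkaCardinal

/-! ### ZFC in a level of the hierarchy -/

namespace VopenkaCardinal

open Cardinal ZFSet FirstOrder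

theorem mem_vonNeumann_of_mem {γ : Ordinal.{u}} {x y : ZFSet.{u}} (hx : x ∈ y) (hy : y ∈ V_ γ) :
    x ∈ V_ γ :=
  (isTransitive_vonNeumann γ).mem_trans hx hy

/-- A limit level contains all subsets of its elements, so separation and choice hold outright. For
replacement a bound on the ranks of the values suffices. -/
theorem modelsZFC_rankMem {γ : Ordinal.{u}} (hγ : Order.IsSuccLimit γ) (hω : Ordinal.omega0 < γ)
    (hrep : ∀ D, IsDefinableRelation (rankMem γ) D → ∀ a : Level γ,
      (∀ x, rankMem γ x a → ∃! y, (x, y) ∈ D) →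
      ∃ ξ < γ, ∀ x y, rankMem γ x a → (x, y) ∈ D → y.1 ∈ V_ ξ) :
    ModelsZFC (rankMem γ) where
  extensionality x y h := by
    refine Subtype.ext (ZFSet.ext fun z => ⟨fun hz => ?_, fun hz => ?_⟩)
    · exact (h ⟨z, mem_vonNeumann_of_mem hz x.2⟩).1 hz
    · exact (h ⟨z, mem_vonNeumann_of_mem hz y.2⟩).2 hz
  foundation := by
    rintro x ⟨y, hy⟩
    obtain ⟨z, hz, hd⟩ := ZFSet.regularity x.1 fun h => ZFSet.notMem_empty y.1 (h ▸ hy)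
    refine ⟨⟨z, mem_vonNeumann_of_mem hz x.2⟩, hz, fun w hw hw' => ?_⟩
    exact ZFSet.notMem_empty w.1 (hd ▸ ZFSet.mem_inter.2 ⟨hw, hw'⟩)
  pairing x y := by
    refine ⟨⟨{x.1, y.1}, ?_⟩, fun w => ?_⟩
    swap
    · rw [rankMem, Subtype.ext_iff, Subtype.ext_iff]
      exact ZFSet.mem_pair
    rw [mem_vonNeumann, rank_pair]
    exact max_lt (hγ.succ_lt (mem_vonNeumann.1 x.2)) (hγ.succ_lt (mem_vonNeumann.1 y.2))
  union x := by
    refine ⟨⟨⋃₀ x.1, mem_vonNeumann.2 ((rank_sUnion_le _).trans_lt (mem_vonNeumann.1 x.2))⟩,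
      fun w => ?_⟩
    simp only [rankMem, ZFSet.mem_sUnion]
    exact ⟨fun ⟨y, hy, hw⟩ => ⟨⟨y, mem_vonNeumann_of_mem hy x.2⟩, hy, hw⟩,
      fun ⟨y, hy, hw⟩ => ⟨y, hy, hw⟩⟩
  powerset x := by
    refine ⟨⟨powerset x.1, ?_⟩, fun y => ?_⟩
    · rw [mem_vonNeumann, rank_powerset]
      exact hγ.succ_lt (mem_vonNeumann.1 x.2)
    · simp only [rankMem, ZFSet.mem_powerset]
      exact ⟨fun h w hw => h hw, fun h w hw => h ⟨w, mem_vonNeumann_of_mem hw y.2⟩ hw⟩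
  infinity := by
    have hmem : ∀ o ≤ Ordinal.omega0, o.toZFSet ∈ V_ γ := fun o ho =>
      mem_vonNeumann.2 (by rw [Ordinal.rank_toZFSet]; exact ho.trans_lt hω)
    refine ⟨⟨Ordinal.omega0.toZFSet, hmem _ le_rfl⟩,
      ⟨⟨(0 : Ordinal).toZFSet, hmem _ (zero_le)⟩, ?_, fun w => ?_⟩, fun n hn => ?_⟩
    · exact Ordinal.toZFSet_mem_toZFSet_iff.2 Ordinal.omega0_pos
    · simp [rankMem]
    · obtain ⟨o, ho, hn⟩ := Ordinal.mem_toZFSet_iff.1 hn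
      have ho' : Order.succ o < Ordinal.omega0 := Ordinal.isSuccLimit_omega0.succ_lt ho
      refine ⟨⟨(Order.succ o).toZFSet, hmem _ ho'.le⟩, Ordinal.toZFSet_mem_toZFSet_iff.2 ho',
        fun w => ?_⟩
      simp only [rankMem, Ordinal.mem_toZFSet_iff, ← hn, Subtype.ext_iff, Order.lt_succ_iff_eq_or_lt]
      constructor
      · rintro ⟨a, rfl | ha, hw⟩
        exacts [Or.inr hw.symm, Or.inl ⟨a, ha, hw⟩]
      · rintro (⟨a, ha, hw⟩ | hw)
        exacts [⟨a, Or.inr ha, hw⟩, ⟨o, Or.inl rfl, hw.symm⟩]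
  separation D _ a := by
    refine ⟨⟨ZFSet.sep (fun x => ∃ h : x ∈ V_ γ, (⟨x, h⟩ : Level γ) ∈ D) a.1,
      mem_vonNeumann_of_subset ZFSet.sep_subset a.2⟩, fun x => ?_⟩
    simp only [rankMem, ZFSet.mem_sep]
    exact ⟨fun ⟨h, _, h'⟩ => ⟨h, h'⟩, fun ⟨h, h'⟩ => ⟨h, x.2, h'⟩⟩
  replacement D hD a ha := by
    obtain ⟨ξ, hξ, hb⟩ := hrep D hD a ha
    refine ⟨⟨ZFSet.sep (fun y => ∃ (h : y ∈ V_ γ) (x : Level γ), rankMem γ x a ∧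
      (x, (⟨y, h⟩ : Level γ)) ∈ D) (V_ ξ),
      mem_vonNeumann_of_subset ZFSet.sep_subset (vonNeumann_mem_of_lt hξ)⟩, fun y => ?_⟩
    simp only [rankMem, ZFSet.mem_sep]
    exact ⟨fun ⟨_, _, h⟩ => h, fun ⟨x, hx, h⟩ => ⟨hb x y hx h, y.2, x, hx, h⟩⟩
  choice a hne hdis := by
    have hne' : ∀ x : Level γ, ∃ y, rankMem γ x a → y ∈ x.1 := fun x => by
      by_cases h : rankMem γ x a
      · obtain ⟨y, hy⟩ := hne x h
        exact ⟨y.1, fun _ => hy⟩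
      · exact ⟨∅, fun h' => (h h').elim⟩
    choose g hg using hne'
    refine ⟨⟨ZFSet.sep (fun y => ∃ x : Level γ, rankMem γ x a ∧ y = g x) (⋃₀ a.1),
      mem_vonNeumann_of_subset ZFSet.sep_subset
        (mem_vonNeumann.2 ((rank_sUnion_le _).trans_lt (mem_vonNeumann.1 a.2)))⟩, fun x hx => ?_⟩
    refine ⟨⟨g x, mem_vonNeumann_of_mem (hg x hx) x.2⟩, ⟨hg x hx, ?_⟩, ?_⟩
    · simp only [rankMem, ZFSet.mem_sep]
      exact ⟨ZFSet.mem_sUnion.2 ⟨x.1, hx, hg x hx⟩, x, hx, rfl⟩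
    · rintro y ⟨hy, hy'⟩
      simp only [rankMem, ZFSet.mem_sep] at hy'
      obtain ⟨-, x', hx', h⟩ := hy'
      have : x = x' := hdis x x' y hx hx' hy (show y.1 ∈ x'.1 by rw [h]; exact hg x' hx')
      exact Subtype.ext (h.trans (congrArg g this.symm))

end VopenkaCardinal

/-! ### The club of Vopěnka-scheme cardinals -/

namespace VopenkaCardinal

open Cardinal ZFSet FirstOrder

/-- `x` is an element of the class of structures for the language `(F, R)` that is defined by the
formula `φ` with the parameters `l`. -/
def IsDefinedStructure {δ : Ordinal.{u}} (d : Level δ) (φ : setLang.Formula ℕ)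
    (F R : ZFSet.{u}) (l : List (Level δ)) (x : Level δ) : Prop :=
  Holds (rankMem δ) d φ (x :: l) ∧ ∃ A : SetStructure F R, A.HasCode x.1

/-- The condition `hwit` makes `V_γ` elementary in `V_δ`. Replacement and the Vopěnka scheme are not
transferred through elementarity, which would require formalizing them as formulas; `hbdd`, `hcls`
and `hemb` reflect the relevant facts directly. -/
theorem isVopenkaSchemeCardinal_of_reflects {δ γ : Cardinal.{u}} (hδ : IsVopenkaCardinal δ)
    (hγ : ℵ₀ < γ) (hγδ : γ < δ) (d : Level δ.ord) (hd : d.1 = ∅)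
    (hwit : ∀ (φ : setLang.Formula ℕ) (l : List (Level δ.ord)), (∀ x ∈ l, x.1 ∈ V_ γ.ord) →
      (∃ x, Holds (rankMem δ.ord) d φ (x :: l)) →
      ∃ ξ < γ.ord, ∃ x, x.1 ∈ V_ ξ ∧ Holds (rankMem δ.ord) d φ (x :: l))
    (hbdd : ∀ (φ : setLang.Formula ℕ) (a : Level δ.ord) (l : List (Level δ.ord)),
      a.1 ∈ V_ γ.ord → (∀ x ∈ l, x.1 ∈ V_ γ.ord) →
      (∃ ξ < δ.ord, ∀ x, x.1 ∈ a.1 → ∃ y, y.1 ∈ V_ ξ ∧ Holds (rankMem δ.ord) d φ (x :: y :: l)) →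
      ∃ ξ < γ.ord, ∀ x, x.1 ∈ a.1 → ∃ y, y.1 ∈ V_ ξ ∧ Holds (rankMem δ.ord) d φ (x :: y :: l))
    (hcls : ∀ (φ : setLang.Formula ℕ) (F R : Level δ.ord) (l : List (Level δ.ord)),
      F.1 ∈ V_ γ.ord → R.1 ∈ V_ γ.ord → (∀ x ∈ l, x.1 ∈ V_ γ.ord) →
      (∃ ξ < δ.ord, ∀ x, IsDefinedStructure d φ F.1 R.1 l x → x.1 ∈ V_ ξ) →
      ∃ ξ < γ.ord, ∀ x, IsDefinedStructure d φ F.1 R.1 l x → x.1 ∈ V_ ξ)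
    (hemb : ∀ (φ : setLang.Formula ℕ) (F R : Level δ.ord) (l : List (Level δ.ord)),
      F.1 ∈ V_ γ.ord → R.1 ∈ V_ γ.ord → (∀ x ∈ l, x.1 ∈ V_ γ.ord) →
      (∃ ξ < δ.ord, HasElementaryEmbedding F.1 R.1
        {z | z ∈ V_ ξ ∧ ∃ x, x.1 = z ∧ IsDefinedStructure d φ F.1 R.1 l x}) →
      ∃ ξ < γ.ord, HasElementaryEmbedding F.1 R.1
        {z | z ∈ V_ ξ ∧ ∃ x, x.1 = z ∧ IsDefinedStructure d φ F.1 R.1 l x}) :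
    IsVopenkaSchemeCardinal γ := by
  have hγδ' : γ.ord < δ.ord := ord_lt_ord.2 hγδ
  have hlim := isSuccLimit_ord hγ.le
  have hlimδ := isSuccLimit_ord hδ.1.aleph0_lt.le
  let up : Level γ.ord → Level δ.ord := fun x => ⟨x.1, vonNeumann_subset_of_le hγδ'.le x.2⟩
  have hup : ∀ l : List (Level γ.ord), ∀ x ∈ l.map up, x.1 ∈ V_ γ.ord := fun l x hx => by
    obtain ⟨y, -, rfl⟩ := List.mem_map.1 hx
    exact y.2
  let d' : Level γ.ord := ⟨∅, mem_vonNeumann.2 (by rw [rank_empty]; exact hlim.bot_lt)⟩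
  obtain rfl : d = up d' := Subtype.ext hd
  have hel := holds_map_iff (E := rankMem γ.ord) (E' := rankMem δ.ord) (f := up)
    (fun x y h => Subtype.ext (congrArg (fun z : Level δ.ord => z.1) h)) (fun _ _ => Iff.rfl) d'
    (fun φ l ⟨y, hy⟩ => by
      obtain ⟨ξ, hξ, x, hx, hφ⟩ := hwit φ _ (hup l) ⟨y, hy⟩
      exact ⟨⟨x.1, vonNeumann_subset_of_le hξ.le hx⟩, hφ⟩)
  refine ⟨modelsZFC_rankMem hlim (by rwa [← ord_aleph0, ord_lt_ord]) fun D hD a ha => ?_, ?_⟩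
  · obtain ⟨φ, l, hφ⟩ := exists_formula₂ d' hD
    -- Below `δ` the ordinal `γ` itself is a bound for the values, and this reflects to a bound
    -- below `γ`.
    obtain ⟨ξ, hξ, hb⟩ := hbdd φ (up a) (l.map up) a.2 (hup l) ⟨γ.ord, hγδ', fun x hx => by
      have hx' : x.1 ∈ V_ γ.ord := mem_vonNeumann_of_mem hx a.2
      obtain ⟨y, hy, -⟩ := ha ⟨x.1, hx'⟩ hx
      exact ⟨up y, y.2, (hel φ (⟨x.1, hx'⟩ :: y :: l)).2 ((hφ _ _).1 hy)⟩⟩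
    refine ⟨ξ, hξ, fun x y hx hy => ?_⟩
    obtain ⟨z, hz, h⟩ := hb (up x) hx
    have hz' : (x, (⟨z.1, vonNeumann_subset_of_le hξ.le hz⟩ : Level γ.ord)) ∈ D :=
      (hφ _ _).2 ((hel φ (x :: ⟨z.1, vonNeumann_subset_of_le hξ.le hz⟩ :: l)).1 h)
    rw [(ha x hx).unique hy hz']
    exact hz
  · intro F hF R hR 𝓜 hM hproper hstr
    obtain ⟨φ, l, hφ⟩ := exists_formula₁ d' hM
    have hmem : ∀ x : Level γ.ord,
        IsDefinedStructure (up d') φ F R (l.map up) (up x) ↔ x ∈ 𝓜 := fun x => by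
      have h := (hφ x).trans (hel φ (x :: l)).symm
      exact ⟨fun hx => h.2 hx.1, fun hx => ⟨h.1 hx, hstr _ ⟨x, hx, rfl⟩⟩⟩
    -- The structures defined over `V_δ` by the formula that defines `𝓜` over `V_γ`.
    let 𝓝 : ZFSet.{u} := ZFSet.sep
      (fun z => ∃ x, x.1 = z ∧ IsDefinedStructure (up d') φ F R (l.map up) x) (V_ δ.ord)
    have hunbdd : ¬ ∃ ξ < δ.ord, ∀ x, IsDefinedStructure (up d') φ F R (l.map up) x →
        x.1 ∈ V_ ξ := fun h => by
      obtain ⟨ξ, hξ, hb⟩ := hcls φ (up ⟨F, hF⟩) (up ⟨R, hR⟩) _ hF hR (hup l) h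
      refine hproper ⟨ZFSet.sep (fun z => z ∈ Subtype.val '' 𝓜) (V_ ξ),
        mem_vonNeumann_of_subset ZFSet.sep_subset (vonNeumann_mem_of_lt hξ), fun z => ?_⟩
      rw [ZFSet.mem_sep]
      refine ⟨fun h => h.2, fun h => ⟨?_, h⟩⟩
      obtain ⟨x, hx, rfl⟩ := h
      exact hb (up x) ((hmem x).2 hx)
    have hsub : 𝓝 ⊆ V_ δ.ord := ZFSet.sep_subset
    have hcard : 𝓝.card = δ := by
      refine le_antisymm ((card_mono hsub).trans_eq ?_) (not_lt.1 fun h => hunbdd ?_)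
      · rw [card_vonNeumann, hδ.1.preBeth_ord]
      -- With fewer than `δ` elements `𝓝` would belong to `V_δ`, and its members would have bounded
      -- rank.
      · have h𝓝 := mem_of_card_lt hδ.1 hsub h
        refine ⟨_, mem_vonNeumann.1 h𝓝, fun x hx => mem_vonNeumann.2 (rank_lt_of_mem ?_)⟩
        exact ZFSet.mem_sep.2 ⟨x.2, x, rfl, hx⟩
    obtain ⟨x, y, A, B, hx, hy, hxy, hA, hB, hAB⟩ := hδ.2 F R 𝓝
      (card_lt_of_mem hδ.1 (vonNeumann_subset_of_le hγδ'.le hF))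
      (card_lt_of_mem hδ.1 (vonNeumann_subset_of_le hγδ'.le hR)) hsub hcard (fun x hx => by
        obtain ⟨-, y, rfl, hy⟩ := ZFSet.mem_sep.1 hx
        exact hy.2)
    obtain ⟨hxδ, hx⟩ := ZFSet.mem_sep.1 hx
    obtain ⟨hyδ, hy⟩ := ZFSet.mem_sep.1 hy
    -- A level below `δ` that contains both structures, so that the existence of such a pair
    -- reflects below `γ`.
    obtain ⟨β, hβ, hb⟩ := exists_level_of_list hlimδ [x, y] (by simp [hxδ, hyδ])
    obtain ⟨ξ, hξ, x', y', A', B', hx', hy', h⟩ := hemb φ (up ⟨F, hF⟩) (up ⟨R, hR⟩) _ hF hR (hup l)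
      ⟨β, hβ, x, y, A, B, ⟨hb x (by simp), hx⟩, ⟨hb y (by simp), hy⟩, hxy, hA, hB, hAB⟩
    have hin : ∀ z, z ∈ V_ ξ → (∃ x, x.1 = z ∧
        IsDefinedStructure (up d') φ F R (l.map up) x) → z ∈ Subtype.val '' 𝓜 := by
      rintro _ hz ⟨x, rfl, hx⟩
      exact ⟨⟨x.1, vonNeumann_subset_of_le hξ.le hz⟩, (hmem _).1 hx, rfl⟩
    exact ⟨x', y', A', B', hin _ hx'.1 hx'.2, hin _ hy'.1 hy'.2, h⟩

theorem exists_club_isVopenkaSchemeCardinal {δ : Cardinal.{u}} (hδ : IsVopenkaCardinal δ) :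
    ∃ C : Set (Set.Iio δ.ord), IsClub C ∧ ∀ α ∈ C, ∃ γ : Cardinal.{u}, γ.ord = α.1 ∧ ℵ₀ < γ ∧
      γ.IsStrongLimit ∧ IsVopenkaSchemeCardinal γ := by
  have hlim := isSuccLimit_ord hδ.1.aleph0_lt.le
  let d : Level δ.ord := ⟨∅, mem_vonNeumann.2 (by rw [rank_empty]; exact hlim.bot_lt)⟩
  -- The first entries of the list serve as the set `a` or the language `F`, `R`. On lists that are
  -- too short the last three conditions hold vacuously.
  let Φ : Fin 4 × setLang.Formula ℕ → List (Level δ.ord) → Ordinal.{u} → Prop := fun i l ξ =>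
    (![∃ x, x.1 ∈ V_ ξ ∧ Holds (rankMem δ.ord) d i.2 (x :: l),
      ∀ a l', l = a :: l' → ∀ x, x.1 ∈ a.1 →
        ∃ y, y.1 ∈ V_ ξ ∧ Holds (rankMem δ.ord) d i.2 (x :: y :: l'),
      ∀ F R l', l = F :: R :: l' → ∀ x, IsDefinedStructure d i.2 F.1 R.1 l' x → x.1 ∈ V_ ξ,
      ∀ F R l', l = F :: R :: l' → HasElementaryEmbedding F.1 R.1
        {z | z ∈ V_ ξ ∧ ∃ x, x.1 = z ∧ IsDefinedStructure d i.2 F.1 R.1 l' x}] : Fin 4 → Prop) i.1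
  obtain ⟨C, hC, hCΦ⟩ := exists_club hδ.1 Φ
  refine ⟨C, hC, fun α hα => ?_⟩
  obtain ⟨γ, hγα, hγ, hsl, hrefl⟩ := hCΦ α hα
  refine ⟨γ, hγα, hγ, hsl, ?_⟩
  have hγδ : γ.ord < δ.ord := hγα ▸ α.2
  rw [← hγα] at hrefl
  refine isVopenkaSchemeCardinal_of_reflects hδ hγ (ord_lt_ord.1 hγδ) d rfl ?_ ?_ ?_ ?_
  · rintro φ l hl ⟨x, hx⟩
    exact hrefl (0, φ) l hl ⟨_, hlim.succ_lt (mem_vonNeumann.1 x.2), x,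
      mem_vonNeumann.2 (Order.lt_succ _), hx⟩
  · rintro φ a l ha hl ⟨ξ, hξ, h⟩
    obtain ⟨ξ, hξ, h⟩ := hrefl (1, φ) (a :: l) (List.forall_mem_cons.2 ⟨ha, hl⟩)
      ⟨ξ, hξ, by rintro _ _ ⟨⟩; exact h⟩
    exact ⟨ξ, hξ, h _ _ rfl⟩
  · rintro φ F R l hF hR hl ⟨ξ, hξ, h⟩
    obtain ⟨ξ, hξ, h⟩ := hrefl (2, φ) (F :: R :: l)
      (List.forall_mem_cons.2 ⟨hF, List.forall_mem_cons.2 ⟨hR, hl⟩⟩)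
      ⟨ξ, hξ, by rintro _ _ _ ⟨⟩; exact h⟩
    exact ⟨ξ, hξ, h _ _ _ rfl⟩
  · rintro φ F R l hF hR hl ⟨ξ, hξ, h⟩
    obtain ⟨ξ, hξ, h⟩ := hrefl (3, φ) (F :: R :: l)
      (List.forall_mem_cons.2 ⟨hF, List.forall_mem_cons.2 ⟨hR, hl⟩⟩)
      ⟨ξ, hξ, by rintro _ _ _ ⟨⟩; exact h⟩
    exact ⟨ξ, hξ, h _ _ _ rfl⟩

end VopenkaCardinal

universe w

/-! ## Embeddings between expansions of levels of the hierarchy -/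

namespace VopenkaCardinal

open Cardinal ZFSet FirstOrder

theorem pair_mem_vonNeumann {γ : Ordinal.{u}} (hγ : Order.IsSuccLimit γ) {x y : ZFSet.{u}}
    (hx : x ∈ V_ γ) (hy : y ∈ V_ γ) : pair x y ∈ V_ γ := by
  rw [mem_vonNeumann] at *
  rw [ZFSet.pair, ZFSet.rank_pair, ZFSet.rank_pair, rank_singleton]
  exact max_lt (hγ.succ_lt (hγ.succ_lt hx))
    (hγ.succ_lt (max_lt (hγ.succ_lt hx) (hγ.succ_lt hy)))

theorem numeral_injective : Function.Injective numeral.{u} := fun m n h => by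
  simpa using Ordinal.toZFSet_injective h

theorem numeral_mem_vonNeumann {γ : Ordinal.{u}} (hγ : Ordinal.omega0 ≤ γ) (n : ℕ) :
    numeral n ∈ V_ γ := by
  rw [mem_vonNeumann, numeral, Ordinal.rank_toZFSet]
  exact (Ordinal.natCast_lt_omega0 n).trans_le hγ

theorem tupleSet_injective {n : ℕ} : Function.Injective (tupleSet.{u} (n := n)) := by
  intro t t' h
  funext i
  have hi : pair (numeral i) (t i) ∈ tupleSet t' := h ▸ ZFSet.mem_range.2 ⟨i, rfl⟩
  obtain ⟨k, hk⟩ := ZFSet.mem_range.1 hi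
  obtain ⟨h1, h2⟩ := pair_inj.1 hk
  obtain rfl : k = i := Fin.ext (numeral_injective h1)
  exact h2.symm

theorem tupleSet_mem_vonNeumann {γ : Ordinal.{u}} (hγ : Order.IsSuccLimit γ)
    (hω : Ordinal.omega0 ≤ γ) {n : ℕ} {t : Fin n → ZFSet.{u}} (ht : ∀ i, t i ∈ V_ γ) :
    tupleSet t ∈ V_ γ := by
  obtain ⟨β, hβ, hb⟩ := exists_level_of_list hγ (List.ofFn fun i => pair (numeral i) (t i)) (by
    intro x hx
    obtain ⟨i, rfl⟩ := (List.mem_ofFn' _ _).1 hx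
    exact pair_mem_vonNeumann hγ (numeral_mem_vonNeumann hω i) (ht i))
  refine mem_vonNeumann_of_subset (fun x hx => ?_) (vonNeumann_mem_of_lt hβ)
  obtain ⟨i, rfl⟩ := ZFSet.mem_range.1 hx
  exact hb _ ((List.mem_ofFn' _ _).2 ⟨i, rfl⟩)

/-- The relations of a coded structure can be read off from the code. -/
theorem relMap_iff_of_hasCode {F R c f r : ZFSet.{u}} {A : SetStructure F R}
    (h : A.HasCode (pair c (pair f r))) {n : ℕ} (s : (codedLanguage F R).Relations n)
    (t : Fin n → A.carrier) :
    Language.Structure.RelMap s t ↔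
      pair (pair s.1 (numeral n)) (tupleSet fun i => (t i).1) ∈ r := by
  obtain ⟨f', r', h, -, hr⟩ := h
  obtain ⟨-, h⟩ := pair_inj.1 h
  obtain ⟨-, rfl⟩ := pair_inj.1 h
  rw [hr]
  refine ⟨fun h => ⟨n, s, t, h, rfl⟩, ?_⟩
  rintro ⟨m, s', t', h, he⟩
  obtain ⟨h1, h2⟩ := pair_inj.1 he
  obtain ⟨h1, h3⟩ := pair_inj.1 h1
  obtain rfl := numeral_injective h3
  obtain rfl : s = s' := Subtype.ext h1
  obtain rfl : t = t' := funext fun i => Subtype.ext (congrFun (tupleSet_injective h2) i)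
  exact h

/-- The set of relation symbols with names `e i` and arities `a i`. -/
noncomputable def symbolSet {I : Type w} [Small.{u} I] (e a : I → ℕ) : ZFSet.{u} :=
  ZFSet.range fun i => pair (numeral (e i)) (numeral (a i))

/-- The set `c` with the relations `T i` as a structure for `symbolSet e a`. -/
noncomputable def relationalStructure {I : Type w} [Small.{u} I] (e a : I → ℕ) (c : ZFSet.{u})
    (hc : c.Nonempty) (T : ∀ i, (Fin (a i) → ZFSet.{u}) → Prop) :
    SetStructure ∅ (symbolSet.{u} e a) where
  carrier := c
  nonempty := hc
  str :=
    { funMap := fun s => (ZFSet.notMem_empty _ s.2).elim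
      RelMap := fun {n} s t => ∃ (i : I) (h : a i = n), s.1 = numeral (e i) ∧
        T i fun k => (t (Fin.cast h k)).1 }

/-- The graph of the relations `T i` on `V_β`. -/
noncomputable def relationGraph {I : Type w} (e a : I → ℕ) (β : Ordinal.{u})
    (T : ∀ i, (Fin (a i) → ZFSet.{u}) → Prop) : ZFSet.{u} :=
  ZFSet.sep (fun z => ∃ (i : I) (t : Fin (a i) → ZFSet.{u}), (∀ k, t k ∈ V_ β) ∧ T i t ∧
    z = pair (pair (numeral (e i)) (numeral (a i))) (tupleSet t)) (V_ β)

section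

variable {I : Type w} {e a : I → ℕ} {β : Ordinal.{u}} (hβ : Order.IsSuccLimit β)
  (hω : Ordinal.omega0 ≤ β) {T : ∀ i, (Fin (a i) → ZFSet.{u}) → Prop}

include hβ hω

theorem mem_relationGraph {z : ZFSet.{u}} : z ∈ relationGraph e a β T ↔
    ∃ (i : I) (t : Fin (a i) → ZFSet.{u}), (∀ k, t k ∈ V_ β) ∧ T i t ∧
      z = pair (pair (numeral (e i)) (numeral (a i))) (tupleSet t) := by
  rw [relationGraph, ZFSet.mem_sep]
  refine ⟨fun h => h.2, fun h => ⟨?_, h⟩⟩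
  obtain ⟨i, t, ht, -, rfl⟩ := h
  exact pair_mem_vonNeumann hβ (pair_mem_vonNeumann hβ (numeral_mem_vonNeumann hω _)
    (numeral_mem_vonNeumann hω _)) (tupleSet_mem_vonNeumann hβ hω ht)

theorem pair_mem_relationGraph (he : Function.Injective e) {i : I} {t : Fin (a i) → ZFSet.{u}}
    (ht : ∀ k, t k ∈ V_ β) :
    pair (pair (numeral (e i)) (numeral (a i))) (tupleSet t) ∈ relationGraph e a β T ↔ T i t := by
  rw [mem_relationGraph hβ hω]
  refine ⟨?_, fun h => ⟨i, t, ht, h, rfl⟩⟩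
  rintro ⟨i', t', -, h, hz⟩
  obtain ⟨h1, h2⟩ := pair_inj.1 hz
  obtain rfl := he (numeral_injective (pair_inj.1 h1).1)
  rwa [tupleSet_injective h2]

theorem hasCode_relationalStructure [Small.{u} I] (hne : (V_ β).Nonempty) :
    (relationalStructure e a (V_ β) hne T).HasCode
      (pair (V_ β) (pair ∅ (relationGraph e a β T))) := by
  refine ⟨∅, _, rfl, fun z => ⟨fun h => (ZFSet.notMem_empty _ h).elim, ?_⟩, fun z => ?_⟩
  · rintro ⟨n, s, -⟩
    exact (ZFSet.notMem_empty _ s.2).elim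
  · rw [mem_relationGraph hβ hω]
    constructor
    · rintro ⟨i, t, ht, hT, rfl⟩
      exact ⟨a i, ⟨numeral (e i), ZFSet.mem_range.2 ⟨i, rfl⟩⟩, fun k => ⟨t k, ht k⟩,
        ⟨i, rfl, rfl, hT⟩, rfl⟩
    · rintro ⟨n, s, t, ⟨i, rfl, hs, hT⟩, rfl⟩
      exact ⟨i, fun k => (t k).1, fun k => (t k).2, hT, by rw [hs]⟩

end

/-- Among the expansions of `V_{β(α)}` by countably many relations and a constant for `α`, where
`α < δ` for a Vopěnka cardinal `δ`, there are two that embed into each other. -/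
theorem exists_embedding_of_isVopenkaCardinal {δ : Cardinal.{u}} (hδ : IsVopenkaCardinal δ)
    {I : Type w} [Countable I] (a : I → ℕ) (T : ∀ i, (Fin (a i) → ZFSet.{u}) → Prop)
    (β : Ordinal.{u} → Ordinal.{u}) (hβ : ∀ α < δ.ord, α < β α ∧ β α < δ.ord ∧
      Order.IsSuccLimit (β α) ∧ Ordinal.omega0 ≤ β α) :
    ∃ α < δ.ord, ∃ α' < δ.ord, α ≠ α' ∧ ∃ j : ZFSet.{u} → ZFSet.{u},
      (∀ x ∈ V_ (β α), j x ∈ V_ (β α')) ∧ j α.toZFSet = α'.toZFSet ∧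
      ∀ i t, (∀ k, t k ∈ V_ (β α)) → (T i t ↔ T i fun k => j (t k)) := by
  classical
  obtain ⟨e, he⟩ := exists_injective_nat (Option I)
  have hlim := isSuccLimit_ord hδ.1.aleph0_lt.le
  have hωδ : Ordinal.omega0 < δ.ord := by rw [← ord_aleph0, ord_lt_ord]; exact hδ.1.aleph0_lt
  let ar : Option I → ℕ := fun o => o.elim 1 a
  -- The index `none` is a unary relation that names `α`. Using a relation instead of a constant
  -- keeps the set of function symbols empty.
  let S : Ordinal.{u} → ∀ o, (Fin (ar o) → ZFSet.{u}) → Prop := fun α o => match o with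
    | none => fun t => t (0 : Fin 1) = α.toZFSet
    | some i => T i
  let code : Ordinal.{u} → ZFSet.{u} := fun α =>
    pair (V_ (β α)) (pair ∅ (relationGraph e ar (β α) (S α)))
  have hempty : ∀ {γ : Ordinal.{u}}, Order.IsSuccLimit γ → (∅ : ZFSet.{u}) ∈ V_ γ := fun h =>
    mem_vonNeumann.2 (by rw [rank_empty]; exact h.bot_lt)
  have hcode : ∀ α < δ.ord, code α ∈ V_ δ.ord := fun α hα => by
    have hV := vonNeumann_mem_of_lt (hβ α hα).2.1
    exact pair_mem_vonNeumann hlim hV (pair_mem_vonNeumann hlim (hempty hlim)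
      (mem_vonNeumann_of_subset ZFSet.sep_subset hV))
  let 𝓜 : ZFSet.{u} := ZFSet.range fun α : Set.Iio δ.ord => code α.1
  have hsub : 𝓜 ⊆ V_ δ.ord := fun x hx => by
    obtain ⟨α, rfl⟩ := ZFSet.mem_range.1 hx
    exact hcode _ α.2
  have hcard : 𝓜.card = δ := by
    refine le_antisymm ((card_mono hsub).trans_eq ?_) (not_lt.1 fun h => ?_)
    · rw [card_vonNeumann, hδ.1.preBeth_ord]
    -- Otherwise `𝓜` has a rank below `δ`, but the code whose index is that rank is a member of `𝓜`
    -- of larger rank.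
    · have hρ := mem_vonNeumann.1 (mem_of_card_lt hδ.1 hsub h)
      have h1 : rank (code (rank 𝓜)) < rank 𝓜 :=
        rank_lt_of_mem (ZFSet.mem_range.2 ⟨⟨_, hρ⟩, rfl⟩)
      have h2 : β (rank 𝓜) < rank (code (rank 𝓜)) := by
        simp only [code, ZFSet.pair, ZFSet.rank_pair, rank_singleton, rank_vonNeumann]
        exact (Order.lt_succ _).trans ((Order.lt_succ _).trans_le (le_max_left _ _))
      exact ((hβ _ hρ).1.trans h2).not_gt h1
  have hR : symbolSet.{u} e ar ∈ V_ δ.ord := by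
    refine mem_vonNeumann_of_subset (fun x hx => ?_) (vonNeumann_mem_of_lt hωδ)
    obtain ⟨o, rfl⟩ := ZFSet.mem_range.1 hx
    exact pair_mem_vonNeumann Ordinal.isSuccLimit_omega0 (numeral_mem_vonNeumann le_rfl _)
      (numeral_mem_vonNeumann le_rfl _)
  obtain ⟨x, y, A, B, hx, hy, hxy, hA, hB, ⟨g⟩⟩ := hδ.2 ∅ (symbolSet.{u} e ar) 𝓜
    (card_lt_of_mem hδ.1 (hempty hlim)) (card_lt_of_mem hδ.1 hR) hsub hcard (fun x hx => by
      obtain ⟨α, rfl⟩ := ZFSet.mem_range.1 hx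
      obtain ⟨-, -, h1, h2⟩ := hβ _ α.2
      exact ⟨_, hasCode_relationalStructure h1 h2 ⟨_, hempty h1⟩⟩)
  obtain ⟨⟨α, hα⟩, rfl⟩ := ZFSet.mem_range.1 hx
  obtain ⟨⟨α', hα'⟩, rfl⟩ := ZFSet.mem_range.1 hy
  have hAc : A.carrier = V_ (β α) := by
    obtain ⟨_, _, h, -⟩ := hA
    exact (pair_inj.1 h).1.symm
  have hBc : B.carrier = V_ (β α') := by
    obtain ⟨_, _, h, -⟩ := hB
    exact (pair_inj.1 h).1.symm
  -- The embedding is extended to all sets by `∅`, since the relations `T i` take arbitrary tuples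
  -- of sets.
  have hj : ∃ j : ZFSet.{u} → ZFSet.{u}, ∀ z : A.carrier, j z.1 = (g z).1 :=
    ⟨fun z => if h : z ∈ A.carrier then (g ⟨z, h⟩).1 else ∅, fun z => dif_pos z.2⟩
  obtain ⟨j, hj⟩ := hj
  obtain ⟨h1, -, h2, h3⟩ := hβ α hα
  obtain ⟨-, -, h2', h3'⟩ := hβ α' hα'
  have hjV : ∀ x ∈ V_ (β α), j x ∈ V_ (β α') := fun x hx => by
    rw [hj ⟨x, hAc.symm ▸ hx⟩, ← hBc]
    exact (g _).2
  have key : ∀ (o : Option I) (t : Fin (ar o) → ZFSet.{u}), (∀ k, t k ∈ V_ (β α)) →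
      (S α o t ↔ S α' o fun k => j (t k)) := fun o t ht => by
    let s : (codedLanguage ∅ (symbolSet.{u} e ar)).Relations (ar o) :=
      ⟨numeral (e o), ZFSet.mem_range.2 ⟨o, rfl⟩⟩
    let t' : Fin (ar o) → A.carrier := fun k => ⟨t k, hAc.symm ▸ ht k⟩
    rw [← pair_mem_relationGraph (T := S α) h2 h3 he ht,
      ← pair_mem_relationGraph (T := S α') h2' h3' he fun k => hjV _ (ht k)]
    refine (relMap_iff_of_hasCode hA s t').symm.trans ((g.map_rel s t').symm.trans ?_)
    refine (relMap_iff_of_hasCode hB s (g ∘ t')).trans (iff_of_eq ?_)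
    have : (fun k => j (t k)) = fun k => (g (t' k)).1 := funext fun k => hj (t' k)
    rw [this]
    rfl
  refine ⟨α, hα, α', hα', fun h => hxy (by subst h; rfl), j, hjV, ?_, fun i => key (some i)⟩
  exact (key none (fun _ => α.toZFSet)
    fun _ => mem_vonNeumann.2 (by rwa [Ordinal.rank_toZFSet])).1 rfl

end VopenkaCardinal

/-! ### Embeddings that preserve truth in the levels and relations between ordinals -/

namespace VopenkaCardinal

open Cardinal ZFSet FirstOrder

instance : Countable setPredLang.Symbols := by
  have h1 : IsEmpty (Σ n, setPredLang.Functions n) := ⟨fun ⟨_, f⟩ => nomatch f⟩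
  have h2 : Countable (Σ n, setPredLang.Relations n) := by
    refine Function.Injective.countable (f := fun r : Σ n, setPredLang.Relations n => r.1) ?_
    rintro ⟨_, r⟩ ⟨_, r'⟩ h
    cases r <;> cases r' <;> first | rfl | cases h
  exact inferInstanceAs (Countable ((Σ n, setPredLang.Functions n) ⊕
    (Σ n, setPredLang.Relations n)))

/-- Countably many relations between ordinals and the structures `⟨V_l, ∈, A ∩ V_l⟩` are preserved
by an embedding between two levels of the hierarchy below a Vopěnka cardinal. -/
theorem exists_ordinal_embedding {δ : Cardinal.{u}} (hδ : IsVopenkaCardinal δ) (A : ZFSet.{u})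
    (P : ℕ → Ordinal.{u} → Ordinal.{u} → Ordinal.{u} → Prop) (β : Ordinal.{u} → Ordinal.{u})
    (hβ : ∀ α < δ.ord, α < β α ∧ β α < δ.ord ∧ Order.IsSuccLimit (β α) ∧
      Ordinal.omega0 ≤ β α) :
    ∃ α < δ.ord, ∃ α' < δ.ord, α ≠ α' ∧ ∃ (j : ZFSet.{u} → ZFSet.{u}) (f : Ordinal.{u} → Ordinal.{u}),
      f α = α' ∧ (∀ ξ < β α, f ξ < β α' ∧ j ξ.toZFSet = (f ξ).toZFSet) ∧
      (∀ n, ∀ ξ < β α, ∀ η < β α, ∀ ζ < β α, P n ξ η ζ ↔ P n (f ξ) (f η) (f ζ)) ∧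
      ∀ l < β α, ∃ e : RankWith A l ↪ₑ[setPredLang] RankWith A (f l), ∀ x, (e x).1 = j x.1 := by
  let ar : ℕ ⊕ (Σ n, setPredLang.Formula (Fin n)) → ℕ := Sum.elim (fun _ => 3) fun φ => φ.1 + 1
  -- The second kind of relation expresses that the tuple satisfies `φ` in the level indexed by `t
  -- 0`. Its preservation for all `φ` makes the map elementary on all levels `V_l` simultaneously.
  let T : ∀ i, (Fin (ar i) → ZFSet.{u}) → Prop := fun i => match i with
    | .inl n => fun t : Fin 3 → ZFSet.{u} => ∃ ξ η ζ : Ordinal.{u}, t 0 = ξ.toZFSet ∧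
        t 1 = η.toZFSet ∧ t 2 = ζ.toZFSet ∧ P n ξ η ζ
    | .inr ⟨n, φ⟩ => fun t : Fin (n + 1) → ZFSet.{u} => ∃ (o : Ordinal.{u})
        (x : Fin n → RankWith A o), t 0 = o.toZFSet ∧ (∀ i : Fin n, t i.succ = (x i).1) ∧ φ.Realize x
  obtain ⟨α, hα, α', hα', hne, j, hjV, hjα, hj⟩ := exists_embedding_of_isVopenkaCardinal hδ ar T β hβ
  have hV : ∀ {ξ}, ξ < β α → ξ.toZFSet ∈ V_ (β α) := fun h =>
    mem_vonNeumann.2 (by rwa [Ordinal.rank_toZFSet])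
  have hsat : ∀ {n : ℕ} (φ : setPredLang.Formula (Fin n)) (o : Ordinal.{u}) (x : Fin n → RankWith A o),
      o < β α → (φ.Realize x ↔ ∃ (o' : Ordinal.{u}) (x' : Fin n → RankWith A o'),
        j o.toZFSet = o'.toZFSet ∧ (∀ i, j (x i).1 = (x' i).1) ∧ φ.Realize x') := fun {n} φ o x ho => by
    have h := hj (.inr ⟨n, φ⟩) (Fin.cons o.toZFSet fun i => (x i).1) (Fin.cases (hV ho) fun i =>
      vonNeumann_subset_of_le ho.le (x i).2)
    refine Iff.trans ?_ h
    refine ⟨fun hφ => ⟨o, x, rfl, fun i => rfl, hφ⟩, ?_⟩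
    rintro ⟨o', x', h1, h2, hφ⟩
    obtain rfl : o = o' := Ordinal.toZFSet_injective h1
    obtain rfl : x = x' := funext fun i => Subtype.ext (h2 i)
    exact hφ
  -- For `⊤` without variables the truth relation only says that `t 0` is an ordinal, so ordinals go
  -- to ordinals.
  have hf : ∀ ξ, ∃ η : Ordinal.{u}, ξ < β α → j ξ.toZFSet = η.toZFSet := fun ξ => by
    by_cases h : ξ < β α
    · obtain ⟨o, -, ho, -⟩ := (hsat (n := 0) ⊤ ξ Fin.elim0 h).1
        (Language.BoundedFormula.realize_top.2 trivial)
      exact ⟨o, fun _ => ho⟩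
    · exact ⟨0, fun h' => absurd h' h⟩
  choose f hf using hf
  refine ⟨α, hα, α', hα', hne, j, f, ?_, fun ξ hξ => ⟨?_, hf ξ hξ⟩, fun n ξ hξ η hη ζ hζ => ?_,
    fun l hl => ?_⟩
  · exact Ordinal.toZFSet_injective ((hf α (hβ α hα).1).symm.trans hjα)
  · have := mem_vonNeumann.1 (hjV _ (hV hξ))
    rwa [hf ξ hξ, Ordinal.rank_toZFSet] at this
  · have h := hj (.inl n) ![ξ.toZFSet, η.toZFSet, ζ.toZFSet] (by
      intro (k : Fin 3)
      fin_cases k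
      exacts [hV hξ, hV hη, hV hζ])
    have hT : ∀ ξ η ζ : Ordinal.{u}, T (.inl n) ![ξ.toZFSet, η.toZFSet, ζ.toZFSet] ↔ P n ξ η ζ := by
      intro ξ η ζ
      refine ⟨?_, fun h => ⟨ξ, η, ζ, rfl, rfl, rfl, h⟩⟩
      rintro ⟨ξ', η', ζ', h1, h2, h3, h⟩
      rwa [Ordinal.toZFSet_injective h1, Ordinal.toZFSet_injective h2, Ordinal.toZFSet_injective h3]
    rw [← hT, h, ← hT (f ξ), ← hf ξ hξ, ← hf η hη, ← hf ζ hζ]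
    have he : (fun k : Fin 3 => j (![ξ.toZFSet, η.toZFSet, ζ.toZFSet] k)) =
        ![j ξ.toZFSet, j η.toZFSet, j ζ.toZFSet] := by
      funext k
      fin_cases k <;> rfl
    exact iff_of_eq (congrArg (T (.inl n)) he)
  · have hsat' : ∀ {n : ℕ} (φ : setPredLang.Formula (Fin n)) (x : Fin n → RankWith A l),
        φ.Realize x ↔ ∃ x' : Fin n → RankWith A (f l), (∀ i, j (x i).1 = (x' i).1) ∧ φ.Realize x' := by
      intro n φ x
      rw [hsat φ l x hl]
      constructor
      · rintro ⟨o, x', ho, h⟩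
        obtain rfl : f l = o := Ordinal.toZFSet_injective ((hf l hl).symm.trans ho)
        exact ⟨x', h⟩
      · rintro ⟨x', h⟩
        exact ⟨_, x', hf l hl, h⟩
    -- For `⊤` in one variable the truth relation is membership in the level indexed by `t 0`.
    have hmem : ∀ x : RankWith A l, j x.1 ∈ V_ (f l) := fun x => by
      obtain ⟨x', h, -⟩ := (hsat' (n := 1) ⊤ fun _ => x).1
        (Language.BoundedFormula.realize_top.2 trivial)
      rw [h 0]
      exact (x' 0).2
    refine ⟨⟨fun x => ⟨j x.1, hmem x⟩, fun n φ x => ?_⟩, fun _ => rfl⟩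
    rw [hsat' φ x]
    refine ⟨fun h => ⟨_, fun i => rfl, h⟩, ?_⟩
    rintro ⟨x', h, hφ⟩
    have : x' = (fun x => ⟨j x.1, hmem x⟩ : RankWith A l → RankWith A (f l)) ∘ x :=
      funext fun i => Subtype.ext (h i).symm
    subst this
    exact hφ

end VopenkaCardinal

/-! ### The critical point -/

namespace VopenkaCardinal

open Cardinal ZFSet FirstOrder

/-- `s` is a cofinal sequence of length `ω` in the ordinal `o`. -/
def IsLadder (s : ℕ → Ordinal.{u}) (o : Ordinal.{u}) : Prop :=
  (∀ n, s n < o) ∧ ∀ ξ < o, ∃ n, ξ ≤ s n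

/-- The least ordinal that is moved by `f` belongs to `C` and is regular, provided that `f` preserves
the next element of `C`, a choice of ladders, and a choice of cofinal functions. -/
theorem exists_critical_point {b : Ordinal.{u}} {f : Ordinal.{u} → Ordinal.{u}} {C : Set Ordinal.{u}}
    {nx : Ordinal.{u} → Ordinal.{u}} {lad : Ordinal.{u} → ℕ → Ordinal.{u}}
    {h : Ordinal.{u} → Ordinal.{u} → Ordinal.{u}}
    (hnx : ∀ ξ < b, ξ < nx ξ ∧ nx ξ < b ∧ nx ξ ∈ C ∧ ∀ c ∈ C, ξ < c → nx ξ ≤ c)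
    (hclosed : ∀ κ < b, κ ≠ 0 → (∀ η < κ, ∃ c ∈ C, η < c ∧ c ≤ κ) → κ ∈ C)
    (hlad : ∀ o, (∃ s, IsLadder s o) → IsLadder (lad o) o)
    (hh : ∀ o, (∀ i < o.cof.ord, h o i < o) ∧ ∀ ξ < o, ∃ i < o.cof.ord, ξ ≤ h o i)
    (hf : ∀ ξ < b, ∀ η < b, ξ < η → f ξ < f η) (hf0 : f 0 = 0)
    (hfnx : ∀ ξ < b, f (nx ξ) = nx (f ξ)) (hfC : ∀ ξ < b, ξ ∈ C → f ξ ∈ C)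
    (hflad : ∀ o < b, (∃ s, IsLadder s o) →
      (∃ s, IsLadder s (f o)) ∧ ∀ n, f (lad o n) = lad (f o) n)
    (hfcof : ∀ o < b, f o.cof.ord = (f o).cof.ord)
    (hfh : ∀ o < b, ∀ i < o.cof.ord, f (h o i) = h (f o) (f i))
    {α : Ordinal.{u}} (hα : α < b) (hfα : f α ≠ α) :
    ∃ κ ≤ α, (∀ ξ < κ, f ξ = ξ) ∧ κ < f κ ∧ κ ∈ C ∧ nx κ ≤ f κ ∧ κ ≤ κ.cof.ord := by
  have hle : ∀ ξ < b, ξ ≤ f ξ := fun ξ => by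
    induction ξ using WellFoundedLT.induction with
    | ind ξ ih =>
      intro hξ
      by_contra hlt
      rw [not_le] at hlt
      have h' := hlt.trans hξ
      exact (ih _ hlt h').not_gt (hf _ h' _ hξ hlt)
  obtain ⟨κ, hκ, hmin⟩ := WellFounded.has_min (wellFounded_lt (α := Ordinal.{u})) {ξ | f ξ ≠ ξ}
    ⟨α, hfα⟩
  have hκα : κ ≤ α := not_lt.1 (hmin α hfα)
  have hκb := hκα.trans_lt hα
  have hfix : ∀ ξ < κ, f ξ = ξ := fun ξ hξ => not_not.1 fun h' => hmin ξ h' hξ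
  have hlt : κ < f κ := (hle κ hκb).lt_of_ne (Ne.symm hκ)
  have hκ0 : κ ≠ 0 := fun h0 => hκ (by rw [h0, hf0])
  have hκC : κ ∈ C := by
    refine hclosed κ hκb hκ0 ?_
    -- Suppose that `C` has no element in the interval from `η` (excluded) to `κ`. Then `nx η` is
    -- above `κ`, and it is fixed because `η` is. The iterates of `κ` under `f` therefore stay below
    -- `nx η`, and their supremum `o` leads to a contradiction as in Kunen's theorem.
    by_contra! hη
    obtain ⟨η, hηκ, hη⟩ := hη
    have hηb := hηκ.trans hκb
    obtain ⟨h1, hcb, hcC, -⟩ := hnx η hηb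
    have hκc : κ < nx η := hη _ hcC h1
    have hfc : f (nx η) = nx η := by rw [hfnx η hηb, hfix η hηκ]
    let s : ℕ → Ordinal.{u} := fun n => f^[n] κ
    have hs : ∀ n, s (n + 1) = f (s n) := fun n => Function.iterate_succ_apply' _ _ _
    have hsc : ∀ n, s n < nx η := fun n => by
      induction n with
      | zero => exact hκc
      | succ n ih =>
        rw [hs, ← hfc]
        exact hf _ (ih.trans hcb) _ hcb ih
    have hsb : ∀ n, s n < b := fun n => (hsc n).trans hcb
    have hss : ∀ n, s n < s (n + 1) := fun n => by
      induction n with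
      | zero => exact hlt
      | succ n ih =>
        rw [hs, hs (n + 1)]
        exact hf _ (hsb _) _ (hsb _) ih
    have hbdd : BddAbove (Set.range s) := ⟨nx η, by rintro _ ⟨n, rfl⟩; exact (hsc n).le⟩
    have hsl : IsLadder s (⨆ n, s n) := by
      refine ⟨fun n => (hss n).trans_le (le_ciSup hbdd (n + 1)), fun ξ hξ => ?_⟩
      obtain ⟨n, hn⟩ := (lt_ciSup_iff hbdd).1 hξ
      exact ⟨n, hn.le⟩
    generalize ⨆ n, s n = o at hsl
    have hob : o < b := by
      refine lt_of_le_of_lt (not_lt.1 fun h' => ?_) hcb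
      obtain ⟨n, hn⟩ := hsl.2 _ h'
      exact (hsc n).not_ge hn
    obtain ⟨hl, hfl⟩ := hflad o hob ⟨s, hsl⟩
    have hlo := hlad o ⟨s, hsl⟩
    have hlf := hlad (f o) hl
    -- If `o < f o`, some ladder point of `f o` is at least `o`. It is the image of a ladder point
    -- of `o`, which is at most some `s m`, so it is below `s (m + 2)`.
    have hfo : f o = o := by
      refine le_antisymm (not_lt.1 fun h' => ?_) (hle o hob)
      obtain ⟨n, hn⟩ := hlf.2 o h'
      rw [← hfl] at hn
      obtain ⟨m, hm⟩ := hsl.2 _ (hlo.1 n)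
      have h1 := hf _ ((hlo.1 n).trans hob) _ (hsb (m + 1)) (hm.trans_lt (hss m))
      rw [← hs] at h1
      exact ((hsl.1 _).trans_le hn).not_gt h1
    obtain ⟨n, hn⟩ := hlo.2 κ (hsl.1 0)
    -- As `o` is fixed, so are its ladder points. One that is at least `κ` dominates every iterate
    -- of `κ`, although it is below their supremum.
    have hfp : f (lad o n) = lad o n := by rw [hfl, hfo]
    obtain ⟨m, hm⟩ := hsl.2 _ (hlo.1 n)
    have hlow : ∀ m, s m ≤ lad o n := fun m => by
      induction m with
      | zero => exact hn
      | succ m ih =>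
        rw [hs, ← hfp]
        rcases ih.lt_or_eq with h' | h'
        · exact (hf _ (hsb m) _ ((hlo.1 n).trans hob) h').le
        · rw [h']
    exact (hss m).not_ge ((hlow (m + 1)).trans hm)
  refine ⟨κ, hκα, hfix, hlt, hκC, (hnx κ hκb).2.2.2 _ (hfC κ hκb hκC) hlt, ?_⟩
  -- If the cofinality of `κ` were below `κ`, then `f` would fix it and all values of `h κ`. So `h
  -- (f κ)` would take the same values on that cofinality, all below `κ`, and would not be cofinal
  -- in `f κ`.
  by_contra! hcof
  have hfc : (f κ).cof.ord = κ.cof.ord := by rw [← hfcof κ hκb, hfix _ hcof]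
  obtain ⟨i, hi, hκi⟩ := (hh (f κ)).2 κ hlt
  rw [hfc] at hi
  have h1 := (hh κ).1 i hi
  have h2 := hfh κ hκb i hi
  rw [hfix _ h1, hfix _ (hi.trans hcof)] at h2
  exact (h1.trans_le hκi).ne h2

end VopenkaCardinal

/-! ### Extendible cardinals and stationarity -/

namespace VopenkaCardinal

open Cardinal ZFSet FirstOrder

/-- Here `κ` is the critical point of an embedding that preserves the data needed in
`exists_critical_point`, and `ν` is the next element of `C`. Since `ν` is at most the image of `κ`,
each `l < ν` is below that image, and the restriction to `V_l` is as required. That `ν` also belongs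
to `C` is what later extends this to all `l < δ`. -/
theorem exists_extendible_mem_club {δ : Cardinal.{u}} (hδ : IsVopenkaCardinal δ) (A : ZFSet.{u})
    {C : Set (Set.Iio δ.ord)} (hC : IsClub C) :
    ∃ κ ∈ C, ∃ ν ∈ C, κ < ν ∧ κ.1 ≤ κ.1.cof.ord ∧ ∀ l, κ.1 < l → l < ν.1 →
      ∃ θ < δ.ord, ∃ e : RankWith A l ↪ₑ[setPredLang] RankWith A θ,
        (∀ ξ < κ.1, ∀ x : RankWith A l, x.1 = ξ.toZFSet → (e x).1 = ξ.toZFSet) ∧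
        ∃ (k : RankWith A l) (μ : Ordinal.{u}),
          k.1 = κ.1.toZFSet ∧ (e k).1 = μ.toZFSet ∧ μ ≠ κ.1 ∧ l < μ := by
  classical
  have hlim := isSuccLimit_ord hδ.1.aleph0_lt.le
  have hωδ : Ordinal.omega0 < δ.ord := by rw [← ord_aleph0, ord_lt_ord]; exact hδ.1.aleph0_lt
  let C' : Set Ordinal.{u} := {c | ∃ h : c < δ.ord, ⟨c, h⟩ ∈ C}
  let nx : Ordinal.{u} → Ordinal.{u} := fun ξ => sInf {c | c ∈ C' ∧ ξ < c}
  have hnx : ∀ ξ < δ.ord, nx ξ ∈ C' ∧ ξ < nx ξ := fun ξ hξ => by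
    obtain ⟨c, hc, hle⟩ := hC.isCofinal ⟨_, hlim.succ_lt hξ⟩
    exact csInf_mem (s := {c | c ∈ C' ∧ ξ < c})
      ⟨c.1, ⟨c.2, hc⟩, (Order.lt_succ ξ).trans_le hle⟩
  have hnx_le : ∀ ξ, ∀ c ∈ C', ξ < c → nx ξ ≤ c := fun ξ c hc h => csInf_le' ⟨hc, h⟩
  have hclosed : ∀ κ < δ.ord, κ ≠ 0 → (∀ η < κ, ∃ c ∈ C', η < c ∧ c ≤ κ) → κ ∈ C' := by
    intro κ hκ hκ0 h
    refine ⟨hκ, hC.isLUB_mem (t := {c | c ∈ C ∧ c.1 ≤ κ}) (fun c hc => hc.1) ?_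
      ⟨fun c hc => hc.2, fun d hd => ?_⟩⟩
    · obtain ⟨c, ⟨hcδ, hc⟩, -, hcκ⟩ := h 0 (pos_iff_ne_zero.2 hκ0)
      exact ⟨⟨c, hcδ⟩, hc, hcκ⟩
    · by_contra hlt
      rw [not_le] at hlt
      obtain ⟨c, ⟨hcδ, hc⟩, hdc, hcκ⟩ := h d.1 hlt
      exact (show c ≤ d.1 from hd (a := ⟨c, hcδ⟩) ⟨hc, hcκ⟩).not_gt hdc
  -- The level must be closed under `nx`, so that the critical point argument takes place below `β`.
  have hβ : ∀ α, ∃ β, α < δ.ord → α < β ∧ β < δ.ord ∧ Order.IsSuccLimit β ∧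
      Ordinal.omega0 ≤ β ∧ ∀ ξ < β, nx ξ < β := fun α => by
    by_cases hα : α < δ.ord
    swap
    · exact ⟨0, fun h => absurd h hα⟩
    obtain ⟨β, ⟨h1, h2⟩, -⟩ := (isClub_closurePoints hδ.1 nx (fun ξ hξ => (hnx ξ hξ).1.1)
      (max_lt hα hωδ)).isCofinal ⟨α, hα⟩
    have h3 := (le_max_right _ _).trans_lt h1
    refine ⟨β.1, fun _ => ⟨(le_max_left _ _).trans_lt h1, β.2, ?_, h3.le, h2⟩⟩
    refine Order.isSuccLimit_iff_of_orderBot.2 ⟨(Ordinal.omega0_pos.trans h3).ne',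
      Order.isSuccPrelimit_of_succ_lt fun ξ hξ => ?_⟩
    exact (Order.succ_le_of_lt (hnx ξ (hξ.trans β.2)).2).trans_lt (h2 ξ hξ)
  choose β hβ using hβ
  have hladder : ∀ o : Ordinal.{u}, ∃ s, (∃ s, IsLadder s o) → IsLadder s o := fun o => by
    by_cases h : ∃ s, IsLadder s o
    · exact ⟨h.choose, fun _ => h.choose_spec⟩
    · exact ⟨fun _ => 0, fun h' => absurd h' h⟩
  choose lad hlad using hladder
  have hcofinal : ∀ o : Ordinal.{u}, ∃ h : Ordinal.{u} → Ordinal.{u},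
      (∀ i < o.cof.ord, h i < o) ∧ ∀ ξ < o, ∃ i < o.cof.ord, ξ ≤ h i := fun o => by
    obtain ⟨g, hg⟩ := Ordinal.exists_isFundamentalSeq (o := o) rfl
    have hk : ∀ i, ∃ ξ, ∀ hi : i ∈ Set.Iio o.cof.ord, (g ⟨i, hi⟩).1 = ξ := fun i => by
      by_cases hi : i ∈ Set.Iio o.cof.ord
      · exact ⟨(g ⟨i, hi⟩).1, fun _ => rfl⟩
      · exact ⟨0, fun h => absurd h hi⟩
    choose k hk using hk
    refine ⟨k, fun i hi => hk i hi ▸ (g ⟨i, hi⟩).2, fun ξ hξ => ?_⟩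
    obtain ⟨_, ⟨i, rfl⟩, hi⟩ := hg.isCofinal_range ⟨ξ, hξ⟩
    exact ⟨i.1, i.2, hk i.1 i.2 ▸ hi⟩
  choose h hh using hcofinal
  -- All functions and predicates to be preserved, as one sequence of ternary relations on ordinals.
  -- The arguments that a relation ignores are later filled with 0.
  let P : ℕ → Ordinal.{u} → Ordinal.{u} → Ordinal.{u} → Prop := fun n => match n with
    | 0 => fun ξ η _ => ξ < η
    | 1 => fun ξ _ _ => ξ = 0
    | 2 => fun ξ η _ => nx ξ = η
    | 3 => fun ξ η ζ => h ξ η = ζ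
    | 4 => fun ξ η _ => ξ.cof.ord = η
    | 5 => fun ξ _ _ => ∃ s, IsLadder s ξ
    | 6 => fun ξ _ _ => ξ ∈ C'
    | n + 7 => fun ξ η _ => lad ξ n = η
  obtain ⟨α, hα, α', hα', hne, j, f, hfα, hf, hfP, hemb⟩ := exists_ordinal_embedding hδ A P β
    fun α hα => ⟨(hβ α hα).1, (hβ α hα).2.1, (hβ α hα).2.2.1, (hβ α hα).2.2.2.1⟩
  obtain ⟨hαβ, hβδ, hβlim, -, hβnx⟩ := hβ α hα
  obtain ⟨-, hβδ', -⟩ := hβ α' hα'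
  have hcof_lt : ∀ o < β α, o.cof.ord < β α := fun o ho => (Ordinal.ord_cof_le o).trans_lt ho
  have h0 : 0 < β α := hβlim.bot_lt
  obtain ⟨κ, hκα, hfix, hκ, hκC, hν, hreg⟩ := exists_critical_point (b := β α) (f := f) (C := C')
    (nx := nx) (lad := lad) (h := h) (α := α)
    (fun ξ hξ => ⟨(hnx ξ (hξ.trans hβδ)).2, hβnx ξ hξ, (hnx ξ (hξ.trans hβδ)).1, hnx_le ξ⟩)
    (fun κ hκ => hclosed κ (hκ.trans hβδ)) hlad hh
    (fun ξ hξ η hη => (hfP 0 ξ hξ η hη 0 h0).1)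
    ((hfP 1 0 h0 0 h0 0 h0).1 rfl)
    (fun ξ hξ => ((hfP 2 ξ hξ _ (hβnx ξ hξ) 0 h0).1 rfl).symm)
    (fun ξ hξ => (hfP 6 ξ hξ 0 h0 0 h0).1)
    (fun o ho hs => ⟨(hfP 5 o ho 0 h0 0 h0).1 hs, fun n =>
      ((hfP (n + 7) o ho _ (((hlad o hs).1 n).trans ho) 0 h0).1 rfl).symm⟩)
    (fun o ho => ((hfP 4 o ho _ (hcof_lt o ho) 0 h0).1 rfl).symm)
    (fun o ho i hi => ((hfP 3 o ho i (hi.trans (hcof_lt o ho)) _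
      (((hh o).1 i hi).trans ho)).1 rfl).symm)
    hαβ (fun h => hne (h.symm.trans hfα))
  have hκβ := hκα.trans_lt hαβ
  have hκδ := hκβ.trans hβδ
  obtain ⟨⟨hνδ, hνC⟩, hκν⟩ := hnx κ hκδ
  refine ⟨⟨κ, hκδ⟩, hκC.2, ⟨nx κ, hνδ⟩, hνC, hκν, hreg, fun l hκl hlν => ?_⟩
  have hlβ : l < β α := hlν.trans (hβnx κ hκβ)
  obtain ⟨e, he⟩ := hemb l hlβ
  refine ⟨f l, (hf l hlβ).1.trans hβδ', e, fun ξ hξ x hx => ?_, ⟨κ.toZFSet, ?_⟩, f κ, rfl, ?_,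
    hκ.ne', hlν.trans_le hν⟩
  · rw [he, hx, (hf ξ (hξ.trans hκβ)).2, hfix ξ hξ]
  · exact mem_vonNeumann.2 (by rwa [Ordinal.rank_toZFSet])
  · exact (he _).trans (hf κ hκβ).2

/-- Members of the club of Vopěnka-scheme cardinals are uncountable strong limits, and critical
points are regular. -/
theorem isStationary_isInaccessible {δ : Cardinal.{u}} (hδ : IsVopenkaCardinal δ) :
    IsStationary {α : Set.Iio δ.ord | ∃ γ : Cardinal.{u}, γ.ord = α.1 ∧ γ.IsInaccessible ∧
      IsVopenkaSchemeCardinal γ} := by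
  intro D hD
  obtain ⟨C, hC, hCγ⟩ := exists_club_isVopenkaSchemeCardinal hδ
  obtain ⟨κ, hκ, -, -, -, hreg, -⟩ := exists_extendible_mem_club hδ ∅
    (hD.inter (cof_Iio_ne hδ.1) hC)
  obtain ⟨γ, hγ, hω, hsl, hV⟩ := hCγ κ hκ.2
  refine ⟨κ, ⟨γ, hγ, ⟨hω, ?_, hsl.isStrongPrelimit⟩, hV⟩, hκ.1⟩
  rwa [← ord_le_ord, hγ]

/-- Let `H κ` be an `l` at which extendibility of `κ` fails, if there is one. When `ν` is a closure
point of `H` above `κ`, such an `l` is below `ν`, where an embedding does exist. -/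
theorem isStationary_isExtendibleBelow {δ : Cardinal.{u}} (hδ : IsVopenkaCardinal δ)
    (A : ZFSet.{u}) :
    IsStationary {α : Set.Iio δ.ord | ∃ γ : Cardinal.{u}, γ.ord = α.1 ∧
      IsExtendibleBelow δ A γ ∧ IsVopenkaSchemeCardinal γ} := by
  intro D hD
  obtain ⟨C, hC, hCγ⟩ := exists_club_isVopenkaSchemeCardinal hδ
  let Ext : Ordinal.{u} → Ordinal.{u} → Prop := fun κ l =>
    ∃ θ < δ.ord, ∃ e : RankWith A l ↪ₑ[setPredLang] RankWith A θ,
      (∀ ξ < κ, ∀ x : RankWith A l, x.1 = ξ.toZFSet → (e x).1 = ξ.toZFSet) ∧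
      ∃ (k : RankWith A l) (μ : Ordinal.{u}),
        k.1 = κ.toZFSet ∧ (e k).1 = μ.toZFSet ∧ μ ≠ κ ∧ l < μ
  have h0 : 0 < δ.ord := (isSuccLimit_ord hδ.1.aleph0_lt.le).bot_lt
  have hH : ∀ κ, ∃ l < δ.ord, (∀ l, κ < l → l < δ.ord → Ext κ l) ∨ κ < l ∧ ¬ Ext κ l := fun κ => by
    by_cases h : ∀ l, κ < l → l < δ.ord → Ext κ l
    · exact ⟨0, h0, Or.inl h⟩
    · push Not at h
      obtain ⟨l, h1, h2, h3⟩ := h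
      exact ⟨l, h2, Or.inr ⟨h1, h3⟩⟩
  choose H hHδ hH using hH
  obtain ⟨κ, hκ, ν, hν, hlt, -, hemb⟩ := exists_extendible_mem_club hδ A
    ((hD.inter (cof_Iio_ne hδ.1) hC).inter (cof_Iio_ne hδ.1)
      (isClub_closurePoints hδ.1 H (fun ξ _ => hHδ ξ) h0))
  obtain ⟨γ, hγ, -, -, hV⟩ := hCγ κ hκ.1.2
  refine ⟨κ, ⟨γ, hγ, ⟨ord_lt_ord.1 (hγ ▸ κ.2), ?_⟩, hV⟩, hκ.1.1⟩
  rw [hγ]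
  rcases hH κ.1 with h | ⟨h1, h2⟩
  · exact h
  · exact absurd (hemb _ h1 (hν.2.2 _ hlt)) h2

end VopenkaCardinal

theorem corollary2p5 :
    (∀ δ : Cardinal.{u}, IsVopenkaCardinal δ →
      (∃ C : Set (Set.Iio δ.ord), IsClub C ∧
        ∀ α ∈ C, ∃ γ : Cardinal.{u}, γ.ord = α.1 ∧ IsVopenkaSchemeCardinal γ) ∧
      IsStationary {α : Set.Iio δ.ord |
        ∃ γ : Cardinal.{u}, γ.ord = α.1 ∧ γ.IsInaccessible ∧ IsVopenkaSchemeCardinal γ} ∧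
      ∀ A : ZFSet.{u}, A ⊆ ZFSet.vonNeumann δ.ord →
        IsStationary {α : Set.Iio δ.ord |
          ∃ γ : Cardinal.{u}, γ.ord = α.1 ∧ IsExtendibleBelow δ A γ ∧
            IsVopenkaSchemeCardinal γ}) ∧
    (ConsistentWithZFC.{v} ExistsVopenkaCardinal →
      ConsistentWithZFC.{v} ExistsVopenkaSchemeCardinal) ∧
    ZFCPlusProves.{v} ExistsVopenkaCardinal (ConSentence ExistsVopenkaSchemeCardinal) := by
  refine ⟨fun δ hδ => ⟨?_, VopenkaCardinal.isStationary_isInaccessible hδ,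
    fun A _ => VopenkaCardinal.isStationary_isExtendibleBelow hδ A⟩, ?_, ?_⟩
  · obtain ⟨C, hC, hCγ⟩ := VopenkaCardinal.exists_club_isVopenkaSchemeCardinal hδ
    refine ⟨C, hC, fun α hα => ?_⟩
    obtain ⟨γ, hγ, -, -, hV⟩ := hCγ α hα
    exact ⟨γ, hγ, hV⟩
  · rintro ⟨M, E, hM, h⟩
    -- The model itself already has a Vopěnka-scheme cardinal.
    exact ⟨M, E, hM, existsVopenkaSchemeCardinal_of_existsVopenkaCardinal hM h⟩
  · intro M E hM h
    exact conSentence_of_existsVopenkaCardinal hM h
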